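/- **Setting.** Let $k=\mathbb F_q$, $A=k[T]$, $F=k(T)$, let $\infty$ be the place of $F$ at infinity, $\mathbb A=\mathbb A_f\times F_\infty$ the adeles of $F$, $\mathcal O=\mathcal O_f\times\mathcal O_\infty$ the maximal compact subring, $|y|=q^{-\deg y}$ the normalized absolute value of an idele, divisor or ideal (so $|\mathfrak r|=q^{-\deg\mathfrak r}$ for a nonzero ideal $\mathfrak r$ of $A$), and $\infty(\cdot)$ the additive valuation of $F_\infty$. Put $\infty(u,v)=\min(\infty(u),\infty(v))$ on $F_\infty^2$. Let $Z$ be the centre of $GL_2$. Let $\mathfrak n\mid\mathfrak m$ be nonzero ideals of $A$. For an ideal $\mathfrak a$ of $A$ let $\mathbb K_0(\mathfrak a\infty)$ be the group of $\left(\begin{smallmatrix}a&b\\c&d\end{smallmatrix}\right)\in GL_2(\mathcal O)$ with $c_f\in\mathfrak a\mathcal O_f$ and $\infty(c_\infty)>0$. Let $\mu_G$ be the Haar measure on $GL_2(\mathbb A)/Z(\mathbb A)$ giving the image of $GL_2(\mathcal O)$ measure $1$, and also the induced measure on $Z(\mathbb A)GL_2(F)\backslash GL_2(\mathbb A)$ (i.e.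 integrate over a fundamental domain for the image of $GL_2(F)$). Put $$\mu(\mathfrak m)=(q-1)\,\mu_G\big(Z(\mathcal O)\backslash\mathbb K_0(\mathfrak m\infty)\big).$$ **Characters.** Let $\chi:\mathbb A_f^*\to\mathbb C^*$ be a non-trivial continuous character trivial on $F^*$ and on $\{u\in\mathcal O_f^*: u\equiv1 \bmod \mathfrak m\}$. For $u\in\mathcal O_f$ let $\chi_0(u)=\chi(z)$ if $u\equiv z\bmod\mathfrak m$ with $z\in\mathcal O_f^*$, and $\chi_0(u)=0$ if there is no such $z$. For a nonzero ideal $\mathfrak q=(a)$ of $A$ prime to $\mathfrak m$ let $\chi(\mathfrak q)=\chi_0(a)$. Let $\chi_1(\alpha,\beta)=\chi_0(\alpha)$, and let $\chi_2(\alpha,\beta)=\chi_0(\beta)$ if $\alpha\in\mathfrak m\mathcal O_f$ and $0$ otherwise. Let $G$ be a finite quotient (with open kernel) of $F^*\backslash\mathbb A^*/\mathcal O_f^*$, write $y\mapsto y^G$ for the quotient map, and $\mathfrak q^G=y^G$ for any $y\in\mathbb A_f^*$ with divisor $\mathfrak q$. Convergence and integration in $\mathbb C[G]$ are understood coefficientwise.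 **Eisenstein series.** For $g\in GL_2(\mathbb A)$ let $V(g)$ (resp. $U(g)$) be the set of $0\ne f\in F^2$ with $fg_f\in\mathcal O_f^2$ such that $fg_\infty=(a,b)$ satisfies $|a|<|b|$ (resp. $|a|\ge|b|$), and put $$E^G_{\mathfrak m}(\chi,g,x,y)=\chi(\det g_f)^{-1}\det(g_f^{-1})^G(xy)^{\deg\det g}\sum_{f\in U(g),\,h\in V(g)}\chi_1(fg_f)\chi_2(hg_f)\det\binom fh_\infty^{G}x^{-2\infty(fg_\infty)}y^{-2\infty(hg_\infty)}.$$ Let $L^G_{\mathfrak m}(\chi,x)=\sum_{(\mathfrak q,\mathfrak m)=1}\chi(\mathfrak q)(\mathfrak q^G)^{-1}x^{\deg\mathfrak q}$ and $\sigma^G_{\mathfrak m}(\chi,\mathfrak r,x)=\sum_{\mathfrak q\mid\mathfrak r,(\mathfrak q,\mathfrak m)=1}\chi(\mathfrak q)(\mathfrak q^G)^{-1}x^{\deg\mathfrak q}$. **Elliptic curve.** Let $E/F$ be an elliptic curve with split multiplicative reduction at $\infty$. Let $\psi_E^*$ be the multiplicative function on effective divisors (extended by $0$ to the other divisors) with $L_x(E,t)=\sum_n\psi_E^*(x^n)t^{n\deg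 x}$ for the Hasse–Weil local factor at each place $x$. Let $\tau$ be a non-trivial continuous character of $F\backslash\mathbb A$ and $\mathfrak d$ an idele with $\{x\in\mathbb A:\tau(x\mathcal O)=1\}=\mathfrak d\mathcal O$. Let $\phi_E:GL_2(\mathbb A)\to\mathbb Q$ be a normalized Hecke eigenform attached to $E$ of level $\mathfrak n\infty$ (in particular this applies to the unique one when $\mathfrak n\infty$ is the conductor of $E$), that is, a locally constant function such that: * $\phi_E(\gamma g\kappa z)=\phi_E(g)$ for $\gamma\in GL_2(F)$, $\kappa\in\mathbb K_0(\mathfrak n\infty)$, $z\in Z(\mathbb A)$; * $\int_{F\backslash\mathbb A}\phi_E\big(\left(\begin{smallmatrix}1&x\\0&1\end{smallmatrix}\right)g\big)dx=0$ for all $g$; * $\phi_E\big(g\left(\begin{smallmatrix}0&1\\\pi&0\end{smallmatrix}\right)\big)=-\phi_E(g)$ for all uniformizers $\pi$ of $F_\infty$, and $\phi_E\big(g\left(\begin{smallmatrix}0&1\\1&0\end{smallmatrix}\right)\big)+\sum_{\epsilon\in k}\phi_E\big(g\left(\begin{smallmatrix}1&0\\\epsilon&1\end{smallmatrix}\right)\big)=0$,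 with the matrices in $GL_2(F_\infty)\subset GL_2(\mathbb A)$; * $\phi_E\left(\begin{smallmatrix}x\mathfrak d&y\\0&1\end{smallmatrix}\right)=\sum_{\eta\in F^*}|\eta x|\,\psi_E^*(\operatorname{div}(\eta x))\,\tau(\eta y)$ for all $x\in\mathbb A^*$, $y\in\mathbb A$. **Theorem.** Let $\mathrm{Re}(s)>1$ and $\mathrm{Re}(t)>1$. The series defining $E^G_{\mathfrak m}(\chi,g,q^{-s},q^{-t})$ converges absolutely for every $g$, its sum is left invariant under $GL_2(F)$ and right invariant under $Z(\mathbb A)$, and $E^G_{\mathfrak m}(\chi,\cdot,q^{-s},q^{-t})\phi_E$ is integrable on $Z(\mathbb A)GL_2(F)\backslash GL_2(\mathbb A)$. The series $L^G_{\mathfrak m}(\chi,q^{-2t})$ converges absolutely, and so does the series $\sum_{d\ge0}\big(\sum_{\deg\mathfrak r=d}|\mathfrak r|^{1+t-s}\sigma^G_{\mathfrak m}(\chi,\mathfrak r,q^{1-2s})\psi_E^*(\mathfrak r)\big)$. If moreover $q^{s-t-1}\neq1$, then $$\int_{Z(\mathbb A)GL_2(F)\backslash GL_2(\mathbb A)}E^G_{\mathfrak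 m}(\chi,g,q^{-s},q^{-t})\,\phi_E(g)\,d\mu_G(g)=(q-1)\mu(\mathfrak m)L^G_{\mathfrak m}(\chi,q^{-2t})\frac{|\mathfrak d|^{t-s}}{1-q^{s-t-1}}\sum_{d\ge0}\ \sum_{\substack{0\ne\mathfrak r\triangleleft A\\ \deg\mathfrak r=d}}|\mathfrak r|^{1+t-s}\sigma^G_{\mathfrak m}(\chi,\mathfrak r,q^{1-2s})\psi_E^*(\mathfrak r).$$ -/

import Mathlib

open Polynomial IsDedekindDomain MeasureTheory
open scoped Matrix

noncomputable section

namespace RankinSelberg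

/-! ### The rational function field `F = k(T)`, its places, its adeles and its ideles

`k` is a finite field with `q` elements, `A = k[T]`, and the closed points of the projective line
are the maximal ideals of `A` (the finite places) and the place at infinity. -/

/-- The completion of `F` at infinity. -/
abbrev FInf (k : Type*) [Field k] : Type _ :=
  @RatFunc.CompletionAtInfty k _ (Classical.decEq _)

/-- The finite adeles of `F`. -/
abbrev FinAdele (k : Type*) [Field k] : Type _ := FiniteAdeleRing k[X] (RatFunc k)

/-- The adeles of `F`. -/
abbrev Adele (k : Type*) [Field k] : Type _ := FinAdele k × FInf k

/-- The adelic group `GL₂(𝔸)`. -/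
abbrev GL2A (k : Type*) [Field k] : Type _ := GL (Fin 2) (Adele k)

/-- The group `GL₂(𝔸) / Z(𝔸)`, where `Z(𝔸)` is the centre. -/
abbrev PGL2A (k : Type*) [Field k] : Type _ := GL2A k ⧸ Subgroup.center (GL2A k)

instance (k : Type*) [Field k] : MeasurableSpace (PGL2A k) := borel _

instance (k : Type*) [Field k] : BorelSpace (PGL2A k) := ⟨rfl⟩

/-- The subgroup `F` of `𝔸`, embedded diagonally. -/
abbrev principalAdeles (k : Type*) [Field k] : AddSubgroup (Adele k) :=
  (algebraMap (RatFunc k) (Adele k)).toAddMonoidHom.range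

instance (k : Type*) [Field k] : MeasurableSpace (Adele k ⧸ principalAdeles k) := borel _

instance (k : Type*) [Field k] : BorelSpace (Adele k ⧸ principalAdeles k) := ⟨rfl⟩

section Ideles

variable {k : Type*} [Field k]

/-- Membership in `𝒪_f`, the product of the `𝒪_v` over the finite places `v`. -/
def IsFinIntegral (x : FinAdele k) : Prop :=
  ∀ v : HeightOneSpectrum k[X], x v ∈ v.adicCompletionIntegers (RatFunc k)

/-- Membership in `𝒪`, the maximal compact subring of `𝔸`. -/
def IsIntegralAdele (x : Adele k) : Prop := IsFinIntegral x.1 ∧ Valued.v x.2 ≤ 1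

/-- A generator of the ideal `r` of `A`, as a finite adele. -/
def finGen (r : Ideal k[X]) : FinAdele k :=
  algebraMap (RatFunc k) (FinAdele k)
    (algebraMap k[X] (RatFunc k) (Submodule.IsPrincipal.generator r))

/-- Membership in `𝔪𝒪_f`. -/
def InIdeal (m : Ideal k[X]) (x : FinAdele k) : Prop := ∃ y, IsFinIntegral y ∧ x = finGen m * y

/-- The diagonal embedding `F^* → 𝔸^*`. -/
def diagUnit (k : Type*) [Field k] : (RatFunc k)ˣ →* (Adele k)ˣ :=
  Units.map (algebraMap (RatFunc k) (Adele k)).toMonoidHom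

/-- The diagonal embedding `F^* → 𝔸_f^*`. -/
def finDiagUnit (k : Type*) [Field k] : (RatFunc k)ˣ →* (FinAdele k)ˣ :=
  Units.map (algebraMap (RatFunc k) (FinAdele k)).toMonoidHom

/-- The finite component `𝔸^* → 𝔸_f^*`. -/
def finPart (x : (Adele k)ˣ) : (FinAdele k)ˣ := (MulEquiv.prodUnits x).1

/-- The embedding `𝔸_f^* ⊆ 𝔸^*`. -/
def ofFin (x : (FinAdele k)ˣ) : (Adele k)ˣ := MulEquiv.prodUnits.symm (x, 1)

/-- The embedding `F_∞^* ⊆ 𝔸^*`. -/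
def ofInf (x : (FInf k)ˣ) : (Adele k)ˣ := MulEquiv.prodUnits.symm (1, x)

/-- The degree of a nonzero ideal of `A`. -/
def idealDeg (r : Ideal k[X]) : ℕ := (Submodule.IsPrincipal.generator r).natDegree

/-- The absolute value `|𝔯| = q^{-deg 𝔯}` of a nonzero ideal of `A`. -/
def idealAbs (r : Ideal k[X]) : ℝ := (Nat.card k : ℝ) ^ (-(idealDeg r : ℤ))

/-- The group of divisors: a family of integers indexed by the finite places, almost all zero,
and one more integer, the multiplicity of the place at infinity. -/
abbrev Divisor (k : Type*) [Field k] : Type _ := (HeightOneSpectrum k[X] →₀ ℤ) × ℤ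

/-- The additive valuation on the completion at infinity (with the value `0` at `0`). -/
def ordInf (x : FInf k) : ℤ := -WithZero.log (Valued.v x)

/-- The divisor of a finite idele. -/
def finDiv (x : (FinAdele k)ˣ) : HeightOneSpectrum k[X] →₀ ℤ :=
  Finsupp.ofSupportFinite (fun v => -WithZero.log (Valued.v ((x : FinAdele k) v))) <| by
    have h := (FiniteAdeleRing.isUnit_iff.mp x.isUnit).2
    rw [Filter.eventually_cofinite] at h
    refine h.subset fun v hv => ?_
    intro h1
    apply hv
    simp [h1]

/-- The divisor of an idele. -/
def ideleDiv (x : (Adele k)ˣ) : Divisor k := (finDiv (finPart x), ordInf (x : Adele k).2)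

/-- The degree of a divisor. -/
def Divisor.deg (D : Divisor k) : ℤ := (D.1.sum fun v n => n * (idealDeg v.asIdeal : ℤ)) + D.2

/-- The absolute value `|D| = q^{-deg D}` of a divisor. -/
def Divisor.abs (D : Divisor k) : ℝ := (Nat.card k : ℝ) ^ (-Divisor.deg D)

/-- Effective divisors. -/
def Divisor.IsEffective (D : Divisor k) : Prop := (∀ v, 0 ≤ D.1 v) ∧ 0 ≤ D.2

/-- The degree of an idele. -/
def ideleDeg (x : (Adele k)ˣ) : ℤ := Divisor.deg (ideleDiv x)

/-- The normalized absolute value of an idele. -/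
def ideleAbs (x : (Adele k)ˣ) : ℝ := Divisor.abs (ideleDiv x)

open scoped Classical in
/-- A generator of the nonzero ideal `r` of `A` as a finite idele: a finite idele with divisor
`r`. (For `r = 0` this is `1`.) -/
def finGenUnit (r : Ideal k[X]) : (FinAdele k)ˣ :=
  if h : Submodule.IsPrincipal.generator r = 0 then 1
  else finDiagUnit k (Units.mk0 (algebraMap k[X] (RatFunc k) (Submodule.IsPrincipal.generator r))
    ((map_ne_zero_iff _ (IsFractionRing.injective k[X] (RatFunc k))).mpr h))

end Ideles

/-! ### Subgroups and elements of `GL₂(𝔸)` -/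

section Matrices

variable {k : Type*} [Field k]

/-- `GL₂(𝒪)`. -/
def GL2O (k : Type*) [Field k] : Set (GL2A k) :=
  {g | ∀ i j, IsIntegralAdele (g i j) ∧ IsIntegralAdele (g⁻¹ i j)}

/-- `𝕂₀(𝔫∞)`: the matrices in `GL₂(𝒪)` whose lower left entry is divisible by `𝔫∞`. -/
def K0Inf (n : Ideal k[X]) : Set (GL2A k) :=
  {g | g ∈ GL2O k ∧ InIdeal n (g 1 0).1 ∧ Valued.v (g 1 0).2 < 1}

/-- The diagonal embedding `GL₂(F) → GL₂(𝔸)`. -/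
def diagGL (k : Type*) [Field k] : GL (Fin 2) (RatFunc k) →* GL2A k :=
  Matrix.GeneralLinearGroup.map (algebraMap (RatFunc k) (Adele k))

/-- The image of `GL₂(F)` in `GL₂(𝔸) / Z(𝔸)`. -/
def rationalSubgroup (k : Type*) [Field k] : Subgroup (PGL2A k) :=
  ((QuotientGroup.mk' (Subgroup.center (GL2A k))).comp (diagGL k)).range

/-- The embedding `GL₂(F_∞) ⊆ GL₂(𝔸)`. -/
def infGL (g : GL (Fin 2) (FInf k)) : GL2A k where
  val := Matrix.of fun i j => ((1 : Matrix (Fin 2) (Fin 2) (FinAdele k)) i j, g i j)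
  inv := Matrix.of fun i j => ((1 : Matrix (Fin 2) (Fin 2) (FinAdele k)) i j, g⁻¹ i j)
  val_inv := by
    have h : (g : Matrix (Fin 2) (Fin 2) (FInf k)) * (g⁻¹ : GL (Fin 2) (FInf k)) = 1 := g.mul_inv
    ext1 i j
    have hij := congrFun (congrFun h i) j
    rw [Matrix.mul_apply, Fin.sum_univ_two] at hij ⊢
    refine Prod.ext ?_ ?_
    · fin_cases i <;> fin_cases j <;> simp
    · refine hij.trans ?_
      fin_cases i <;> fin_cases j <;> simp
  inv_val := by
    have h : ((g⁻¹ : GL (Fin 2) (FInf k)) : Matrix (Fin 2) (Fin 2) (FInf k)) * g = 1 := g.inv_mul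
    ext1 i j
    have hij := congrFun (congrFun h i) j
    rw [Matrix.mul_apply, Fin.sum_univ_two] at hij ⊢
    refine Prod.ext ?_ ?_
    · fin_cases i <;> fin_cases j <;> simp
    · refine hij.trans ?_
      fin_cases i <;> fin_cases j <;> simp

/-- The matrix `(x y; 0 1)` over a commutative ring, for a unit `x`. -/
def affineGL {R : Type*} [CommRing R] (x : Rˣ) (y : R) : GL (Fin 2) R where
  val := !![(x : R), y; 0, 1]
  inv := !![((x⁻¹ : Rˣ) : R), -((x⁻¹ : Rˣ) : R) * y; 0, 1]
  val_inv := by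
    ext i j
    fin_cases i <;> fin_cases j <;> simp [Matrix.mul_apply, Fin.sum_univ_two]
  inv_val := by
    ext i j
    fin_cases i <;> fin_cases j <;> simp [Matrix.mul_apply, Fin.sum_univ_two]

/-- The matrix `(1 0; c 1)`. -/
def lowerGL {R : Type*} [CommRing R] (c : R) : GL (Fin 2) R where
  val := !![1, 0; c, 1]
  inv := !![1, 0; -c, 1]
  val_inv := by
    ext i j
    fin_cases i <;> fin_cases j <;> simp [Matrix.mul_apply, Fin.sum_univ_two]
  inv_val := by
    ext i j
    fin_cases i <;> fin_cases j <;> simp [Matrix.mul_apply, Fin.sum_univ_two]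

/-- The matrix `(0 1; c 0)`, for a unit `c`. -/
def antiGL {R : Type*} [CommRing R] (c : Rˣ) : GL (Fin 2) R where
  val := !![0, 1; (c : R), 0]
  inv := !![0, ((c⁻¹ : Rˣ) : R); 1, 0]
  val_inv := by
    ext i j
    fin_cases i <;> fin_cases j <;> simp [Matrix.mul_apply, Fin.sum_univ_two]
  inv_val := by
    ext i j
    fin_cases i <;> fin_cases j <;> simp [Matrix.mul_apply, Fin.sum_univ_two]

end Matrices

/-! ### Dirichlet characters and finite quotients of the idele class group -/

section Characters

variable {k : Type*} [Field k]

/-- `χ` is a Dirichlet character of conductor (dividing) `𝔪`: a continuous homomorphism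
`𝔸_f^* → ℂ^*` trivial on `F^*` and on `𝒪_𝔪 = {u ∈ 𝒪_f^* : u ≡ 1 mod 𝔪}`. -/
structure IsDirichletCharacter (m : Ideal k[X]) (χ : (FinAdele k)ˣ →* ℂˣ) : Prop where
  continuous : Continuous χ
  trivial_principal : ∀ a : (RatFunc k)ˣ, χ (finDiagUnit k a) = 1
  trivial_congruence : ∀ u : (FinAdele k)ˣ, IsFinIntegral (u : FinAdele k) →
    IsFinIntegral ((u⁻¹ : (FinAdele k)ˣ) : FinAdele k) → InIdeal m ((u : FinAdele k) - 1) → χ u = 1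

open scoped Classical in
/-- The function `χ₀` on `𝒪_f`: the value at `u` is `χ(z)` for any `z ∈ 𝒪_f^*` congruent to `u`
modulo `𝔪` if there is one, that is, if the class of `u` in `𝒪_f/𝔪` is a unit, and `0` otherwise. -/
def chi0 (m : Ideal k[X]) (χ : (FinAdele k)ˣ →* ℂˣ) (u : FinAdele k) : ℂ :=
  if h : ∃ z : (FinAdele k)ˣ, IsFinIntegral (z : FinAdele k) ∧
      IsFinIntegral ((z⁻¹ : (FinAdele k)ˣ) : FinAdele k) ∧ InIdeal m (u - z)
  then (χ h.choose : ℂ) else 0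

/-- The value of `χ` at a nonzero ideal prime to `𝔪`: the value of `χ₀` at a generator. -/
def chiIdeal (m : Ideal k[X]) (χ : (FinAdele k)ˣ →* ℂˣ) (r : Ideal k[X]) : ℂ :=
  chi0 m χ (finGen r)

/-- `G`, with the map `pr`, is a (topological) finite quotient group of `F^* \ 𝔸^* / 𝒪_f^*`. -/
structure IsFiniteQuotient {G : Type*} [CommGroup G] (pr : (Adele k)ˣ →* G) : Prop where
  surjective : Function.Surjective pr
  isOpen_ker : IsOpen (pr.ker : Set (Adele k)ˣ)
  trivial_principal : ∀ a : (RatFunc k)ˣ, pr (diagUnit k a) = 1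
  trivial_integral : ∀ u : (FinAdele k)ˣ, IsFinIntegral (u : FinAdele k) →
    IsFinIntegral ((u⁻¹ : (FinAdele k)ˣ) : FinAdele k) → pr (ofFin u) = 1

open scoped Classical in
/-- The image `d_∞^G` in `G` of the component at infinity of `d ∈ F^*` (and `1` for `d = 0`). -/
def infClass {G : Type*} [CommGroup G] (pr : (Adele k)ˣ →* G) (d : RatFunc k) : G :=
  if h : d = 0 then 1
  else pr (ofInf (Units.mk0 (algebraMap (RatFunc k) (FInf k) d)
    ((map_ne_zero (algebraMap (RatFunc k) (FInf k))).mpr h)))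

/-- The class `𝔮^G` in `G` of a nonzero ideal of `A`. -/
def idealClass {G : Type*} [CommGroup G] (pr : (Adele k)ˣ →* G) (r : Ideal k[X]) : G :=
  pr (ofFin (finGenUnit r))

end Characters

/-! ### Series in the group algebra `ℂ[G]` of a finite group -/

section Series

variable {G ι : Type*}

/-- Absolute convergence of a series in `ℂ[G]`. -/
def GSummable (f : ι → MonoidAlgebra ℂ G) : Prop := ∀ h : G, Summable fun i => (f i).coeff h

/-- The sum of a series in `ℂ[G]`, for a finite group `G`, computed on coefficients. -/
def gsum [Finite G] (f : ι → MonoidAlgebra ℂ G) : MonoidAlgebra ℂ G :=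
  MonoidAlgebra.ofCoeff (Finsupp.equivFunOnFinite.symm fun h => ∑' i, (f i).coeff h)

/-- Integrability of a `ℂ[G]`-valued function, tested on coefficients. -/
def GIntegrable {X : Type*} [MeasurableSpace X] (f : X → MonoidAlgebra ℂ G) (μ : Measure X) : Prop :=
  ∀ h : G, Integrable (fun p => (f p).coeff h) μ

/-- The integral of a `ℂ[G]`-valued function, for a finite group `G`, computed on coefficients. -/
def gintegral [Finite G] {X : Type*} [MeasurableSpace X] (f : X → MonoidAlgebra ℂ G)
    (μ : Measure X) : MonoidAlgebra ℂ G :=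
  MonoidAlgebra.ofCoeff (Finsupp.equivFunOnFinite.symm fun h => ∫ p, (f p).coeff h ∂μ)

end Series

/-! ### The double Eisenstein series -/

section Eisenstein

variable {k : Type*} [Field k]

/-- The row vector `f g`, for `f ∈ F²` and `g ∈ GL₂(𝔸)`. -/
def rowMul (f : Fin 2 → RatFunc k) (g : GL2A k) : Fin 2 → Adele k :=
  (fun i => algebraMap (RatFunc k) (Adele k) (f i)) ᵥ* (g : Matrix (Fin 2) (Fin 2) (Adele k))

/-- `∞(u, v) = min(∞(u), ∞(v))` for a nonzero pair in `F_∞²`. -/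
def ordInfPair (w : Fin 2 → Adele k) : ℤ :=
  -WithZero.log (max (Valued.v (w 0).2) (Valued.v (w 1).2))

/-- `W(g) = {0 ≠ f ∈ F² : f g_f ∈ 𝒪_f²}`. -/
def setW (g : GL2A k) : Set (Fin 2 → RatFunc k) :=
  {f | f ≠ 0 ∧ ∀ i, IsFinIntegral (rowMul f g i).1}

/-- `V(g)`: the set of those `f ∈ W(g)` for which `f g_∞ = (a, b)` with `|a| < |b|`. -/
def setV (g : GL2A k) : Set (Fin 2 → RatFunc k) :=
  {f | f ∈ setW g ∧ Valued.v (rowMul f g 0).2 < Valued.v (rowMul f g 1).2}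

/-- `U(g)`, the complement of `V(g)` in `W(g)`. -/
def setU (g : GL2A k) : Set (Fin 2 → RatFunc k) := setW g \ setV g

/-- `χ₁(α, β) = χ(α)`. -/
def chi1 (m : Ideal k[X]) (χ : (FinAdele k)ˣ →* ℂˣ) (w : Fin 2 → Adele k) : ℂ := chi0 m χ (w 0).1

open scoped Classical in
/-- `χ₂(α, β) = χ(β)` if `α = 0` in `𝒪_f/𝔪`, and `0` otherwise. -/
def chi2 (m : Ideal k[X]) (χ : (FinAdele k)ˣ →* ℂˣ) (w : Fin 2 → Adele k) : ℂ :=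
  if InIdeal m (w 0).1 then chi0 m χ (w 1).1 else 0

variable {G : Type*} [CommGroup G]

/-- The terms of the double Eisenstein series, indexed by `((a, b), (c, d)) ∈ U(g) × V(g)`. -/
def eisTerm (m : Ideal k[X]) (χ : (FinAdele k)ˣ →* ℂˣ) (pr : (Adele k)ˣ →* G) (g : GL2A k)
    (x y : ℂ) (p : setU g × setV g) : MonoidAlgebra ℂ G :=
  MonoidAlgebra.single (infClass pr (p.1.1 0 * p.2.1 1 - p.1.1 1 * p.2.1 0))
    (chi1 m χ (rowMul p.1.1 g) * chi2 m χ (rowMul p.2.1 g) *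
      x ^ (-2 * ordInfPair (rowMul p.1.1 g)) * y ^ (-2 * ordInfPair (rowMul p.2.1 g)))

/-- The double Eisenstein series `E^G_𝔪(χ, g, x, y)`, with values in `ℂ[G]`. -/
def eisenstein [Finite G] (m : Ideal k[X]) (χ : (FinAdele k)ˣ →* ℂˣ) (pr : (Adele k)ˣ →* G)
    (g : GL2A k) (x y : ℂ) : MonoidAlgebra ℂ G :=
  MonoidAlgebra.single (pr (ofFin (finPart (Matrix.GeneralLinearGroup.det g))))⁻¹
      (((χ (finPart (Matrix.GeneralLinearGroup.det g)) : ℂˣ) : ℂ)⁻¹ *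
        (x * y) ^ ideleDeg (Matrix.GeneralLinearGroup.det g)) *
    gsum (eisTerm m χ pr g x y)

/-! ### The `L`-series and the divisor sums -/

/-- The terms of `L^G_𝔪(χ, x)`, indexed by the nonzero ideals prime to `𝔪`. -/
def lTerm (m : Ideal k[X]) (χ : (FinAdele k)ˣ →* ℂˣ) (pr : (Adele k)ˣ →* G) (x : ℂ)
    (r : {r : Ideal k[X] // r ≠ ⊥ ∧ IsCoprime r m}) : MonoidAlgebra ℂ G :=
  MonoidAlgebra.single (idealClass pr r.1)⁻¹ (chiIdeal m χ r.1 * x ^ idealDeg r.1)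

/-- `L^G_𝔪(χ, x)`: the sum over the nonzero ideals `𝔮` prime to `𝔪` of
`χ(𝔮) (𝔮^G)⁻¹ x^{deg 𝔮}`. -/
def lSeries [Finite G] (m : Ideal k[X]) (χ : (FinAdele k)ˣ →* ℂˣ) (pr : (Adele k)ˣ →* G) (x : ℂ) :
    MonoidAlgebra ℂ G :=
  gsum (lTerm m χ pr x)

/-- `σ^G_𝔪(χ, 𝔯, x)`: the sum over the ideals `𝔮` dividing the nonzero ideal `𝔯` and prime to `𝔪`
of `χ(𝔮) (𝔮^G)⁻¹ x^{deg 𝔮}`. -/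
def sigmaG (m : Ideal k[X]) (χ : (FinAdele k)ˣ →* ℂˣ) (pr : (Adele k)ˣ →* G) (r : Ideal k[X])
    (x : ℂ) : MonoidAlgebra ℂ G :=
  ∑ᶠ (e : Ideal k[X]) (_ : e ∣ r ∧ IsCoprime e m),
    MonoidAlgebra.single (idealClass pr e)⁻¹ (chiIdeal m χ e * x ^ idealDeg e)

end Eisenstein

/-! ### Elliptic curves over `F` -/

section EllipticCurves

variable {k : Type*} [Field k]

/-- The valuation ring of `F` at a finite place. -/
abbrev finRing (v : HeightOneSpectrum k[X]) : ValuationSubring (RatFunc k) :=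
  (v.valuation (RatFunc k)).valuationSubring

/-- The valuation ring of `F` at infinity. -/
abbrev infRing (k : Type*) [Field k] : ValuationSubring (RatFunc k) :=
  (@RatFunc.inftyValuation k _ (Classical.decEq _)).valuationSubring

/-- Split multiplicative reduction at infinity. -/
def IsSplitAtInf (E : WeierstrassCurve (RatFunc k)) : Prop :=
  (E.minimal (infRing k)).HasSplitMultiplicativeReduction (infRing k)

/-- `ψ_E^*(v^n)` for a finite place `v`: the coefficient of `t^{n deg v}` in the local factor
`L_v(E, t)` of the Hasse–Weil `L`-function, which is the local power series at `t^{deg v}`. -/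
def psiFin (E : WeierstrassCurve (RatFunc k)) (v : HeightOneSpectrum k[X]) (n : ℕ) : ℤ :=
  PowerSeries.coeff n (E.localPowerSeries (finRing v))

/-- `ψ_E^*(∞^n)`. -/
def psiInf (E : WeierstrassCurve (RatFunc k)) (n : ℕ) : ℤ :=
  PowerSeries.coeff n (E.localPowerSeries (infRing k))

open scoped Classical in
/-- The multiplicative function `ψ_E^*` on divisors, zero on non-effective divisors. -/
def psi (E : WeierstrassCurve (RatFunc k)) (D : Divisor k) : ℤ :=
  if D.IsEffective then (D.1.prod fun v n => psiFin E v n.toNat) * psiInf E D.2.toNat else 0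

/-- `ψ_E^*` on the nonzero ideals of `A`. -/
def psiIdeal (E : WeierstrassCurve (RatFunc k)) (r : Ideal k[X]) : ℤ :=
  psi E (finDiv (finGenUnit r), 0)

end EllipticCurves

/-! ### Cuspidal harmonic forms and their Fourier coefficients -/

section Forms

variable {k : Type*} [Field k]

/-- `ℚ`-valued automorphic forms of level `𝔫∞` with trivial central character. -/
structure IsAutomorphicForm (n : Ideal k[X]) (φ : GL2A k → ℚ) : Prop where
  locallyConstant : IsLocallyConstant φ
  left_invariant : ∀ γ g, φ (diagGL k γ * g) = φ g
  central : ∀ g, ∀ z ∈ Subgroup.center (GL2A k), φ (g * z) = φ g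
  right_invariant : ∀ g, ∀ κ ∈ K0Inf n, φ (g * κ) = φ g

/-- Harmonic forms: here the constants `k` are identified with the residue field at infinity. -/
structure IsHarmonic (φ : GL2A k → ℚ) : Prop where
  anti : ∀ (g : GL2A k) (ϖ : (FInf k)ˣ), ordInf (ϖ : FInf k) = 1 →
    φ (g * infGL (antiGL ϖ)) = -φ g
  sum_zero : ∀ g : GL2A k, φ (g * infGL (antiGL 1)) +
    ∑ᶠ ε : k, φ (g * infGL (lowerGL (algebraMap (RatFunc k) (FInf k) (RatFunc.C ε)))) = 0

/-- Cusp forms: the integral of `x ↦ φ((1 x; 0 1) g)` over `F \ 𝔸` is zero, for all `g`. -/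
def IsCuspidal (φ : GL2A k → ℚ) : Prop :=
  ∀ (ν : Measure (Adele k ⧸ principalAdeles k)), ν.IsAddHaarMeasure → IsProbabilityMeasure ν →
    ∀ g : GL2A k, ∫ x, ((φ (affineGL 1 (Quotient.out x) * g) : ℚ) : ℝ) ∂ν = 0

/-- `τ` is a nontrivial continuous character of `F \ 𝔸`, and `{x : τ(x𝒪) = 1} = 𝔡𝒪`. -/
structure IsAdditiveCharacter (τ : AddChar (Adele k) ℂ) (δ : (Adele k)ˣ) : Prop where
  continuous : Continuous τ
  trivial_principal : ∀ a : RatFunc k, τ (algebraMap (RatFunc k) (Adele k) a) = 1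
  nontrivial : τ ≠ 1
  different : ∀ x : Adele k, (∀ y, IsIntegralAdele y → τ (x * y) = 1) ↔
    ∃ y, IsIntegralAdele y ∧ x = (δ : Adele k) * y

/-- The function `c` on divisors, zero on non-effective divisors, gives the Fourier coefficients of
`φ`: one has `φ((x𝔡 y; 0 1)) = ∑_{η ∈ F^*} c(ηx) τ(ηy)` for all ideles `x` and adeles `y`. -/
structure IsFourierCoefficient (τ : AddChar (Adele k) ℂ) (δ : (Adele k)ˣ) (φ : GL2A k → ℚ)
    (c : Divisor k → ℂ) : Prop where
  zero_of_not_effective : ∀ D : Divisor k, ¬ D.IsEffective → c D = 0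
  expansion : ∀ (x : (Adele k)ˣ) (y : Adele k),
    HasSum (fun η : (RatFunc k)ˣ => c (ideleDiv (diagUnit k η * x)) * τ ((diagUnit k η : Adele k) * y))
      ((φ (affineGL (x * δ) y) : ℚ) : ℂ)

/-- `φ` is a normalized Hecke eigenform attached to `E`, of level `𝔫∞`: a `ℚ`-valued cuspidal
harmonic form of level `𝔫∞` with Fourier coefficients `|D| ψ_E^*(D)`. -/
structure IsNormalizedHeckeEigenform (E : WeierstrassCurve (RatFunc k)) (n : Ideal k[X])
    (τ : AddChar (Adele k) ℂ) (δ : (Adele k)ˣ) (φ : GL2A k → ℚ) : Prop where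
  automorphic : IsAutomorphicForm n φ
  harmonic : IsHarmonic φ
  cuspidal : IsCuspidal φ
  fourier : IsFourierCoefficient τ δ φ fun D => ((Divisor.abs D : ℝ) : ℂ) * (psi E D : ℂ)

end Forms

/-! ### The two sides of the formula -/

section Formula

variable {k : Type*} [Field k]

/-- The constant `μ(𝔪) = (q - 1) μ_G(Z(𝒪) \ 𝕂₀(𝔪∞))`. -/
def muConst (μG : Measure (PGL2A k)) (m : Ideal k[X]) : ℝ :=
  ((Nat.card k : ℝ) - 1) * μG.real ((QuotientGroup.mk : GL2A k → PGL2A k) '' K0Inf m)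

variable {G : Type*} [CommGroup G]

/-- The function `E^G_𝔪(χ, g, x, y) φ(g)` on `GL₂(𝔸) / Z(𝔸)`, computed on representatives: it does
not depend on the choice of the representatives if both factors are right-invariant under `Z(𝔸)`. -/
def integrand [Finite G] (m : Ideal k[X]) (χ : (FinAdele k)ˣ →* ℂˣ) (pr : (Adele k)ˣ →* G)
    (φ : GL2A k → ℚ) (x y : ℂ) (p : PGL2A k) : MonoidAlgebra ℂ G :=
  ((φ (Quotient.out p) : ℚ) : ℂ) • eisenstein m χ pr (Quotient.out p) x y

/-- The part of degree `d` of the Dirichlet series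
`∑_𝔯 |𝔯|^{1+t-s} σ^G_𝔪(χ, 𝔯, q^{1-2s}) ψ_E^*(𝔯)`. -/
def dirichletTerm (E : WeierstrassCurve (RatFunc k)) (m : Ideal k[X]) (χ : (FinAdele k)ˣ →* ℂˣ)
    (pr : (Adele k)ˣ →* G) (s t : ℂ) (d : ℕ) : MonoidAlgebra ℂ G :=
  ∑ᶠ (r : Ideal k[X]) (_ : r ≠ ⊥ ∧ idealDeg r = d),
    (((idealAbs r : ℝ) : ℂ) ^ (1 + t - s) * (psiIdeal E r : ℂ)) •
      sigmaG m χ pr r ((Nat.card k : ℂ) ^ (1 - 2 * s))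

end Formula

end RankinSelberg

end

/-! This is a Rankin–Selberg unfolding, carried out on explicit cosets. A vector of U(g) is never
proportional to one of V(g), so the pairs in U(g) × V(g) are matrices γ in GL₂(F), and the
Eisenstein series is a sum of Ψ(γg) over GL₂(F) (`eisenstein_coeff`). Here Ψ is `secVal`, with its
class in G recorded by `secClass`; it is right invariant under Z(F_∞)𝕂₀(𝔪∞) (`secVal_mul_k0`,
`secVal_mul_inf`). Iwasawa decomposition and strong approximation show that Ψ lives on a disjoint
union of cosets of that group, the cells. They are represented by (α β; 0 ω) at the finite places
and (T^{-N} 0; 0 ω) at infinity, where α and ω generate ideals 𝔞 and 𝔴, and β runs over the residues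
modulo 𝔞 (`exists_cell`, `cell_unique`).

Over a fundamental domain each cell contributes its whole volume, that of the image of 𝕂₀(𝔪∞)
(`tsum_measure_cellSet`). A class of PGL₂(F) that moves a point into a cell has exactly q - 1 lifts
to GL₂(F) that do so, because F^* ∩ 𝒪_f^* = k^*. Hence the integral is q - 1 times this volume times
the sum of φΨ over the cells (`hasSum_integrand`).

The analytic input is that a cusp form vanishes high in the cusp, so that φ is supported on finitely
many double cosets GL₂(F) s Z(𝔸) 𝕂₀(𝔪∞) (`exists_finite_support`). The sum of |φΨ| over the cells is
therefore controlled by finitely many sums of |Ψ(γs)| over γ, which converge by counting lattice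
points (`summable_secVal`). All later rearrangements, and even the convergence of the Dirichlet
series over 𝔯, are deduced from this; no estimate for ψ_E^* enters.

It remains to evaluate the sum over the cells. The value of φ does not depend on 𝔴, so the sum over
𝔴 splits off as the L-series (`eq_smul_of_hasSum_cells`). Summing the Fourier expansion over β is
orthogonality of characters and keeps only the coefficients at multiples of 𝔞 (`hasSum_cell`). Since
ψ_E^*(∞^n) = 1 for n ≥ 0 by split reduction, the place at infinity only bounds degrees
(`psi_eq_ite`). With M = N - deg 𝔡 + deg 𝔞 the sum over 𝔞 dividing 𝔯 produces σ(𝔯), and what is left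
is the sum over M of X^M S(M), where X = q^{s-t-1} and S(M) collects ψ_E^*(𝔯)σ(𝔯) over deg 𝔯 ≤ M
(`hasSum_sumLE`). Multiplication by 1 - X turns S into its differences, that is, into the Dirichlet
series (`hasSum_telescope`). This is the origin of the denominator 1 - X. -/

noncomputable section

namespace RankinSelberg

section Places

variable {k : Type*} [Field k]

/-! ### Local calculations in the adeles -/

@[simp] lemma finAdele_mul_apply (x y : FinAdele k) (v : HeightOneSpectrum k[X]) :
    (x * y) v = x v * y v := rfl

@[simp] lemma finAdele_add_apply (x y : FinAdele k) (v : HeightOneSpectrum k[X]) :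
    (x + y) v = x v + y v := rfl

@[simp] lemma finAdele_sub_apply (x y : FinAdele k) (v : HeightOneSpectrum k[X]) :
    (x - y) v = x v - y v := rfl

@[simp] lemma finAdele_one_apply (v : HeightOneSpectrum k[X]) : (1 : FinAdele k) v = 1 := rfl

@[simp] lemma finAdele_zero_apply (v : HeightOneSpectrum k[X]) : (0 : FinAdele k) v = 0 := rfl

lemma finAdele_sum_apply {ι : Type*} (s : Finset ι) (f : ι → FinAdele k)
    (v : HeightOneSpectrum k[X]) : (∑ i ∈ s, f i) v = ∑ i ∈ s, f i v := by
  classical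
  induction s using Finset.induction_on with
  | empty => simp
  | insert a s ha ih => rw [Finset.sum_insert ha, Finset.sum_insert ha, finAdele_add_apply, ih]

lemma isFinIntegral_iff {x : FinAdele k} : IsFinIntegral x ↔ ∀ v, Valued.v (x v) ≤ 1 := Iff.rfl

/-- The ring `𝒪_f`. -/
def finIntegers (k : Type*) [Field k] : Subring (FinAdele k) where
  carrier := {x | IsFinIntegral x}
  mul_mem' ha hb v := mul_mem (ha v) (hb v)
  one_mem' v := one_mem (v.adicCompletionIntegers (RatFunc k))
  add_mem' ha hb v := add_mem (ha v) (hb v)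
  zero_mem' v := zero_mem (v.adicCompletionIntegers (RatFunc k))
  neg_mem' ha v := neg_mem (ha v)

@[simp] lemma mem_finIntegers {x : FinAdele k} : x ∈ finIntegers k ↔ IsFinIntegral x := Iff.rfl

/-- A family of local integers, as a finite adele. -/
def finAdeleOfIntegral (f : ∀ v : HeightOneSpectrum k[X], v.adicCompletion (RatFunc k))
    (h : ∀ v, f v ∈ v.adicCompletionIntegers (RatFunc k)) : FinAdele k :=
  ⟨f, Filter.Eventually.of_forall h⟩

@[simp] lemma finAdeleOfIntegral_apply
    (f : ∀ v : HeightOneSpectrum k[X], v.adicCompletion (RatFunc k))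
    (h : ∀ v, f v ∈ v.adicCompletionIntegers (RatFunc k)) (v) :
    finAdeleOfIntegral f h v = f v := rfl

lemma valued_algebraMap_apply (a : RatFunc k) (v : HeightOneSpectrum k[X]) :
    Valued.v ((algebraMap (RatFunc k) (FinAdele k) a) v) = v.valuation (RatFunc k) a :=
  v.valuedAdicCompletion_eq_valuation' a

/-- The embedding of `A` into the finite adeles. -/
def polyFin (k : Type*) [Field k] : k[X] →+* FinAdele k :=
  (algebraMap (RatFunc k) (FinAdele k)).comp (algebraMap k[X] (RatFunc k))

lemma valued_polyFin (p : k[X]) (v : HeightOneSpectrum k[X]) :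
    Valued.v (polyFin k p v) = v.intValuation p := by
  rw [polyFin, RingHom.comp_apply, valued_algebraMap_apply]
  exact v.valuation_of_algebraMap p

lemma isFinIntegral_polyFin (p : k[X]) : IsFinIntegral (polyFin k p) := fun v => by
  have := v.intValuation_le_one p
  rw [← valued_polyFin] at this
  exact this

lemma isFinIntegral_algebraMap_iff {a : RatFunc k} :
    IsFinIntegral (algebraMap (RatFunc k) (FinAdele k) a) ↔
      ∃ p : k[X], algebraMap k[X] (RatFunc k) p = a := by
  constructor
  · intro h
    refine HeightOneSpectrum.mem_integers_of_valuation_le_one (R := k[X]) (RatFunc k) a fun v => ?_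
    rw [← valued_algebraMap_apply]
    exact h v
  · rintro ⟨p, rfl⟩
    exact isFinIntegral_polyFin p

lemma finUnit_apply_ne_zero (c : (FinAdele k)ˣ) (v : HeightOneSpectrum k[X]) :
    (c : FinAdele k) v ≠ 0 :=
  (FiniteAdeleRing.isUnit_iff.mp c.isUnit).1 v

lemma finUnit_inv_apply (c : (FinAdele k)ˣ) (v : HeightOneSpectrum k[X]) :
    ((c⁻¹ : (FinAdele k)ˣ) : FinAdele k) v = ((c : FinAdele k) v)⁻¹ := by
  have h : ((c : FinAdele k) * ((c⁻¹ : (FinAdele k)ˣ) : FinAdele k)) v = 1 := by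
    rw [c.mul_inv]; rfl
  exact eq_inv_of_mul_eq_one_right h

lemma isFinIntegral_inv_mul_iff (c : (FinAdele k)ˣ) (x : FinAdele k) :
    IsFinIntegral (((c⁻¹ : (FinAdele k)ˣ) : FinAdele k) * x) ↔
      ∀ v, Valued.v (x v) ≤ Valued.v ((c : FinAdele k) v) := by
  rw [isFinIntegral_iff]
  refine forall_congr' fun v => ?_
  have h0 : Valued.v ((c : FinAdele k) v) ≠ 0 := by
    simpa using finUnit_apply_ne_zero c v
  rw [finAdele_mul_apply, finUnit_inv_apply, map_mul, map_inv₀, mul_comm, ← div_eq_mul_inv,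
    div_le_one₀ (zero_lt_iff.mpr h0)]

lemma exists_integral_mul_iff (c : (FinAdele k)ˣ) (x : FinAdele k) :
    (∃ y, IsFinIntegral y ∧ x = (c : FinAdele k) * y) ↔ IsFinIntegral (((c⁻¹ : (FinAdele k)ˣ) : FinAdele k) * x) := by
  constructor
  · rintro ⟨y, hy, rfl⟩
    simpa using hy
  · intro h
    exact ⟨_, h, by simp⟩

/-- Membership in `𝒪_f^*`. -/
def IsFinIntegralUnit (u : (FinAdele k)ˣ) : Prop :=
  IsFinIntegral (u : FinAdele k) ∧ IsFinIntegral ((u⁻¹ : (FinAdele k)ˣ) : FinAdele k)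

lemma isFinIntegralUnit_iff {u : (FinAdele k)ˣ} :
    IsFinIntegralUnit u ↔ ∀ v, Valued.v ((u : FinAdele k) v) = 1 := by
  have h2 := isFinIntegral_inv_mul_iff u 1
  rw [mul_one] at h2
  rw [IsFinIntegralUnit, h2, isFinIntegral_iff, ← forall_and]
  refine forall_congr' fun v => ?_
  rw [finAdele_one_apply, map_one, le_antisymm_iff]

lemma IsFinIntegralUnit.mul {u w : (FinAdele k)ˣ} (hu : IsFinIntegralUnit u)
    (hw : IsFinIntegralUnit w) : IsFinIntegralUnit (u * w) := by
  rw [isFinIntegralUnit_iff] at *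
  intro v
  simp [hu v, hw v]

lemma IsFinIntegralUnit.inv {u : (FinAdele k)ˣ} (hu : IsFinIntegralUnit u) :
    IsFinIntegralUnit u⁻¹ := ⟨hu.2, by simpa using hu.1⟩

lemma generator_ne_zero {r : Ideal k[X]} (hr : r ≠ ⊥) : Submodule.IsPrincipal.generator r ≠ 0 :=
  fun h => hr ((Submodule.IsPrincipal.eq_bot_iff_generator_eq_zero r).mpr h)

lemma polyUnit_aux {p : k[X]} (hp : p ≠ 0) : algebraMap k[X] (RatFunc k) p ≠ 0 :=
  (map_ne_zero_iff _ (IsFractionRing.injective k[X] (RatFunc k))).mpr hp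

/-- A nonzero polynomial, as an element of `F^*`. -/
def polyUnit (p : k[X]) (hp : p ≠ 0) : (RatFunc k)ˣ := Units.mk0 _ (polyUnit_aux hp)

@[simp] lemma coe_polyUnit (p : k[X]) (hp : p ≠ 0) :
    (polyUnit p hp : RatFunc k) = algebraMap k[X] (RatFunc k) p := rfl

@[simp] lemma coe_finDiagUnit (a : (RatFunc k)ˣ) :
    (finDiagUnit k a : FinAdele k) = algebraMap (RatFunc k) (FinAdele k) a := rfl

@[simp] lemma coe_diagUnit (a : (RatFunc k)ˣ) :
    (diagUnit k a : Adele k) = algebraMap (RatFunc k) (Adele k) a := rfl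

lemma finGenUnit_eq {r : Ideal k[X]} (hr : r ≠ ⊥) :
    finGenUnit r = finDiagUnit k (polyUnit _ (generator_ne_zero hr)) := by
  rw [finGenUnit, dif_neg (generator_ne_zero hr)]
  rfl

lemma coe_finGenUnit {r : Ideal k[X]} (hr : r ≠ ⊥) : (finGenUnit r : FinAdele k) = finGen r := by
  rw [finGenUnit_eq hr]; rfl

lemma inIdeal_iff {m : Ideal k[X]} (hm : m ≠ ⊥) {x : FinAdele k} :
    InIdeal m x ↔ ∀ v : HeightOneSpectrum k[X],
      Valued.v (x v) ≤ v.intValuation (Submodule.IsPrincipal.generator m) := by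
  rw [InIdeal, ← coe_finGenUnit hm, exists_integral_mul_iff, isFinIntegral_inv_mul_iff,
    coe_finGenUnit hm]
  refine forall_congr' fun v => ?_
  rw [← valued_polyFin]
  rfl

lemma InIdeal.add {m : Ideal k[X]} {x y : FinAdele k} (hx : InIdeal m x) (hy : InIdeal m y) :
    InIdeal m (x + y) := by
  obtain ⟨a, ha, rfl⟩ := hx
  obtain ⟨b, hb, rfl⟩ := hy
  exact ⟨a + b, (finIntegers k).add_mem ha hb, by ring⟩

lemma InIdeal.mul_right {m : Ideal k[X]} {x y : FinAdele k} (hx : InIdeal m x)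
    (hy : IsFinIntegral y) : InIdeal m (x * y) := by
  obtain ⟨a, ha, rfl⟩ := hx
  exact ⟨a * y, (finIntegers k).mul_mem ha hy, by ring⟩

lemma InIdeal.mul_left {m : Ideal k[X]} {x y : FinAdele k} (hx : InIdeal m x)
    (hy : IsFinIntegral y) : InIdeal m (y * x) := mul_comm x y ▸ hx.mul_right hy

lemma InIdeal.neg {m : Ideal k[X]} {x : FinAdele k} (hx : InIdeal m x) : InIdeal m (-x) := by
  obtain ⟨a, ha, rfl⟩ := hx
  exact ⟨-a, (finIntegers k).neg_mem ha, by ring⟩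

lemma InIdeal.sub {m : Ideal k[X]} {x y : FinAdele k} (hx : InIdeal m x) (hy : InIdeal m y) :
    InIdeal m (x - y) := sub_eq_add_neg x y ▸ hx.add hy.neg

lemma InIdeal.isFinIntegral {m : Ideal k[X]} {x : FinAdele k} (hx : InIdeal m x) :
    IsFinIntegral x := by
  obtain ⟨a, ha, rfl⟩ := hx
  exact (finIntegers k).mul_mem (isFinIntegral_polyFin _) ha

lemma InIdeal.of_dvd {m n : Ideal k[X]} (h : n ∣ m) {x : FinAdele k} (hx : InIdeal m x) :
    InIdeal n x := by
  obtain ⟨a, ha, rfl⟩ := hx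
  have h1 : Submodule.IsPrincipal.generator m ∈ n :=
    Ideal.le_of_dvd h (Submodule.IsPrincipal.generator_mem m)
  obtain ⟨b, hb⟩ := (Submodule.IsPrincipal.mem_iff_generator_dvd n).mp h1
  refine ⟨polyFin k b * a, (finIntegers k).mul_mem (isFinIntegral_polyFin _) ha, ?_⟩
  have : finGen m = finGen n * polyFin k b := by
    change polyFin k _ = polyFin k _ * polyFin k b
    rw [← map_mul, ← hb]
  rw [this, mul_assoc]

/-! ### The place at infinity -/

lemma valued_inf_algebraMap {a : RatFunc k} (h : a ≠ 0) :
    Valued.v (algebraMap (RatFunc k) (FInf k) a) = WithZero.exp a.intDegree := by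
  classical
  rw [RatFunc.valuedCompletionAtInfty.def]
  refine (@Valued.extensionValuation_apply_coe _ _ _ _ (RatFunc.inftyValued k) a).trans ?_
  have : RatFunc.inftyValuationDef k a = WithZero.exp a.intDegree := by simp [h]
  convert this
  rw [RatFunc.inftyValued.def]

lemma isOpen_valued_lt_one {K Γ : Type*} [Field K] [LinearOrderedCommGroupWithZero Γ]
    [Valued K Γ] : IsOpen {x : K | Valued.v x < 1} := by
  have h := Valued.isOpen_ball K (Γ₀ := Γ) 1
  simpa only [Valuation.restrict_lt_one_iff] using h

lemma exists_ratFunc_inf (x : FInf k) : ∃ a : RatFunc k,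
    Valued.v (x - algebraMap (RatFunc k) (FInf k) a) < 1 := by
  have hd : DenseRange (algebraMap (RatFunc k) (FInf k)) := by
    letI := Classical.decEq (RatFunc k)
    exact @UniformSpace.Completion.denseRange_coe _ (RatFunc.inftyValued k).toUniformSpace
  have ho : IsOpen {y : FInf k | Valued.v (x - y) < 1} :=
    (isOpen_valued_lt_one (K := FInf k)).preimage
      (continuous_const.sub continuous_id : Continuous fun y => x - y)
  obtain ⟨a, ha⟩ := hd.exists_mem_open ho ⟨x, by simp⟩
  exact ⟨a, ha⟩

/-- The embedding of `A` into `F_∞`. -/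
def polyInf (k : Type*) [Field k] : k[X] →+* FInf k :=
  (algebraMap (RatFunc k) (FInf k)).comp (algebraMap k[X] (RatFunc k))

lemma valued_polyInf {p : k[X]} (hp : p ≠ 0) :
    Valued.v (polyInf k p) = WithZero.exp (p.natDegree : ℤ) := by
  rw [polyInf, RingHom.comp_apply, valued_inf_algebraMap (polyUnit_aux hp),
    RatFunc.intDegree_polynomial]

lemma valued_polyInf_lt {p : k[X]} {n : ℕ} : Valued.v (polyInf k p) < WithZero.exp (n : ℤ) ↔
    p.degree < n := by
  rcases eq_or_ne p 0 with rfl | hp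
  · simp
  · rw [valued_polyInf hp, WithZero.exp_lt_exp, degree_eq_natDegree hp]
    norm_cast

/-- The polynomial part of a rational approximation of x will do: what remains is a proper fraction,
of absolute value less than 1. -/
lemma exists_poly_inf (x : FInf k) : ∃ p : k[X], Valued.v (x - polyInf k p) < 1 := by
  obtain ⟨a, ha⟩ := exists_ratFunc_inf x
  have hd : a.denom ≠ 0 := a.denom_ne_zero
  refine ⟨a.num / a.denom, ?_⟩
  have h1 : polyInf k (a.num / a.denom) = algebraMap (RatFunc k) (FInf k) a -
      polyInf k (a.num % a.denom) / polyInf k a.denom := by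
    have h0 : polyInf k a.denom ≠ 0 := by
      rw [← Valuation.ne_zero_iff Valued.v, valued_polyInf hd]; exact WithZero.exp_ne_zero
    rw [eq_sub_iff_add_eq, ← mul_left_inj' h0, add_mul, div_mul_cancel₀ _ h0, ← map_mul, ← map_add,
      mul_comm, EuclideanDomain.div_add_mod]
    have h2 : algebraMap (RatFunc k) (FInf k) a = polyInf k a.num / polyInf k a.denom := by
      conv_lhs => rw [← RatFunc.num_div_denom a]
      exact map_div₀ _ _ _
    rw [h2, div_mul_cancel₀ _ h0]
  rw [h1, ← sub_add, sub_eq_add_neg x]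
  refine lt_of_le_of_lt (Valuation.map_add _ _ _) (max_lt (by rwa [← sub_eq_add_neg]) ?_)
  rw [map_div₀, valued_polyInf hd, div_lt_one₀ WithZero.exp_pos, valued_polyInf_lt,
    ← degree_eq_natDegree hd]
  exact EuclideanDomain.mod_lt _ hd

/-! ### Strong approximation -/

/-- A generator of the maximal ideal `v`. -/
def primeGen (v : HeightOneSpectrum k[X]) : k[X] := Submodule.IsPrincipal.generator v.asIdeal

lemma primeGen_ne_zero (v : HeightOneSpectrum k[X]) : primeGen v ≠ 0 := generator_ne_zero v.ne_bot

lemma span_primeGen (v : HeightOneSpectrum k[X]) : Ideal.span {primeGen v} = v.asIdeal :=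
  Ideal.span_singleton_generator v.asIdeal

lemma prime_primeGen (v : HeightOneSpectrum k[X]) : Prime (primeGen v) := by
  rw [← Ideal.span_singleton_prime (primeGen_ne_zero v), span_primeGen]
  exact v.isPrime

lemma intValuation_primeGen_self (v : HeightOneSpectrum k[X]) :
    v.intValuation (primeGen v) = WithZero.exp (-1 : ℤ) :=
  v.intValuation_singleton (primeGen_ne_zero v) (span_primeGen v).symm

lemma intValuation_primeGen_of_ne {v w : HeightOneSpectrum k[X]} (h : w ≠ v) :
    w.intValuation (primeGen v) = 1 := by
  rw [HeightOneSpectrum.intValuation_eq_one_iff]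
  intro hm
  apply h
  have hle : v.asIdeal ≤ w.asIdeal := by
    rw [← span_primeGen v, Ideal.span_singleton_le_iff_mem]
    exact hm
  have := (v.isPrime.isMaximal v.ne_bot).eq_of_le w.isPrime.ne_top hle
  exact HeightOneSpectrum.ext this.symm

/-- Partial fractions: of a rational function close to x at v, keep only the part whose poles lie at
v. -/
lemma exists_ratFunc_local (v : HeightOneSpectrum k[X]) (x : v.adicCompletion (RatFunc k)) :
    ∃ a : RatFunc k, Valued.v (x - (algebraMap (RatFunc k) (FinAdele k) a) v) ≤ 1 ∧
      ∀ w, w ≠ v → Valued.v ((algebraMap (RatFunc k) (FinAdele k) a) w) ≤ 1 := by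
  have ho : IsOpen {y : v.adicCompletion (RatFunc k) | Valued.v (x - y) < 1} :=
    (isOpen_valued_lt_one (K := v.adicCompletion (RatFunc k))).preimage
      (continuous_const.sub continuous_id : Continuous fun y => x - y)
  obtain ⟨a, ha⟩ := (v.denseRange_algebraMap (RatFunc k)).exists_mem_open ho ⟨x, by simp⟩
  -- The denominator is ϖ^e d with ϖ the prime of v and d prime to ϖ. A Bézout relation between the
  -- factors splits the fraction into one over ϖ^e, which is kept, and one over d, which is integral
  -- at v.
  obtain ⟨e, d, hd, hde⟩ := WfDvdMonoid.max_power_factor (a.denom_ne_zero)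
    (prime_primeGen v).irreducible
  have hcop : IsCoprime (primeGen v ^ e) d :=
    (((prime_primeGen v).irreducible.coprime_iff_not_dvd).mpr hd).pow_left
  obtain ⟨r, s, hrs⟩ := hcop
  have hp0 : algebraMap k[X] (RatFunc k) (primeGen v) ≠ 0 := polyUnit_aux (primeGen_ne_zero v)
  have hd0 : algebraMap k[X] (RatFunc k) d ≠ 0 := polyUnit_aux fun h => hd (h ▸ dvd_zero _)
  have hrs' := congrArg (algebraMap k[X] (RatFunc k)) hrs
  simp only [map_add, map_mul, map_pow, map_one] at hrs'
  have hdv : v.valuation (RatFunc k) (algebraMap k[X] (RatFunc k) d) = 1 := by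
    rw [v.valuation_of_algebraMap, v.intValuation_eq_one_iff, ← span_primeGen,
      Ideal.mem_span_singleton]
    exact hd
  refine ⟨algebraMap _ _ (a.num * s) / algebraMap _ _ (primeGen v) ^ e, ?_, fun w hw => ?_⟩
  · have h1 : algebraMap _ _ (a.num * s) / algebraMap _ _ (primeGen v) ^ e =
        a - algebraMap k[X] (RatFunc k) (a.num * r) / algebraMap _ _ d := by
      have h2 : a = algebraMap k[X] (RatFunc k) a.num /
          (algebraMap k[X] (RatFunc k) (primeGen v) ^ e * algebraMap k[X] (RatFunc k) d) := by
        conv_lhs => rw [← RatFunc.num_div_denom a, hde, map_mul, map_pow]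
      generalize a.num = b at h2
      rw [h2]
      simp only [map_mul]
      field_simp
      linear_combination (algebraMap k[X] (RatFunc k) b) * hrs'
    rw [h1, map_sub (algebraMap (RatFunc k) (FinAdele k)), finAdele_sub_apply, ← sub_add]
    refine (Valuation.map_add _ _ _).trans (max_le ha.le ?_)
    rw [valued_algebraMap_apply, map_div₀, hdv, div_one]
    exact v.valuation_le_one _
  · rw [valued_algebraMap_apply, map_div₀, map_pow, w.valuation_of_algebraMap (primeGen v),
      intValuation_primeGen_of_ne hw, one_pow, div_one]
    exact w.valuation_le_one _

/-- Sum the principal parts at the finitely many places where x is not integral; each is integral at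
all other places, so they do not disturb one another. -/
lemma exists_ratFunc_sub_integral (x : FinAdele k) :
    ∃ a : RatFunc k, IsFinIntegral (x - algebraMap (RatFunc k) (FinAdele k) a) := by
  classical
  have hfin : {v | ¬ (x v ∈ v.adicCompletionIntegers (RatFunc k))}.Finite := by
    have := x.2
    rwa [Filter.eventually_cofinite] at this
  choose f hf1 hf2 using fun v => exists_ratFunc_local v (x v)
  refine ⟨∑ v ∈ hfin.toFinset, f v, fun w => ?_⟩
  change Valued.v ((x - algebraMap (RatFunc k) (FinAdele k) (∑ v ∈ hfin.toFinset, f v)) w) ≤ 1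
  rw [map_sum, finAdele_sub_apply, finAdele_sum_apply]
  by_cases hw : w ∈ hfin.toFinset
  · rw [← Finset.add_sum_erase _ _ hw, ← sub_sub]
    refine (Valuation.map_sub _ _ _).trans (max_le (hf1 w) ?_)
    refine Valuation.map_sum_le _ fun v hv => hf2 v w ?_
    exact (Finset.ne_of_mem_erase hv).symm
  · refine (Valuation.map_sub _ _ _).trans (max_le ?_ ?_)
    · have : x w ∈ w.adicCompletionIntegers (RatFunc k) := by simpa using hw
      exact this
    · refine Valuation.map_sum_le _ fun v hv => hf2 v w ?_
      rintro rfl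
      exact hw hv

/-- `𝔸 = F + (𝒪_f × 𝔪_∞)`. -/
lemma exists_ratFunc_sub_adele (x : Adele k) :
    ∃ a : RatFunc k, IsFinIntegral (x - algebraMap (RatFunc k) (Adele k) a).1 ∧
      Valued.v (x - algebraMap (RatFunc k) (Adele k) a).2 < 1 := by
  obtain ⟨a, ha⟩ := exists_ratFunc_sub_integral x.1
  obtain ⟨p, hp⟩ := exists_poly_inf (x.2 - algebraMap (RatFunc k) (FInf k) a)
  refine ⟨a + algebraMap k[X] (RatFunc k) p, ?_, ?_⟩
  · have : (x - algebraMap (RatFunc k) (Adele k) (a + algebraMap k[X] (RatFunc k) p)).1 =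
        (x.1 - algebraMap (RatFunc k) (FinAdele k) a) - polyFin k p := by
      rw [map_add, ← sub_sub]; rfl
    rw [this]
    exact (finIntegers k).sub_mem ha (isFinIntegral_polyFin p)
  · have : (x - algebraMap (RatFunc k) (Adele k) (a + algebraMap k[X] (RatFunc k) p)).2 =
        (x.2 - algebraMap (RatFunc k) (FInf k) a) - polyInf k p := by
      rw [map_add, ← sub_sub]; rfl
    rw [this]
    exact hp

/-- `𝔸_f^* = F^* 𝒪_f^*`. -/
lemma exists_ratFunc_unit (c : (FinAdele k)ˣ) :
    ∃ a : (RatFunc k)ˣ, IsFinIntegralUnit ((finDiagUnit k a)⁻¹ * c) := by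
  classical
  -- A has class number one: a product of powers of prime generators has any prescribed finite
  -- divisor.
  refine ⟨(finDiv c).prod fun v n => polyUnit (primeGen v) (primeGen_ne_zero v) ^ n, ?_⟩
  rw [isFinIntegralUnit_iff]
  intro w
  have h0 : Valued.v ((c : FinAdele k) w) ≠ 0 := by simpa using finUnit_apply_ne_zero c w
  rw [Units.val_mul, finAdele_mul_apply, finUnit_inv_apply, map_mul, map_inv₀, coe_finDiagUnit,
    valued_algebraMap_apply, inv_mul_eq_one₀]
  · have hc : Valued.v ((c : FinAdele k) w) = WithZero.exp (-(finDiv c w)) := by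
      change _ = WithZero.exp (- -_)
      rw [neg_neg, WithZero.exp_log h0]
    rw [hc, Finsupp.prod, Units.coe_prod, map_prod, Finset.prod_eq_single w]
    · rw [Units.val_zpow_eq_zpow_val, map_zpow₀, coe_polyUnit]
      erw [w.valuation_of_algebraMap]
      rw [intValuation_primeGen_self, ← WithZero.exp_zsmul]
      simp
    · intro v _ hv
      rw [Units.val_zpow_eq_zpow_val, map_zpow₀, coe_polyUnit]
      erw [w.valuation_of_algebraMap]
      rw [intValuation_primeGen_of_ne hv.symm, one_zpow]
    · intro hw
      rw [Finsupp.notMem_support_iff.mp hw]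
      simp
  · simp

end Places

section Degrees

variable {k : Type*} [Field k]

/-! ### Divisors and degrees -/

lemma finDiv_apply (c : (FinAdele k)ˣ) (v : HeightOneSpectrum k[X]) :
    finDiv c v = -WithZero.log (Valued.v ((c : FinAdele k) v)) := rfl

lemma valued_finUnit (c : (FinAdele k)ˣ) (v : HeightOneSpectrum k[X]) :
    Valued.v ((c : FinAdele k) v) = WithZero.exp (-finDiv c v) := by
  have h0 : Valued.v ((c : FinAdele k) v) ≠ 0 := by simpa using finUnit_apply_ne_zero c v
  rw [finDiv_apply, neg_neg, WithZero.exp_log h0]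

lemma finDiv_mul (c d : (FinAdele k)ˣ) : finDiv (c * d) = finDiv c + finDiv d := by
  ext v
  rw [Finsupp.add_apply, ← neg_inj, ← WithZero.exp_inj, neg_add, WithZero.exp_add,
    ← valued_finUnit, ← valued_finUnit, ← valued_finUnit, ← map_mul]
  rfl

/-- The divisor map on the finite ideles, as a homomorphism. -/
def finDivHom (k : Type*) [Field k] : (FinAdele k)ˣ →* Multiplicative (HeightOneSpectrum k[X] →₀ ℤ) where
  toFun c := Multiplicative.ofAdd (finDiv c)
  map_one' := by
    have := finDiv_mul (1 : (FinAdele k)ˣ) 1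
    rw [one_mul, left_eq_add] at this
    rw [this]; rfl
  map_mul' c d := by rw [finDiv_mul]; rfl

lemma finDiv_one : finDiv (1 : (FinAdele k)ˣ) = 0 := (finDivHom k).map_one

lemma finDiv_inv (c : (FinAdele k)ˣ) : finDiv c⁻¹ = -finDiv c := (finDivHom k).map_inv c

lemma finDiv_eq_zero_iff {c : (FinAdele k)ˣ} : finDiv c = 0 ↔ IsFinIntegralUnit c := by
  rw [isFinIntegralUnit_iff, Finsupp.ext_iff]
  refine forall_congr' fun v => ?_
  rw [valued_finUnit, WithZero.exp_eq_one, neg_eq_zero]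
  rfl

lemma finDiv_eq_iff {c d : (FinAdele k)ˣ} : finDiv c = finDiv d ↔ IsFinIntegralUnit (d⁻¹ * c) := by
  rw [← finDiv_eq_zero_iff, finDiv_mul, finDiv_inv, neg_add_eq_zero, eq_comm]

lemma isFinIntegral_unit_iff {c : (FinAdele k)ˣ} :
    IsFinIntegral (c : FinAdele k) ↔ ∀ v, 0 ≤ finDiv c v := by
  rw [isFinIntegral_iff]
  refine forall_congr' fun v => ?_
  rw [valued_finUnit, ← WithZero.exp_zero, WithZero.exp_le_exp, neg_nonpos]

/-- The degree of a divisor supported on the finite places. -/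
def finDeg (k : Type*) [Field k] : (HeightOneSpectrum k[X] →₀ ℤ) →+ ℤ :=
  Finsupp.liftAddHom fun v => AddMonoidHom.mulRight (idealDeg v.asIdeal : ℤ)

lemma divisor_deg (D : Divisor k) : D.deg = finDeg k D.1 + D.2 := rfl

lemma associated_primeGen {p : k[X]} (hp : Prime p) :
    ∃ v : HeightOneSpectrum k[X], Associated (primeGen v) p := by
  refine ⟨⟨Ideal.span {p}, (Ideal.span_singleton_prime hp.ne_zero).mpr hp, ?_⟩, ?_⟩
  · simpa using hp.ne_zero
  · rw [← Ideal.span_singleton_eq_span_singleton, span_primeGen]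

lemma polyUnit_mul {p r : k[X]} (hp : p ≠ 0) (hr : r ≠ 0) :
    polyUnit (p * r) (mul_ne_zero hp hr) = polyUnit p hp * polyUnit r hr :=
  Units.ext (map_mul _ _ _)

lemma finDiv_polyUnit_apply {p : k[X]} (hp : p ≠ 0) (v : HeightOneSpectrum k[X]) :
    WithZero.exp (-finDiv (finDiagUnit k (polyUnit p hp)) v) = v.intValuation p := by
  rw [← valued_finUnit]
  exact valued_polyFin p v

lemma finDiv_primeGen (v : HeightOneSpectrum k[X]) :
    finDiv (finDiagUnit k (polyUnit (primeGen v) (primeGen_ne_zero v))) = Finsupp.single v 1 := by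
  classical
  ext w
  rw [← neg_inj, ← WithZero.exp_inj, finDiv_polyUnit_apply, Finsupp.single_apply]
  split_ifs with h
  · subst h
    exact intValuation_primeGen_self _
  · rw [intValuation_primeGen_of_ne (Ne.symm h)]
    simp

lemma isFinIntegralUnit_polyUnit {p : k[X]} (hp : IsUnit p) :
    IsFinIntegralUnit (finDiagUnit k (polyUnit p hp.ne_zero)) := by
  obtain ⟨u, rfl⟩ := hp
  refine ⟨isFinIntegral_polyFin _, ?_⟩
  have h : ((finDiagUnit k (polyUnit (u : k[X]) u.isUnit.ne_zero))⁻¹ : (FinAdele k)ˣ) =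
      finDiagUnit k (polyUnit ((u⁻¹ : k[X]ˣ) : k[X]) u⁻¹.isUnit.ne_zero) := by
    rw [inv_eq_iff_mul_eq_one, ← map_mul, ← polyUnit_mul]
    have : polyUnit ((u : k[X]) * ((u⁻¹ : k[X]ˣ) : k[X]))
        (mul_ne_zero u.isUnit.ne_zero u⁻¹.isUnit.ne_zero) = 1 := Units.ext (by simp)
    rw [this, map_one]
  rw [h]
  exact isFinIntegral_polyFin _

lemma finDiv_polyUnit_of_associated {p r : k[X]} (h : Associated p r) (hp : p ≠ 0) (hr : r ≠ 0) :
    finDiv (finDiagUnit k (polyUnit p hp)) = finDiv (finDiagUnit k (polyUnit r hr)) := by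
  obtain ⟨u, rfl⟩ := h
  rw [polyUnit_mul hp u.isUnit.ne_zero, map_mul, finDiv_mul,
    finDiv_eq_zero_iff.mpr (isFinIntegralUnit_polyUnit u.isUnit), add_zero]

lemma natDegree_eq_of_associated {p r : k[X]} (h : Associated p r) :
    p.natDegree = r.natDegree := by
  rw [natDegree, natDegree, degree_eq_degree_of_associated h]

/-- Both sides are additive over products and agree on units and on primes. This is the finite half
of the product formula. -/
lemma finDeg_polyUnit {p : k[X]} (hp : p ≠ 0) :
    finDeg k (finDiv (finDiagUnit k (polyUnit p hp))) = p.natDegree := by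
  induction p using UniqueFactorizationMonoid.induction_on_prime with
  | h₁ => exact absurd rfl hp
  | h₂ x hx =>
    rw [finDiv_eq_zero_iff.mpr (isFinIntegralUnit_polyUnit hx), map_zero,
      natDegree_eq_zero_of_isUnit hx, Nat.cast_zero]
  | h₃ a p ha hp' ih =>
    obtain ⟨v, hv⟩ := associated_primeGen hp'
    rw [polyUnit_mul hp'.ne_zero ha, map_mul, finDiv_mul, map_add, ih, natDegree_mul hp'.ne_zero ha,
      ← finDiv_polyUnit_of_associated hv (primeGen_ne_zero v), finDiv_primeGen,
      ← natDegree_eq_of_associated hv]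
    simp [finDeg, idealDeg, primeGen]

lemma ordInf_mul {x y : FInf k} (hx : x ≠ 0) (hy : y ≠ 0) :
    ordInf (x * y) = ordInf x + ordInf y := by
  rw [ordInf, ordInf, ordInf, map_mul, WithZero.log_mul (by simpa using hx) (by simpa using hy),
    neg_add]

lemma valued_eq_exp_ordInf {x : FInf k} (hx : x ≠ 0) : Valued.v x = WithZero.exp (-ordInf x) := by
  rw [ordInf, neg_neg, WithZero.exp_log (by simpa using hx)]

lemma ordInf_eq_iff {x : FInf k} (hx : x ≠ 0) {n : ℤ} :
    ordInf x = n ↔ Valued.v x = WithZero.exp (-n) := by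
  rw [valued_eq_exp_ordInf hx, WithZero.exp_inj, neg_inj]

lemma ordInf_algebraMap {a : RatFunc k} (ha : a ≠ 0) :
    ordInf (algebraMap (RatFunc k) (FInf k) a) = -a.intDegree := by
  rw [ordInf, valued_inf_algebraMap ha, WithZero.log_exp]

lemma adeleUnit_snd_ne_zero (x : (Adele k)ˣ) : (x : Adele k).2 ≠ 0 :=
  (MulEquiv.prodUnits x).2.ne_zero

lemma ideleDiv_mul (x y : (Adele k)ˣ) : ideleDiv (x * y) = ideleDiv x + ideleDiv y := by
  refine Prod.ext ?_ ?_
  · change finDiv (finPart (x * y)) = finDiv (finPart x) + finDiv (finPart y)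
    rw [← finDiv_mul]; rfl
  · exact ordInf_mul (adeleUnit_snd_ne_zero x) (adeleUnit_snd_ne_zero y)

lemma divisor_deg_add (D D' : Divisor k) : (D + D').deg = D.deg + D'.deg := by
  rw [divisor_deg, divisor_deg, divisor_deg, Prod.fst_add, Prod.snd_add, map_add]
  ring

/-- The degree of ideles, as a homomorphism. -/
def ideleDegHom (k : Type*) [Field k] : (Adele k)ˣ →* Multiplicative ℤ where
  toFun x := Multiplicative.ofAdd (ideleDeg x)
  map_one' := by
    have : ideleDeg (1 * 1 : (Adele k)ˣ) = ideleDeg (1 : (Adele k)ˣ) + ideleDeg (1 : (Adele k)ˣ) := by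
      rw [ideleDeg, ideleDiv_mul, divisor_deg_add]; rfl
    rw [one_mul, left_eq_add] at this
    rw [this]; rfl
  map_mul' x y := by
    rw [ideleDeg, ideleDiv_mul, divisor_deg_add]; rfl

lemma ideleDeg_mul (x y : (Adele k)ˣ) : ideleDeg (x * y) = ideleDeg x + ideleDeg y :=
  (ideleDegHom k).map_mul x y

lemma ideleDeg_inv (x : (Adele k)ˣ) : ideleDeg x⁻¹ = -ideleDeg x := (ideleDegHom k).map_inv x

lemma finPart_diagUnit (a : (RatFunc k)ˣ) : finPart (diagUnit k a) = finDiagUnit k a := rfl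

lemma exists_polyUnit_div (a : (RatFunc k)ˣ) :
    ∃ (p r : k[X]) (hp : p ≠ 0) (hr : r ≠ 0), a * polyUnit r hr = polyUnit p hp := by
  have hn : (a : RatFunc k).num ≠ 0 := RatFunc.num_ne_zero a.ne_zero
  refine ⟨_, _, hn, (a : RatFunc k).denom_ne_zero, Units.ext ?_⟩
  rw [Units.val_mul, coe_polyUnit, coe_polyUnit]
  nth_rewrite 1 [← RatFunc.num_div_denom (a : RatFunc k)]
  exact div_mul_cancel₀ _ (polyUnit_aux (RatFunc.denom_ne_zero _))

/-- The product formula. -/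
lemma ideleDeg_diagUnit (a : (RatFunc k)ˣ) : ideleDeg (diagUnit k a) = 0 := by
  have hpoly : ∀ (p : k[X]) (hp : p ≠ 0), ideleDeg (diagUnit k (polyUnit p hp)) = 0 := by
    intro p hp
    rw [ideleDeg, divisor_deg]
    change finDeg k (finDiv (finDiagUnit k (polyUnit p hp))) +
      ordInf (algebraMap (RatFunc k) (FInf k) (algebraMap _ _ p)) = 0
    rw [finDeg_polyUnit, ordInf_algebraMap (polyUnit_aux hp), RatFunc.intDegree_polynomial,
      add_neg_cancel]
  obtain ⟨p, r, hp, hr, h⟩ := exists_polyUnit_div a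
  have h1 := hpoly p hp
  rw [← h, map_mul, ideleDeg_mul, hpoly r hr, add_zero] at h1
  exact h1

/-! ### Ideals of `A` -/

lemma finDiv_finGenUnit_mul {a e : Ideal k[X]} (ha : a ≠ ⊥) (he : e ≠ ⊥) :
    finDiv (finGenUnit (a * e)) = finDiv (finGenUnit a) + finDiv (finGenUnit e) := by
  have hae : a * e ≠ ⊥ := mul_ne_zero ha he
  rw [finGenUnit_eq ha, finGenUnit_eq he, finGenUnit_eq hae, ← finDiv_mul, ← map_mul,
    ← polyUnit_mul]
  refine finDiv_polyUnit_of_associated ?_ _ _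
  rw [← Ideal.span_singleton_eq_span_singleton, Ideal.span_singleton_generator,
    ← Ideal.span_singleton_mul_span_singleton, Ideal.span_singleton_generator,
    Ideal.span_singleton_generator]

lemma finDeg_finGenUnit {r : Ideal k[X]} (hr : r ≠ ⊥) :
    finDeg k (finDiv (finGenUnit r)) = idealDeg r := by
  rw [finGenUnit_eq hr, finDeg_polyUnit]; rfl

lemma idealDeg_mul {a e : Ideal k[X]} (ha : a ≠ ⊥) (he : e ≠ ⊥) :
    idealDeg (a * e) = idealDeg a + idealDeg e := by
  have h := congrArg (finDeg k) (finDiv_finGenUnit_mul ha he)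
  rw [map_add, finDeg_finGenUnit ha, finDeg_finGenUnit he, finDeg_finGenUnit (mul_ne_zero ha he)]
    at h
  exact_mod_cast h

/-- The constants among the nonzero rational functions. -/
def constUnit (k : Type*) [Field k] : kˣ →* (RatFunc k)ˣ := Units.map (RatFunc.C (K := k)).toMonoidHom

lemma constUnit_injective : Function.Injective (constUnit k) :=
  Units.map_injective (RatFunc.C (K := k)).injective

/-- The units of A are the constants. This is the source of the factor q - 1 in the unfolding. -/
lemma isFinIntegralUnit_finDiagUnit_iff {a : (RatFunc k)ˣ} :
    IsFinIntegralUnit (finDiagUnit k a) ↔ ∃ c, constUnit k c = a := by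
  constructor
  · rintro ⟨h1, h2⟩
    rw [coe_finDiagUnit, isFinIntegral_algebraMap_iff] at h1
    rw [← map_inv, coe_finDiagUnit, isFinIntegral_algebraMap_iff] at h2
    obtain ⟨p, hp⟩ := h1
    obtain ⟨r, hr⟩ := h2
    have hpr : p * r = 1 := by
      apply IsFractionRing.injective k[X] (RatFunc k)
      rw [map_mul, hp, hr, map_one]
      simp
    obtain ⟨c, hc, hcp⟩ := Polynomial.isUnit_iff.mp (IsUnit.of_mul_eq_one r hpr)
    refine ⟨hc.unit, Units.ext ?_⟩
    rw [← hp, ← hcp]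
    simp [constUnit]
  · rintro ⟨c, rfl⟩
    have : constUnit k c = polyUnit (C (c : k)) (C_ne_zero.mpr c.ne_zero) := by
      ext; simp [constUnit]
    rw [this]
    exact isFinIntegralUnit_polyUnit (isUnit_C.mpr c.isUnit)

/-- Strong approximation for x divided by α, followed by Euclidean division. Polynomials of degree
less than deg α thus represent 𝒪_f modulo α. -/
lemma exists_poly_sub_mul {α : k[X]} (hα : α ≠ 0) {x : FinAdele k} (hx : IsFinIntegral x) :
    ∃ β : k[X], β.degree < α.degree ∧ ∃ y, IsFinIntegral y ∧ x = polyFin k β + polyFin k α * y := by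
  set c := finDiagUnit k (polyUnit α hα)
  have hc : (c : FinAdele k) = polyFin k α := rfl
  obtain ⟨f, hf⟩ := exists_ratFunc_sub_integral ((↑c⁻¹ : FinAdele k) * x)
  have hcx : polyFin k α * ((↑c⁻¹ : FinAdele k) * x) = x := by rw [← hc]; simp
  obtain ⟨p, hp⟩ : ∃ p, algebraMap k[X] (RatFunc k) p = algebraMap _ _ α * f := by
    rw [← isFinIntegral_algebraMap_iff]
    have h1 : algebraMap (RatFunc k) (FinAdele k) (algebraMap _ _ α * f) = x - polyFin k α *
        ((↑c⁻¹ : FinAdele k) * x - algebraMap (RatFunc k) (FinAdele k) f) := by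
      rw [mul_sub, hcx, map_mul, sub_sub_cancel]; rfl
    rw [h1]
    exact (finIntegers k).sub_mem hx ((finIntegers k).mul_mem (isFinIntegral_polyFin _) hf)
  refine ⟨p % α, EuclideanDomain.mod_lt p hα, ((↑c⁻¹ : FinAdele k) * x - algebraMap _ _ f) +
    polyFin k (p / α), (finIntegers k).add_mem hf (isFinIntegral_polyFin _), ?_⟩
  have h2 : polyFin k p = polyFin k α * algebraMap (RatFunc k) (FinAdele k) f := by
    change algebraMap (RatFunc k) (FinAdele k) _ = _
    rw [hp, map_mul]; rfl
  have h3 : polyFin k p = polyFin k α * polyFin k (p / α) + polyFin k (p % α) := by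
    rw [← map_mul, ← map_add, EuclideanDomain.div_add_mod]
  rw [mul_add, mul_sub, hcx]
  linear_combination h3 - h2

/-- The quotient is a rational function without finite poles, hence a polynomial. This makes the
above representatives of residues unique. -/
lemma dvd_of_polyFin_eq_mul {α β : k[X]} (hα : α ≠ 0) {y : FinAdele k} (hy : IsFinIntegral y)
    (h : polyFin k β = polyFin k α * y) : α ∣ β := by
  have h1 : y = algebraMap (RatFunc k) (FinAdele k) (algebraMap _ _ β / algebraMap _ _ α) := by
    have hu : IsUnit (polyFin k α) := (finDiagUnit k (polyUnit α hα)).isUnit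
    rw [← hu.mul_right_inj, ← h]
    change _ = algebraMap (RatFunc k) (FinAdele k) _ * _
    rw [← map_mul, mul_div_cancel₀ _ (polyUnit_aux hα)]
    rfl
  rw [h1, isFinIntegral_algebraMap_iff] at hy
  obtain ⟨p, hp⟩ := hy
  refine ⟨p, IsFractionRing.injective k[X] (RatFunc k) ?_⟩
  rw [map_mul, hp, mul_div_cancel₀ _ (polyUnit_aux hα)]

/-- A power of the standard uniformizer `T⁻¹` at infinity: a unit of `F_∞` of valuation `n`. -/
def infPow (k : Type*) [Field k] (n : ℤ) : (FInf k)ˣ :=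
  Units.map (algebraMap (RatFunc k) (FInf k)).toMonoidHom (Units.mk0 RatFunc.X RatFunc.X_ne_zero ^ (-n))

@[simp] lemma ordInf_infPow (n : ℤ) : ordInf (infPow k n : FInf k) = n := by
  have h : (infPow k n : FInf k) = algebraMap (RatFunc k) (FInf k) RatFunc.X ^ (-n) := by
    simp [infPow]
  rw [ordInf_eq_iff (Units.ne_zero _), h, map_zpow₀, valued_inf_algebraMap RatFunc.X_ne_zero,
    RatFunc.intDegree_X, ← WithZero.exp_zsmul]
  simp

lemma valued_infPow (n : ℤ) : Valued.v (infPow k n : FInf k) = WithZero.exp (-n) := by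
  rw [valued_eq_exp_ordInf (Units.ne_zero _), ordInf_infPow]

end Degrees

section Compactness

/-! ### Compactness -/

-- The unit ball is a complete discrete valuation ring, and its residue field is finite because S
-- meets every residue class.
open Valued in
lemma isCompact_valued_le_one {K : Type*} [Field K] [Valued K (WithZero (Multiplicative ℤ))]
    [CompleteSpace K] (h1 : ∃ x : K, x ≠ 0 ∧ Valued.v x ≠ 1) {S : Set K} (hS : S.Finite)
    (h2 : ∀ x : K, Valued.v x ≤ 1 → ∃ s ∈ S, Valued.v (x - s) < 1) :
    IsCompact {x : K | Valued.v x ≤ 1} := by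
  have hnt : (Valued.v : Valuation K (WithZero (Multiplicative ℤ))).IsNontrivial :=
    ⟨h1.choose, by simpa using h1.choose_spec.1, h1.choose_spec.2⟩
  have hd : (Valued.v : Valuation K (WithZero (Multiplicative ℤ))).IsRankOneDiscrete := inferInstance
  let _ : (Valued.v : Valuation K (WithZero (Multiplicative ℤ))).RankOne :=
    Valuation.IsRankOneDiscrete.rankOne _ (e := 2) (by norm_num)
  have hdvr : IsDiscreteValuationRing 𝒪[K] :=
    inferInstanceAs (IsDiscreteValuationRing
      (Valued.v : Valuation K (WithZero (Multiplicative ℤ))).valuationSubring)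
  have hfin : Finite 𝓀[K] := by
    classical
    have : Finite S := hS
    let f : S → 𝓀[K] := fun s => if h : Valued.v (s : K) ≤ 1 then
      IsLocalRing.residue 𝒪[K] ⟨s, h⟩ else 0
    refine Finite.of_surjective f fun y => ?_
    obtain ⟨x, rfl⟩ := IsLocalRing.residue_surjective y
    obtain ⟨s, hs, hxs⟩ := h2 x x.2
    have hs1 : Valued.v s ≤ 1 := by
      have : s = x - (x - s) := by ring
      rw [this]
      exact (Valuation.map_sub _ _ _).trans (max_le x.2 hxs.le)
    refine ⟨⟨s, hs⟩, ?_⟩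
    simp only [f]
    rw [dif_pos hs1, eq_comm, ← sub_eq_zero, ← map_sub, IsLocalRing.residue_eq_zero_iff,
      IsLocalRing.mem_maximalIdeal, mem_nonunits_iff, Valuation.Integer.not_isUnit_iff_valuation_lt_one]
    exact hxs
  have hcomp : CompleteSpace 𝒪[K] := by
    exact (Valued.isClosed_integer K).completeSpace_coe
  have := Valued.integer.compactSpace_iff_completeSpace_and_isDiscreteValuationRing_and_finite_residueField.mpr
    ⟨hcomp, hdvr, hfin⟩
  exact isCompact_iff_compactSpace.mpr this

variable {k : Type*} [Field k]

lemma finite_degree_lt [Finite k] (n : WithBot ℕ) : {p : k[X] | p.degree < n}.Finite := by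
  have hfin : ∀ n : ℕ, {p : k[X] | p.degree < n}.Finite := fun n => by
    have : Finite (degreeLT k n) := Finite.of_equiv _ (degreeLTEquiv k n).symm.toEquiv
    refine (Set.toFinite (degreeLT k n : Set k[X])).subset fun p hp => ?_
    exact mem_degreeLT.mpr hp
  induction n using WithBot.recBotCoe with
  | bot => simp
  | coe n => exact hfin n

lemma isCompact_adicCompletionIntegers [Finite k] (v : HeightOneSpectrum k[X]) :
    IsCompact {x : v.adicCompletion (RatFunc k) | Valued.v x ≤ 1} := by
  classical
  refine isCompact_valued_le_one ⟨polyFin k (primeGen v) v, ?_, ?_⟩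
    (((finite_degree_lt (k := k) (primeGen v).degree)).image fun β => polyFin k β v) fun x hx => ?_
  · exact finUnit_apply_ne_zero (finDiagUnit k (polyUnit _ (primeGen_ne_zero v))) v
  · rw [valued_polyFin, intValuation_primeGen_self, Ne, WithZero.exp_eq_one]
    norm_num
  -- The local integer x is extended by 0 at the other places, so that the global division statement
  -- gives its residue.
  · obtain ⟨β, hβ, y, hy, h⟩ := exists_poly_sub_mul (primeGen_ne_zero v)
      (x := finAdeleOfIntegral (Function.update 0 v x) fun w => by
        by_cases h : w = v
        · subst h
          rw [Function.update_self]
          exact hx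
        · rw [Function.update_of_ne h]
          exact zero_mem _)
      (fun w => by
        by_cases h : w = v
        · subst h
          rw [finAdeleOfIntegral_apply, Function.update_self]
          exact hx
        · rw [finAdeleOfIntegral_apply, Function.update_of_ne h]
          exact zero_mem _)
    refine ⟨_, ⟨β, hβ, rfl⟩, ?_⟩
    have h1 := DFunLike.congr_fun h v
    rw [finAdeleOfIntegral_apply, Function.update_self, finAdele_add_apply, finAdele_mul_apply] at h1
    rw [h1, add_sub_cancel_left, map_mul, valued_polyFin, intValuation_primeGen_self]
    have h2 : Valued.v (y v) ≤ 1 := hy v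
    calc _ ≤ WithZero.exp (-1 : ℤ) * 1 := by gcongr
      _ < 1 := by rw [mul_one, ← WithZero.exp_zero, WithZero.exp_lt_exp]; norm_num

lemma isCompact_finIntegers [Finite k] : IsCompact {x : FinAdele k | IsFinIntegral x} := by
  have : ∀ v : HeightOneSpectrum k[X], CompactSpace (v.adicCompletionIntegers (RatFunc k)) :=
    fun v => isCompact_iff_compactSpace.mp (isCompact_adicCompletionIntegers v)
  have h := isCompact_range (RestrictedProduct.isEmbedding_structureMap
    (R := fun v : HeightOneSpectrum k[X] => v.adicCompletion (RatFunc k))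
    (A := fun v => (v.adicCompletionIntegers (RatFunc k) : Set (v.adicCompletion (RatFunc k))))
    (𝓕 := Filter.cofinite)).continuous
  rw [RestrictedProduct.range_structureMap] at h
  exact h

instance : CompleteSpace (FInf k) :=
  @UniformSpace.Completion.completeSpace (RatFunc k)
    (@RatFunc.inftyValued k _ (Classical.decEq _)).toUniformSpace

lemma isCompact_infIntegers [Finite k] : IsCompact {x : FInf k | Valued.v x ≤ 1} := by
  refine isCompact_valued_le_one ⟨infPow k 1, Units.ne_zero _, ?_⟩
    ((finite_degree_lt (k := k) 1).image (polyInf k)) fun x hx => ?_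
  · rw [valued_infPow, Ne, WithZero.exp_eq_one]
    norm_num
  · obtain ⟨p, hp⟩ := exists_poly_inf x
    refine ⟨_, ⟨p, ?_, rfl⟩, hp⟩
    have h1 : Valued.v (polyInf k p) < WithZero.exp ((1 : ℕ) : ℤ) := by
      have : polyInf k p = x - (x - polyInf k p) := by ring
      rw [this]
      refine ((Valuation.map_sub _ _ _).trans (max_le hx hp.le)).trans_lt ?_
      rw [← WithZero.exp_zero, WithZero.exp_lt_exp]
      norm_num
    exact valued_polyInf_lt.mp h1

lemma isOpen_finIntegers : IsOpen {x : FinAdele k | IsFinIntegral x} :=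
  RestrictedProduct.isOpen_forall_mem fun _ => Valued.isOpen_valuationSubring _

lemma isOpen_integralAdele : IsOpen {x : Adele k | IsIntegralAdele x} :=
  (isOpen_finIntegers.preimage continuous_fst).inter
    ((Valued.isOpen_integer (FInf k)).preimage continuous_snd)

lemma isOpen_inIdeal {m : Ideal k[X]} (hm : m ≠ ⊥) : IsOpen {x : FinAdele k | InIdeal m x} := by
  have h : {x : FinAdele k | InIdeal m x} =
      (fun x : FinAdele k => (((finGenUnit m)⁻¹ : (FinAdele k)ˣ) : FinAdele k) * x) ⁻¹' {x | IsFinIntegral x} := by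
    ext x
    rw [Set.mem_preimage, Set.mem_ofPred_eq, Set.mem_ofPred_eq, ← exists_integral_mul_iff,
      coe_finGenUnit hm, InIdeal]
  rw [h]
  exact isOpen_finIntegers.preimage (continuous_const.mul continuous_id)

/-- The compact ring 𝒪 surjects onto the quotient, because 𝔸 = F + 𝒪. -/
instance [Finite k] : CompactSpace (Adele k ⧸ principalAdeles k) := by
  constructor
  have h : IsCompact {x : Adele k | IsIntegralAdele x} :=
    isCompact_finIntegers.prod isCompact_infIntegers
  have h2 := h.image (f := (QuotientAddGroup.mk : Adele k → Adele k ⧸ principalAdeles k))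
    QuotientAddGroup.continuous_mk
  refine h2.of_isClosed_subset isClosed_univ fun x _ => ?_
  induction x using QuotientAddGroup.induction_on with
  | H x =>
    obtain ⟨a, ha, hb⟩ := exists_ratFunc_sub_adele x
    refine ⟨x - algebraMap (RatFunc k) (Adele k) a, ⟨ha, hb.le⟩, ?_⟩
    rw [QuotientAddGroup.eq]
    exact ⟨a, by simp⟩

/-- `IsCuspidal` quantifies over all such measures, so one has to exist before cuspidality can be
applied. -/
lemma exists_addHaar_probability [Finite k] : ∃ ν : Measure (Adele k ⧸ principalAdeles k),
    ν.IsAddHaarMeasure ∧ IsProbabilityMeasure ν := by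
  let K : TopologicalSpace.PositiveCompacts (Adele k ⧸ principalAdeles k) := ⊤
  refine ⟨Measure.addHaarMeasure K, inferInstance, ⟨?_⟩⟩
  exact Measure.addHaarMeasure_self

end Compactness

section Levels

/-! ### Open subgroups -/

variable {k : Type*} [Field k]

lemma continuous_entry (i j : Fin 2) : Continuous fun g : GL2A k => g i j :=
  Units.continuous_val.matrix_elem i j

lemma continuous_inv_entry (i j : Fin 2) : Continuous fun g : GL2A k => g⁻¹ i j :=
  (Units.continuous_val.comp continuous_inv).matrix_elem i j

lemma isOpen_GL2O : IsOpen (GL2O k) := by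
  have : GL2O k = ⋂ i : Fin 2, ⋂ j : Fin 2, {g : GL2A k | IsIntegralAdele (g i j)} ∩
      {g : GL2A k | IsIntegralAdele (g⁻¹ i j)} := by
    ext g
    simp [GL2O]
  rw [this]
  refine isOpen_iInter_of_finite fun i => isOpen_iInter_of_finite fun j => ?_
  exact (isOpen_integralAdele.preimage (continuous_entry i j)).inter
    (isOpen_integralAdele.preimage (continuous_inv_entry i j))

lemma isOpen_K0Inf {m : Ideal k[X]} (hm : m ≠ ⊥) : IsOpen (K0Inf m) := by
  refine isOpen_GL2O.inter (IsOpen.inter ?_ ?_)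
  · exact (isOpen_inIdeal hm).preimage (continuous_fst.comp (continuous_entry 1 0))
  · exact (isOpen_valued_lt_one (K := FInf k)).preimage (continuous_snd.comp (continuous_entry 1 0))

end Levels

section GenericGL

/-! ### Congruence subgroups of `GL₂` of a ring -/

variable {R : Type*} [CommRing R]

lemma gl_ext {g h : GL (Fin 2) R} (h00 : g 0 0 = h 0 0) (h01 : g 0 1 = h 0 1)
    (h10 : g 1 0 = h 1 0) (h11 : g 1 1 = h 1 1) : g = h := by
  ext i j
  fin_cases i <;> fin_cases j <;> assumption

lemma gl_mul_apply (g h : GL (Fin 2) R) (i j : Fin 2) :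
    (g * h) i j = g i 0 * h 0 j + g i 1 * h 1 j := by
  rw [Units.val_mul, Matrix.mul_apply, Fin.sum_univ_two]

lemma gl_one_apply (i j : Fin 2) : (1 : GL (Fin 2) R) i j = if i = j then 1 else 0 :=
  Matrix.one_apply

lemma gl_det (g : GL (Fin 2) R) :
    (Matrix.GeneralLinearGroup.det g : R) = g 0 0 * g 1 1 - g 0 1 * g 1 0 :=
  Matrix.det_fin_two _

lemma gl_det_inv (g : GL (Fin 2) R) :
    (((Matrix.GeneralLinearGroup.det g)⁻¹ : Rˣ) : R) =
      g⁻¹ 0 0 * g⁻¹ 1 1 - g⁻¹ 0 1 * g⁻¹ 1 0 := by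
  rw [← map_inv, gl_det]

lemma gl_inv_apply (g : GL (Fin 2) R) (i j : Fin 2) :
    g⁻¹ i j = (((Matrix.GeneralLinearGroup.det g)⁻¹ : Rˣ) : R) *
      !![g 1 1, -g 0 1; -g 1 0, g 0 0] i j := by
  have hd := (Matrix.GeneralLinearGroup.det g).mul_inv
  rw [gl_det] at hd
  set e := (((Matrix.GeneralLinearGroup.det g)⁻¹ : Rˣ) : R)
  have h : (g⁻¹ : GL (Fin 2) R).val = e • !![g 1 1, -g 0 1; -g 1 0, g 0 0] := by
    have h1 : g.val * (e • !![g 1 1, -g 0 1; -g 1 0, g 0 0]) = 1 := by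
      ext i j
      fin_cases i <;> fin_cases j <;>
        simp [Matrix.mul_apply, Fin.sum_univ_two] <;>
        first | ring1 | linear_combination hd
    exact Units.inv_eq_of_mul_eq_one_right h1
  rw [h, Matrix.smul_apply, smul_eq_mul]

/-- The matrices in `GL₂(S)` with lower left entry in `J`, for a subring `S` of `R`. -/
def k0GL (S : Subring R) (J : AddSubgroup R) (hJ : ∀ s ∈ S, ∀ x ∈ J, s * x ∈ J) :
    Subgroup (GL (Fin 2) R) where
  carrier := {g | (∀ i j, g i j ∈ S ∧ g⁻¹ i j ∈ S) ∧ g 1 0 ∈ J}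
  mul_mem' := by
    rintro g h ⟨hg, hg'⟩ ⟨hh, hh'⟩
    refine ⟨fun i j => ⟨?_, ?_⟩, ?_⟩
    · rw [gl_mul_apply]
      exact S.add_mem (S.mul_mem (hg _ _).1 (hh _ _).1) (S.mul_mem (hg _ _).1 (hh _ _).1)
    · rw [mul_inv_rev, gl_mul_apply]
      exact S.add_mem (S.mul_mem (hh _ _).2 (hg _ _).2) (S.mul_mem (hh _ _).2 (hg _ _).2)
    · rw [gl_mul_apply, mul_comm (g 1 0)]
      exact J.add_mem (hJ _ (hh _ _).1 _ hg') (hJ _ (hg _ _).1 _ hh')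
  one_mem' := by
    refine ⟨fun i j => ⟨?_, ?_⟩, ?_⟩
    · rw [gl_one_apply]; split_ifs
      exacts [S.one_mem, S.zero_mem]
    · rw [inv_one, gl_one_apply]; split_ifs
      exacts [S.one_mem, S.zero_mem]
    · rw [gl_one_apply, if_neg one_ne_zero]
      exact J.zero_mem
  inv_mem' := by
    rintro g ⟨hg, hg'⟩
    refine ⟨fun i j => ⟨(hg i j).2, by rw [inv_inv]; exact (hg i j).1⟩, ?_⟩
    rw [gl_inv_apply, gl_det_inv]
    refine hJ _ (S.sub_mem (S.mul_mem (hg _ _).2 (hg _ _).2) (S.mul_mem (hg _ _).2 (hg _ _).2)) _ ?_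
    exact J.neg_mem hg'

lemma mem_k0GL {S : Subring R} {J : AddSubgroup R} {hJ : ∀ s ∈ S, ∀ x ∈ J, s * x ∈ J}
    {g : GL (Fin 2) R} : g ∈ k0GL S J hJ ↔ (∀ i j, g i j ∈ S ∧ g⁻¹ i j ∈ S) ∧ g 1 0 ∈ J := Iff.rfl

lemma mem_k0GL_of_det {S : Subring R} {J : AddSubgroup R} {hJ : ∀ s ∈ S, ∀ x ∈ J, s * x ∈ J}
    {g : GL (Fin 2) R} (h : ∀ i j, g i j ∈ S)
    (hd : (((Matrix.GeneralLinearGroup.det g)⁻¹ : Rˣ) : R) ∈ S) (h10 : g 1 0 ∈ J) :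
    g ∈ k0GL S J hJ := by
  refine ⟨fun i j => ⟨h i j, ?_⟩, h10⟩
  rw [gl_inv_apply]
  refine S.mul_mem hd ?_
  fin_cases i <;> fin_cases j
  exacts [h _ _, S.neg_mem (h _ _), S.neg_mem (h _ _), h _ _]

lemma gl_det_mem_of_mem {S : Subring R} {J : AddSubgroup R} {hJ : ∀ s ∈ S, ∀ x ∈ J, s * x ∈ J}
    {g : GL (Fin 2) R} (h : g ∈ k0GL S J hJ) :
    (Matrix.GeneralLinearGroup.det g : R) ∈ S ∧
      (((Matrix.GeneralLinearGroup.det g)⁻¹ : Rˣ) : R) ∈ S := by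
  rw [gl_det_inv, gl_det]
  exact ⟨S.sub_mem (S.mul_mem (h.1 _ _).1 (h.1 _ _).1) (S.mul_mem (h.1 _ _).1 (h.1 _ _).1),
    S.sub_mem (S.mul_mem (h.1 _ _).2 (h.1 _ _).2) (S.mul_mem (h.1 _ _).2 (h.1 _ _).2)⟩

/-- `GL₂(S)`, for a subring `S` of `R`. -/
def intGL (S : Subring R) : Subgroup (GL (Fin 2) R) := k0GL S ⊤ fun _ _ _ _ => trivial

lemma mem_intGL {S : Subring R} {g : GL (Fin 2) R} :
    g ∈ intGL S ↔ ∀ i j, g i j ∈ S ∧ g⁻¹ i j ∈ S := and_iff_left trivial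

lemma mem_intGL_of_det {S : Subring R} {g : GL (Fin 2) R} (h : ∀ i j, g i j ∈ S)
    (hd : (((Matrix.GeneralLinearGroup.det g)⁻¹ : Rˣ) : R) ∈ S) : g ∈ intGL S :=
  mem_k0GL_of_det h hd trivial

/-- The matrix `(a b; 0 d)`, for units `a` and `d`. -/
def triGL (a d : Rˣ) (b : R) : GL (Fin 2) R where
  val := !![(a : R), b; 0, d]
  inv := !![((a⁻¹ : Rˣ) : R), -((a⁻¹ : Rˣ) : R) * b * ((d⁻¹ : Rˣ) : R); 0, ((d⁻¹ : Rˣ) : R)]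
  val_inv := by
    ext i j
    fin_cases i <;> fin_cases j <;> simp [Matrix.mul_apply, Fin.sum_univ_two, mul_assoc]
  inv_val := by
    ext i j
    fin_cases i <;> fin_cases j <;> simp [Matrix.mul_apply, Fin.sum_univ_two]

@[simp] lemma triGL_00 (a d : Rˣ) (b : R) : triGL a d b 0 0 = a := rfl
@[simp] lemma triGL_01 (a d : Rˣ) (b : R) : triGL a d b 0 1 = b := rfl
@[simp] lemma triGL_10 (a d : Rˣ) (b : R) : triGL a d b 1 0 = 0 := rfl
@[simp] lemma triGL_11 (a d : Rˣ) (b : R) : triGL a d b 1 1 = d := rfl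
@[simp] lemma affineGL_00 (x : Rˣ) (y : R) : affineGL x y 0 0 = x := rfl
@[simp] lemma affineGL_01 (x : Rˣ) (y : R) : affineGL x y 0 1 = y := rfl
@[simp] lemma affineGL_10 (x : Rˣ) (y : R) : affineGL x y 1 0 = 0 := rfl
@[simp] lemma affineGL_11 (x : Rˣ) (y : R) : affineGL x y 1 1 = 1 := rfl
@[simp] lemma lowerGL_00 (c : R) : lowerGL c 0 0 = 1 := rfl
@[simp] lemma lowerGL_01 (c : R) : lowerGL c 0 1 = 0 := rfl
@[simp] lemma lowerGL_10 (c : R) : lowerGL c 1 0 = c := rfl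
@[simp] lemma lowerGL_11 (c : R) : lowerGL c 1 1 = 1 := rfl
@[simp] lemma antiGL_00 (c : Rˣ) : antiGL c 0 0 = 0 := rfl
@[simp] lemma antiGL_01 (c : Rˣ) : antiGL c 0 1 = 1 := rfl
@[simp] lemma antiGL_10 (c : Rˣ) : antiGL c 1 0 = c := rfl
@[simp] lemma antiGL_11 (c : Rˣ) : antiGL c 1 1 = 0 := rfl

lemma det_triGL (a d : Rˣ) (b : R) : Matrix.GeneralLinearGroup.det (triGL a d b) = a * d := by
  ext
  rw [gl_det]
  simp

lemma affineGL_eq (x : Rˣ) (y : R) : affineGL x y = triGL x 1 y := gl_ext rfl rfl rfl rfl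

lemma triGL_mul (a d a' d' : Rˣ) (b b' : R) :
    triGL a d b * triGL a' d' b' = triGL (a * a') (d * d') (a * b' + b * d') := by
  apply gl_ext <;> simp [gl_mul_apply]

lemma affineGL_mul (x x' : Rˣ) (y y' : R) :
    affineGL x y * affineGL x' y' = affineGL (x * x') (x * y' + y) := by
  simp [affineGL_eq, triGL_mul]

lemma triGL_mem_k0GL {S : Subring R} {J : AddSubgroup R} {hJ : ∀ s ∈ S, ∀ x ∈ J, s * x ∈ J}
    {a d : Rˣ} {b : R} (ha : (a : R) ∈ S) (ha' : ((a⁻¹ : Rˣ) : R) ∈ S) (hd : (d : R) ∈ S)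
    (hd' : ((d⁻¹ : Rˣ) : R) ∈ S) (hb : b ∈ S) : triGL a d b ∈ k0GL S J hJ := by
  refine mem_k0GL_of_det ?_ ?_ J.zero_mem
  · intro i j
    fin_cases i <;> fin_cases j
    exacts [ha, hb, S.zero_mem, hd]
  · rw [det_triGL, mul_inv, Units.val_mul]
    exact S.mul_mem ha' hd'

/-- The scalar matrix attached to a unit. -/
abbrev scalarGL (z : Rˣ) : GL (Fin 2) R := Matrix.GeneralLinearGroup.scalar (Fin 2) z

lemma scalarGL_eq (z : Rˣ) : scalarGL z = triGL z z 0 := by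
  apply gl_ext <;> simp [scalarGL, Matrix.GeneralLinearGroup.scalar]

lemma scalarGL_mem_center (z : Rˣ) : scalarGL z ∈ Subgroup.center (GL (Fin 2) R) := by
  rw [Matrix.GeneralLinearGroup.center_eq_range_scalar]
  exact ⟨z, rfl⟩

lemma mem_center_iff {g : GL (Fin 2) R} :
    g ∈ Subgroup.center (GL (Fin 2) R) ↔ ∃ z, scalarGL z = g := by
  rw [Matrix.GeneralLinearGroup.center_eq_range_scalar]
  rfl

lemma scalarGL_comm (z : Rˣ) (g : GL (Fin 2) R) : scalarGL z * g = g * scalarGL z :=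
  (Subgroup.mem_center_iff.mp (scalarGL_mem_center z) g).symm

end GenericGL

section Components

/-! ### The components of an adelic matrix -/

variable {k : Type*} [Field k]

/-- The finite component of an adelic matrix. -/
def gFin (k : Type*) [Field k] : GL2A k →* GL (Fin 2) (FinAdele k) :=
  Matrix.GeneralLinearGroup.map (RingHom.fst (FinAdele k) (FInf k))

/-- The infinite component of an adelic matrix. -/
def gInf (k : Type*) [Field k] : GL2A k →* GL (Fin 2) (FInf k) :=
  Matrix.GeneralLinearGroup.map (RingHom.snd (FinAdele k) (FInf k))

lemma gFin_apply (g : GL2A k) (i j : Fin 2) : gFin k g i j = (g i j).1 := rfl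

lemma gInf_apply (g : GL2A k) (i j : Fin 2) : gInf k g i j = (g i j).2 := rfl

lemma gl2A_ext {g h : GL2A k} (h1 : gFin k g = gFin k h) (h2 : gInf k g = gInf k h) : g = h :=
  Units.ext <| Matrix.ext fun i j => Prod.ext
    (congrArg (fun x : GL (Fin 2) (FinAdele k) => x i j) h1)
    (congrArg (fun x : GL (Fin 2) (FInf k) => x i j) h2)

lemma pair_mul_eq_one {a b : Matrix (Fin 2) (Fin 2) (FinAdele k)}
    {c d : Matrix (Fin 2) (Fin 2) (FInf k)} (h1 : a * b = 1) (h2 : c * d = 1) :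
    (Matrix.of fun i j => (a i j, c i j) : Matrix (Fin 2) (Fin 2) (Adele k)) *
      (Matrix.of fun i j => (b i j, d i j)) = 1 := by
  refine Matrix.ext fun i j => Prod.ext ?_ ?_
  · have h := congrFun (congrFun h1 i) j
    rw [Matrix.mul_apply, Fin.sum_univ_two] at h ⊢
    refine h.trans ?_
    rw [Matrix.one_apply, Matrix.one_apply]
    split_ifs <;> rfl
  · have h := congrFun (congrFun h2 i) j
    rw [Matrix.mul_apply, Fin.sum_univ_two] at h ⊢
    refine h.trans ?_
    rw [Matrix.one_apply, Matrix.one_apply]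
    split_ifs <;> rfl

/-- The adelic matrix with given components. -/
def pairGL (a : GL (Fin 2) (FinAdele k)) (b : GL (Fin 2) (FInf k)) : GL2A k where
  val := Matrix.of fun i j => (a i j, b i j)
  inv := Matrix.of fun i j => (a⁻¹ i j, b⁻¹ i j)
  val_inv := pair_mul_eq_one a.mul_inv b.mul_inv
  inv_val := pair_mul_eq_one a.inv_mul b.inv_mul

@[simp] lemma gFin_pairGL (a : GL (Fin 2) (FinAdele k)) (b : GL (Fin 2) (FInf k)) :
    gFin k (pairGL a b) = a := Units.ext rfl

@[simp] lemma gInf_pairGL (a : GL (Fin 2) (FinAdele k)) (b : GL (Fin 2) (FInf k)) :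
    gInf k (pairGL a b) = b := Units.ext rfl

/-- The ideal `𝔪𝒪_f`, as a subgroup. -/
def finIdeal (m : Ideal k[X]) : AddSubgroup (FinAdele k) where
  carrier := {x | InIdeal m x}
  add_mem' := InIdeal.add
  zero_mem' := ⟨0, (finIntegers k).zero_mem, by simp⟩
  neg_mem' := InIdeal.neg

lemma mem_finIdeal {m : Ideal k[X]} {x : FinAdele k} : x ∈ finIdeal m ↔ InIdeal m x := Iff.rfl

/-- The finite component of `𝕂₀(𝔪∞)`. -/
def k0Fin (m : Ideal k[X]) : Subgroup (GL (Fin 2) (FinAdele k)) :=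
  k0GL (finIntegers k) (finIdeal m) fun _ hs _ hx =>
    mem_finIdeal.mpr ((mem_finIdeal.mp hx).mul_left (mem_finIntegers.mp hs))

/-- The ring `𝒪_∞`. -/
def infIntegers (k : Type*) [Field k] : Subring (FInf k) := (Valued.v : Valuation (FInf k) _).integer

lemma mem_infIntegers {x : FInf k} : x ∈ infIntegers k ↔ Valued.v x ≤ 1 := Iff.rfl

/-- The maximal ideal of `𝒪_∞`. -/
def infMaxIdeal (k : Type*) [Field k] : AddSubgroup (FInf k) :=
  (Valued.v : Valuation (FInf k) _).ltAddSubgroup 1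

lemma mem_infMaxIdeal {x : FInf k} : x ∈ infMaxIdeal k ↔ Valued.v x < 1 := by
  simp [infMaxIdeal]

/-- The Iwahori subgroup of `GL₂(F_∞)`. -/
def k0InfComp (k : Type*) [Field k] : Subgroup (GL (Fin 2) (FInf k)) :=
  k0GL (infIntegers k) (infMaxIdeal k) fun s hs x hx => by
    rw [mem_infMaxIdeal] at hx ⊢
    rw [map_mul]
    exact (mul_le_mul_of_nonneg_right (mem_infIntegers.mp hs) zero_le).trans_lt (by rwa [one_mul])

/-- The group `𝕂₀(𝔪∞)`. -/
def k0 (m : Ideal k[X]) : Subgroup (GL2A k) :=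
  (k0Fin m).comap (gFin k) ⊓ (k0InfComp k).comap (gInf k)

lemma mem_k0_iff {m : Ideal k[X]} {g : GL2A k} :
    g ∈ k0 m ↔ gFin k g ∈ k0Fin m ∧ gInf k g ∈ k0InfComp k := Iff.rfl

lemma coe_k0 (m : Ideal k[X]) : (k0 m : Set (GL2A k)) = K0Inf m := by
  ext g
  rw [SetLike.mem_coe, mem_k0_iff, k0Fin, k0InfComp, mem_k0GL, mem_k0GL, mem_infMaxIdeal]
  constructor
  · rintro ⟨⟨h1, h2⟩, h3, h4⟩
    exact ⟨fun i j => ⟨⟨(h1 i j).1, (h3 i j).1⟩, ⟨(h1 i j).2, (h3 i j).2⟩⟩, h2, h4⟩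
  · rintro ⟨h1, h2, h3⟩
    exact ⟨⟨fun i j => ⟨(h1 i j).1.1, (h1 i j).2.1⟩, h2⟩, fun i j => ⟨(h1 i j).1.2, (h1 i j).2.2⟩, h3⟩

/-- The group `GL₂(𝒪)`. -/
def gl2O (k : Type*) [Field k] : Subgroup (GL2A k) :=
  (intGL (finIntegers k)).comap (gFin k) ⊓ (intGL (infIntegers k)).comap (gInf k)

lemma coe_gl2O : (gl2O k : Set (GL2A k)) = GL2O k := by
  ext g
  rw [SetLike.mem_coe, gl2O, Subgroup.mem_inf, Subgroup.mem_comap, Subgroup.mem_comap, mem_intGL,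
    mem_intGL]
  constructor
  · rintro ⟨h1, h3⟩
    exact fun i j => ⟨⟨(h1 i j).1, (h3 i j).1⟩, ⟨(h1 i j).2, (h3 i j).2⟩⟩
  · rintro h1
    exact ⟨fun i j => ⟨(h1 i j).1.1, (h1 i j).2.1⟩, fun i j => ⟨(h1 i j).1.2, (h1 i j).2.2⟩⟩

lemma k0_le_gl2O (m : Ideal k[X]) : k0 m ≤ gl2O k := fun _ h =>
  ⟨mem_intGL.mpr h.1.1, mem_intGL.mpr h.2.1⟩

lemma k0_mono {m n : Ideal k[X]} (h : n ∣ m) : k0 m ≤ k0 n := fun _ hg =>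
  ⟨⟨hg.1.1, InIdeal.of_dvd h hg.1.2⟩, hg.2⟩

/-- The diagonal embedding of `GL₂(F)`, at the finite places. -/
def diagGLFin (k : Type*) [Field k] : GL (Fin 2) (RatFunc k) →* GL (Fin 2) (FinAdele k) :=
  Matrix.GeneralLinearGroup.map (algebraMap (RatFunc k) (FinAdele k))

/-- The embedding of `GL₂(F)` in `GL₂(F_∞)`. -/
def diagGLInf (k : Type*) [Field k] : GL (Fin 2) (RatFunc k) →* GL (Fin 2) (FInf k) :=
  Matrix.GeneralLinearGroup.map (algebraMap (RatFunc k) (FInf k))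

@[simp] lemma gFin_diagGL (γ : GL (Fin 2) (RatFunc k)) : gFin k (diagGL k γ) = diagGLFin k γ :=
  Units.ext rfl

@[simp] lemma gInf_diagGL (γ : GL (Fin 2) (RatFunc k)) : gInf k (diagGL k γ) = diagGLInf k γ :=
  Units.ext rfl

lemma gl_map_triGL {R S : Type*} [CommRing R] [CommRing S] (f : R →+* S) (a d : Rˣ) (b : R) :
    Matrix.GeneralLinearGroup.map f (triGL a d b) =
      triGL (Units.map f.toMonoidHom a) (Units.map f.toMonoidHom d) (f b) := by
  apply gl_ext <;> simp

end Components

section Iwasawa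

variable {k : Type*} [Field k]

/-! ### Iwasawa decomposition at the finite places -/

open scoped Classical in
/-- The lower left entry of the compact factor in the local Iwasawa decomposition of a matrix with
lower row `(c, d)`. -/
def localLower {K Γ : Type*} [Field K] [LinearOrderedCommGroupWithZero Γ] [Valued K Γ]
    (c d : K) : K := if Valued.v c ≤ Valued.v d then c / d else 1

lemma valued_div_le_one {K Γ : Type*} [Field K] [LinearOrderedCommGroupWithZero Γ]
    (v : Valuation K Γ) {c d : K} (h : v c ≤ v d) : v (c / d) ≤ 1 := by
  rcases eq_or_ne d 0 with rfl | hd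
  · simp
  · rw [map_div₀, div_le_one₀ (zero_lt_iff.mpr (by simpa using hd))]
    exact h

/-- At each place divide the row (c, d) by whichever of c and d is larger. The idempotent e marks
the places where d is chosen, and e, e - 1 completes the normalized row to a matrix of determinant
1. -/
lemma exists_lower_row (c d : FinAdele k) : ∃ e c' d' w : FinAdele k,
    IsFinIntegral e ∧ IsFinIntegral c' ∧ IsFinIntegral d' ∧ w * c' = c ∧ w * d' = d ∧
      e * d' + (1 - e) * c' = 1 ∧ ∀ v, c' v = localLower (c v) (d v) := by
  classical
  let e : FinAdele k := finAdeleOfIntegral (fun v => if Valued.v (c v) ≤ Valued.v (d v) then 1 else 0)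
    fun v => by split_ifs; exacts [one_mem _, zero_mem _]
  let c' : FinAdele k := finAdeleOfIntegral (fun v => localLower (c v) (d v)) fun v => by
    rw [localLower]; split_ifs with h
    exacts [valued_div_le_one _ h, one_mem _]
  let d' : FinAdele k := finAdeleOfIntegral
    (fun v => if Valued.v (c v) ≤ Valued.v (d v) then 1 else d v / c v) fun v => by
      split_ifs with h
      exacts [one_mem _, valued_div_le_one _ (not_le.mp h).le]
  have he : ∀ v, e v = if Valued.v (c v) ≤ Valued.v (d v) then 1 else 0 := fun _ => rfl
  have hc : ∀ v, c' v = if Valued.v (c v) ≤ Valued.v (d v) then c v / d v else 1 := fun _ => rfl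
  have hd : ∀ v, d' v = if Valued.v (c v) ≤ Valued.v (d v) then 1 else d v / c v := fun _ => rfl
  have hc0 : ∀ v, ¬ Valued.v (c v) ≤ Valued.v (d v) → c v ≠ 0 := by
    intro v h h0
    apply h
    rw [h0, map_zero]
    exact zero_le
  have hd0 : ∀ v, Valued.v (c v) ≤ Valued.v (d v) → d v = 0 → c v = 0 := by
    intro v h h0
    rw [h0, map_zero, le_zero_iff, map_eq_zero] at h
    exact h
  refine ⟨e, c', d', e * d + (1 - e) * c, ?_, ?_, ?_, ?_, ?_, ?_, fun _ => rfl⟩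
  · intro v
    rw [he]; split_ifs; exacts [one_mem _, zero_mem _]
  · intro v
    rw [hc]; split_ifs with h
    exacts [valued_div_le_one _ h, one_mem _]
  · intro v
    rw [hd]; split_ifs with h
    exacts [one_mem _, valued_div_le_one _ (not_le.mp h).le]
  · refine FiniteAdeleRing.ext _ fun v => ?_
    simp only [finAdele_mul_apply, finAdele_add_apply, finAdele_sub_apply, finAdele_one_apply]
    rw [he, hc]
    split_ifs with h
    · rcases eq_or_ne (d v) 0 with h0 | h0
      · simp [h0, hd0 v h h0]
      · field_simp; ring
    · ring
  · refine FiniteAdeleRing.ext _ fun v => ?_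
    simp only [finAdele_mul_apply, finAdele_add_apply, finAdele_sub_apply, finAdele_one_apply]
    rw [he, hd]
    split_ifs with h
    · ring
    · have := hc0 v h
      field_simp; ring
  · refine FiniteAdeleRing.ext _ fun v => ?_
    simp only [finAdele_mul_apply, finAdele_add_apply, finAdele_sub_apply, finAdele_one_apply]
    rw [he, hd, hc]
    split_ifs with h <;> ring

/-- The compact factor has the normalized lower row of g. The last clause keeps track of its lower
left entry, which later decides whether the factor lies in the congruence subgroup modulo 𝔪. -/
lemma exists_iwasawa (g : GL (Fin 2) (FinAdele k)) :
    ∃ (a d : (FinAdele k)ˣ) (b : FinAdele k) (κ : GL (Fin 2) (FinAdele k)),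
      κ ∈ intGL (finIntegers k) ∧ Matrix.GeneralLinearGroup.det κ = 1 ∧ g = triGL a d b * κ ∧
      ∀ v, κ 1 0 v = localLower (g 1 0 v) (g 1 1 v) := by
  obtain ⟨e, c, d, w, he, hc, hd, hwc, hwd, h1, hv⟩ := exists_lower_row (g 1 0) (g 1 1)
  let κ : GL (Fin 2) (FinAdele k) :=
    { val := !![e, -(1 - e); c, d]
      inv := !![d, 1 - e; -c, e]
      val_inv := by
        refine Matrix.ext fun i j => ?_
        fin_cases i <;> fin_cases j <;> simp [Matrix.mul_apply, Fin.sum_univ_two] <;>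
          first | ring1 | linear_combination h1
      inv_val := by
        refine Matrix.ext fun i j => ?_
        fin_cases i <;> fin_cases j <;> simp [Matrix.mul_apply, Fin.sum_univ_two] <;>
          first | ring1 | linear_combination h1 }
  have hκ : ∀ i j, κ i j = !![e, -(1 - e); c, d] i j := fun _ _ => rfl
  have hκ' : ∀ i j, κ⁻¹ i j = !![d, 1 - e; -c, e] i j := fun _ _ => rfl
  have h10 : (g * κ⁻¹) 1 0 = 0 := by
    rw [gl_mul_apply, hκ', hκ', ← hwc, ← hwd]
    simp
    ring
  have hdet := (Matrix.GeneralLinearGroup.det (g * κ⁻¹)).isUnit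
  rw [gl_det, h10, mul_zero, sub_zero] at hdet
  refine ⟨(isUnit_of_mul_isUnit_left hdet).unit, (isUnit_of_mul_isUnit_right hdet).unit,
    (g * κ⁻¹) 0 1, κ, ?_, ?_, ?_, hv⟩
  · have hee : 1 - e ∈ finIntegers k := (finIntegers k).sub_mem (finIntegers k).one_mem he
    rw [mem_intGL]
    intro i j
    rw [hκ, hκ']
    fin_cases i <;> fin_cases j
    exacts [⟨he, hd⟩, ⟨(finIntegers k).neg_mem hee, hee⟩, ⟨hc, (finIntegers k).neg_mem hc⟩, ⟨hd, he⟩]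
  · refine Units.ext ?_
    rw [gl_det, hκ, hκ, hκ, hκ, Units.val_one]
    simp
    linear_combination h1
  · rw [← mul_inv_eq_iff_eq_mul]
    apply gl_ext
    · simp
    · simp
    · simp [h10]
    · simp

lemma mem_intGL_triGL {R : Type*} [CommRing R] {S : Subring R} {a d : Rˣ} {b : R} (ha : (a : R) ∈ S)
    (ha' : ((a⁻¹ : Rˣ) : R) ∈ S) (hd : (d : R) ∈ S) (hd' : ((d⁻¹ : Rˣ) : R) ∈ S) (hb : b ∈ S) :
    triGL a d b ∈ intGL S := triGL_mem_k0GL ha ha' hd hd' hb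

/-- `GL₂(𝔸_f) = GL₂(F) GL₂(𝒪_f)`. -/
lemma exists_diagGLFin_mul (g : GL (Fin 2) (FinAdele k)) :
    ∃ γ, ∃ κ ∈ intGL (finIntegers k), g = diagGLFin k γ * κ := by
  obtain ⟨a, d, b, κ, hκ, -, rfl, -⟩ := exists_iwasawa g
  obtain ⟨f, hf⟩ := exists_ratFunc_unit a
  obtain ⟨h, hh⟩ := exists_ratFunc_unit d
  set u := (finDiagUnit k f)⁻¹ * a with hu
  set w := (finDiagUnit k h)⁻¹ * d with hw
  -- Rational generators f and h take care of the two diagonal ideles; after scaling by them, strong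
  -- approximation makes the upper right entry integral up to a rational y.
  obtain ⟨y, hy⟩ := exists_ratFunc_sub_integral
    ((((finDiagUnit k f)⁻¹ : (FinAdele k)ˣ) : FinAdele k) * b * ((w⁻¹ : (FinAdele k)ˣ) : FinAdele k))
  set o := (((finDiagUnit k f)⁻¹ : (FinAdele k)ˣ) : FinAdele k) * b *
    ((w⁻¹ : (FinAdele k)ˣ) : FinAdele k) - algebraMap (RatFunc k) (FinAdele k) y with ho
  refine ⟨triGL f h 0 * triGL 1 1 y, triGL u w (o * w) * κ, ?_, ?_⟩
  · exact Subgroup.mul_mem _ (mem_intGL_triGL hf.1 hf.2 hh.1 hh.2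
      ((finIntegers k).mul_mem hy hh.1)) hκ
  · rw [← mul_assoc]
    congr 1
    have h1 : diagGLFin k (triGL f h 0 * triGL 1 1 y) = triGL (finDiagUnit k f) (finDiagUnit k h) 0 *
        triGL 1 1 (algebraMap (RatFunc k) (FinAdele k) y) := by
      rw [map_mul, diagGLFin, gl_map_triGL, gl_map_triGL, map_one, map_zero]
      rfl
    rw [h1, triGL_mul, triGL_mul]
    have h2 : o * (w : FinAdele k) + algebraMap (RatFunc k) (FinAdele k) y * w =
        (((finDiagUnit k f)⁻¹ : (FinAdele k)ˣ) : FinAdele k) * b := by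
      simp only [ho, sub_mul, sub_add_cancel, mul_assoc, Units.inv_mul, mul_one]
    have h3 : (finDiagUnit k f : FinAdele k) *
        ((((finDiagUnit k f)⁻¹ : (FinAdele k)ˣ) : FinAdele k) * b) = b := by
      rw [← mul_assoc, Units.mul_inv, one_mul]
    apply gl_ext
    · simp [hu]
    · simp only [triGL_01]
      rw [← h3, ← h2]
      push_cast
      ring
    · simp
    · simp [hw]

end Iwasawa

section Infinite

variable {k : Type*} [Field k]

/-! ### Reduction theory at infinity -/

/-- `GL₂(A)`, as a subgroup of `GL₂(F_∞)`. -/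
def polyGL (k : Type*) [Field k] : Subgroup (GL (Fin 2) (FInf k)) :=
  (Matrix.GeneralLinearGroup.map (n := Fin 2) (polyInf k)).range

/-- `Z(F_∞) GL₂(𝒪_∞)`. -/
def zkInf (k : Type*) [Field k] : Subgroup (GL (Fin 2) (FInf k)) :=
  Subgroup.center _ ⊔ intGL (infIntegers k)

lemma scalarGL_mem_zkInf (z : (FInf k)ˣ) : scalarGL z ∈ zkInf k :=
  Subgroup.mem_sup_left (scalarGL_mem_center z)

lemma infUnit_mem {x : (FInf k)ˣ} (h : Valued.v (x : FInf k) = 1) :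
    (x : FInf k) ∈ infIntegers k ∧ ((x⁻¹ : (FInf k)ˣ) : FInf k) ∈ infIntegers k := by
  rw [mem_infIntegers, mem_infIntegers, Units.val_inv_eq_inv_val, map_inv₀, h]
  simp

lemma triGL_mem_intGL_inf {a d : (FInf k)ˣ} {b : FInf k} (ha : Valued.v (a : FInf k) = 1)
    (hd : Valued.v (d : FInf k) = 1) (hb : Valued.v b ≤ 1) : triGL a d b ∈ intGL (infIntegers k) :=
  mem_intGL_triGL (infUnit_mem ha).1 (infUnit_mem ha).2 (infUnit_mem hd).1 (infUnit_mem hd).2 hb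

/-- The antidiagonal involution is in `GL₂(𝒪)`. -/
lemma antiGL_one_mem_intGL {R : Type*} [CommRing R] (S : Subring R) :
    (antiGL 1 : GL (Fin 2) R) ∈ intGL S := by
  refine mem_intGL_of_det ?_ ?_
  · intro i j
    fin_cases i <;> fin_cases j
    exacts [S.zero_mem, S.one_mem, S.one_mem, S.zero_mem]
  · have : Matrix.GeneralLinearGroup.det (antiGL 1 : GL (Fin 2) R) = -1 := by
      ext; rw [gl_det]; simp
    rw [this]
    simp [S.neg_mem, S.one_mem]

lemma lowerGL_mem_intGL {R : Type*} [CommRing R] {S : Subring R} {c : R} (hc : c ∈ S) :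
    lowerGL c ∈ intGL S := by
  refine mem_intGL_of_det ?_ ?_
  · intro i j
    fin_cases i <;> fin_cases j
    exacts [S.one_mem, S.zero_mem, hc, S.one_mem]
  · have : Matrix.GeneralLinearGroup.det (lowerGL c) = 1 := by
      ext; rw [gl_det]; simp
    rw [this]
    exact S.one_mem

lemma affineGL_poly_mem (p : k[X]) : affineGL 1 (polyInf k p) ∈ polyGL k :=
  ⟨affineGL 1 p, by apply gl_ext <;> simp⟩

lemma antiGL_one_mem_polyGL : antiGL 1 ∈ polyGL k :=
  ⟨antiGL 1, by apply gl_ext <;> simp⟩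

/-- Equality in `GL₂(A) \ GL₂(F_∞) / Z(F_∞) GL₂(𝒪_∞)`. -/
def InfEquiv (g h : GL (Fin 2) (FInf k)) : Prop := ∃ γ ∈ polyGL k, ∃ κ ∈ zkInf k, g = γ * h * κ

lemma InfEquiv.trans {g h l : GL (Fin 2) (FInf k)} (h1 : InfEquiv g h) (h2 : InfEquiv h l) :
    InfEquiv g l := by
  obtain ⟨γ, hγ, κ, hκ, rfl⟩ := h1
  obtain ⟨γ', hγ', κ', hκ', rfl⟩ := h2
  exact ⟨γ * γ', mul_mem hγ hγ', κ' * κ, mul_mem hκ' hκ, by group⟩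

lemma InfEquiv.right {g h κ : GL (Fin 2) (FInf k)} (hκ : κ ∈ zkInf k) (e : g = h * κ) :
    InfEquiv g h := ⟨1, one_mem _, κ, hκ, by rw [e, one_mul]⟩

lemma InfEquiv.left {g h γ : GL (Fin 2) (FInf k)} (hγ : γ ∈ polyGL k) (e : g = γ * h) :
    InfEquiv g h := ⟨γ, hγ, 1, one_mem _, by rw [e, mul_one]⟩

lemma intGL_le_zkInf : intGL (infIntegers k) ≤ zkInf k := le_sup_right

/-- Iwasawa decomposition at infinity. -/
lemma infEquiv_affine (g : GL (Fin 2) (FInf k)) : ∃ x y, InfEquiv g (affineGL x y) := by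
  have htri : ∀ g : GL (Fin 2) (FInf k), g 1 0 = 0 → ∃ x y, InfEquiv g (affineGL x y) := by
    intro g hg
    have hdet := (Matrix.GeneralLinearGroup.det g).isUnit
    rw [gl_det, hg, mul_zero, sub_zero] at hdet
    set a := (isUnit_of_mul_isUnit_left hdet).unit with ha
    set d := (isUnit_of_mul_isUnit_right hdet).unit with hd'
    refine ⟨a / d, g 0 1 / g 1 1, .right (scalarGL_mem_zkInf d) ?_⟩
    have hd : g 1 1 ≠ 0 := d.ne_zero
    rw [affineGL_eq, scalarGL_eq, triGL_mul]
    apply gl_ext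
    · simp [ha]
    · simp [hd', hd]
    · simp [hg]
    · simp [hd']
  have hlow : ∀ g : GL (Fin 2) (FInf k), Valued.v (g 1 0) ≤ Valued.v (g 1 1) →
      ∃ x y, InfEquiv g (affineGL x y) := by
    intro g hg
    have hd : g 1 1 ≠ 0 := by
      intro h0
      rw [h0, map_zero, le_zero_iff, map_eq_zero] at hg
      have hdet := (Matrix.GeneralLinearGroup.det g).ne_zero
      rw [gl_det, hg, h0] at hdet
      simp at hdet
    obtain ⟨x, y, h⟩ := htri (g * lowerGL (-(g 1 0 / g 1 1))) (by
      rw [gl_mul_apply]; simp; field_simp; ring)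
    refine ⟨x, y, .trans (.right (κ := (lowerGL (-(g 1 0 / g 1 1)))⁻¹) ?_ (by group)) h⟩
    exact Subgroup.inv_mem _ (intGL_le_zkInf (lowerGL_mem_intGL (neg_mem (valued_div_le_one _ hg))))
  rcases le_total (Valued.v (g 1 0)) (Valued.v (g 1 1)) with hg | hg
  · exact hlow g hg
  · obtain ⟨x, y, h⟩ := hlow (g * antiGL 1) (by rw [gl_mul_apply, gl_mul_apply]; simpa using hg)
    exact ⟨x, y, .trans (.right (κ := (antiGL 1)⁻¹)
      (Subgroup.inv_mem _ (intGL_le_zkInf (antiGL_one_mem_intGL _))) (by group)) h⟩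

lemma infEquiv_sub_poly (x : (FInf k)ˣ) (y : FInf k) (p : k[X]) :
    InfEquiv (affineGL x y) (affineGL x (y - polyInf k p)) :=
  .left (affineGL_poly_mem p) (by rw [affineGL_mul]; simp)

lemma infEquiv_of_le {x : (FInf k)ˣ} {y : FInf k} (h : Valued.v y ≤ Valued.v (x : FInf k)) {n : ℤ}
    (hn : ordInf (x : FInf k) = n) : InfEquiv (affineGL x y) (affineGL (infPow k n) 0) := by
  have hx := valued_eq_exp_ordInf x.ne_zero
  rw [hn, ← valued_infPow (k := k)] at hx
  refine .right (κ := triGL ((infPow k n)⁻¹ * x) 1 (((infPow k n)⁻¹ : (FInf k)ˣ) * y))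
    (intGL_le_zkInf (triGL_mem_intGL_inf ?_ (by simp) ?_)) ?_
  · rw [Units.val_mul, map_mul, hx, ← map_mul, Units.inv_mul, map_one]
  · rw [Units.val_inv_eq_inv_val, mul_comm, ← div_eq_mul_inv]
    exact valued_div_le_one _ (h.trans hx.le)
  · rw [affineGL_eq, affineGL_eq, triGL_mul]
    simp

lemma infEquiv_inv (x : (FInf k)ˣ) : InfEquiv (affineGL x 0) (affineGL x⁻¹ 0) :=
  ⟨antiGL 1, antiGL_one_mem_polyGL, scalarGL x * antiGL 1,
    mul_mem (scalarGL_mem_zkInf x) (intGL_le_zkInf (antiGL_one_mem_intGL _)), by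
      rw [scalarGL_eq]; apply gl_ext <;> simp [gl_mul_apply]⟩

/-- The inversion of the half plane: exchanging the rows sends y to 1/y and x to -x/y². The
condition on x and y makes the lower triangular correction integral. -/
lemma infEquiv_flip (x y : (FInf k)ˣ) (h : Valued.v (x : FInf k) ≤ Valued.v (y : FInf k)) :
    InfEquiv (affineGL x y) (affineGL (-x / (y * y)) ((y⁻¹ : (FInf k)ˣ) : FInf k)) := by
  refine ⟨antiGL 1, antiGL_one_mem_polyGL, scalarGL y * lowerGL (x / y : FInf k),
    mul_mem (scalarGL_mem_zkInf y) (intGL_le_zkInf (lowerGL_mem_intGL (valued_div_le_one _ h))), ?_⟩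
  have hx := x.ne_zero
  have hy := y.ne_zero
  rw [scalarGL_eq]
  apply gl_ext
  · simp [gl_mul_apply]; field_simp
  · simp [gl_mul_apply]
  · simp [gl_mul_apply]; field_simp; ring
  · simp [gl_mul_apply]

lemma ordInf_div (x y : (FInf k)ˣ) :
    ordInf ((x / y : (FInf k)ˣ) : FInf k) = ordInf (x : FInf k) - ordInf (y : FInf k) := by
  rw [eq_sub_iff_add_eq, ← ordInf_mul (Units.ne_zero _) (Units.ne_zero _), ← Units.val_mul,
    div_mul_cancel]

lemma ordInf_neg (x : FInf k) : ordInf (-x) = ordInf x := by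
  rw [ordInf, ordInf, Valuation.map_neg]

lemma ordInf_one : ordInf (1 : FInf k) = 0 := by simp [ordInf]

/-- Every class of `GL₂(A) \ GL₂(F_∞) / Z(F_∞) GL₂(𝒪_∞)` is represented by a diagonal matrix. -/
lemma infEquiv_diag_affine (N : ℕ) : ∀ (x : (FInf k)ˣ) (y : FInf k), ordInf (x : FInf k) ≤ N →
    ∃ n : ℕ, InfEquiv (affineGL x y) (affineGL (infPow k (-n)) 0) := by
  induction N using Nat.strong_induction_on with
  | _ N ih =>
    intro x y hxN
    -- A continued fraction descent: remove the polynomial part of y, so that its absolute value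
    -- drops below 1, then stop if x dominates and invert otherwise.
    obtain ⟨p, hp⟩ := exists_poly_inf y
    suffices h : ∃ n : ℕ, InfEquiv (affineGL x (y - polyInf k p)) (affineGL (infPow k (-n)) 0) by
      obtain ⟨n, hn⟩ := h
      exact ⟨n, (infEquiv_sub_poly x y p).trans hn⟩
    set z := y - polyInf k p
    rcases le_or_gt (Valued.v z) (Valued.v (x : FInf k)) with hz | hz
    · rcases le_total (ordInf (x : FInf k)) 0 with h0 | h0
      · obtain ⟨n, hn⟩ := Int.eq_ofNat_of_zero_le (neg_nonneg.mpr h0)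
        exact ⟨n, infEquiv_of_le hz (by omega)⟩
      · obtain ⟨n, hn⟩ := Int.eq_ofNat_of_zero_le h0
        refine ⟨n, (infEquiv_of_le hz rfl).trans ((infEquiv_inv _).trans
          (infEquiv_of_le (by simp) ?_))⟩
        have := ordInf_div 1 (infPow k (ordInf (x : FInf k)))
        rw [one_div, ordInf_infPow, Units.val_one, ordInf_one] at this
        rw [this, hn, zero_sub]
    · have hz0 : z ≠ 0 := by
        intro h0
        rw [h0, map_zero] at hz
        exact not_lt_zero hz
      obtain ⟨w, hw⟩ : ∃ w : (FInf k)ˣ, (w : FInf k) = z := ⟨Units.mk0 z hz0, rfl⟩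
      rw [← hw] at hz hp ⊢
      have h1 := hp
      rw [valued_eq_exp_ordInf w.ne_zero, ← WithZero.exp_zero, WithZero.exp_lt_exp] at h1
      have h2 := hz
      rw [valued_eq_exp_ordInf w.ne_zero, valued_eq_exp_ordInf x.ne_zero, WithZero.exp_lt_exp] at h2
      have h3 := ordInf_div (-x) (w * w)
      rw [Units.val_mul, ordInf_mul w.ne_zero w.ne_zero, Units.val_neg, ordInf_neg] at h3
      -- Inversion lowers the valuation of x by twice that of w, which is at least 1, so the
      -- induction terminates.
      obtain ⟨n, hn⟩ := ih (ordInf ((-x / (w * w) : (FInf k)ˣ) : FInf k)).toNat (by omega) _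
        ((w⁻¹ : (FInf k)ˣ) : FInf k) (Int.self_le_toNat _)
      exact ⟨n, (infEquiv_flip x w hz.le).trans hn⟩

lemma infEquiv_diag (g : GL (Fin 2) (FInf k)) :
    ∃ n : ℕ, InfEquiv g (affineGL (infPow k (-n)) 0) := by
  obtain ⟨x, y, h⟩ := infEquiv_affine g
  obtain ⟨n, hn⟩ := infEquiv_diag_affine _ x y (Int.self_le_toNat _)
  exact ⟨n, h.trans hn⟩

end Infinite

/-! ### Reduction theory for `GL₂(𝔸)` -/

section Global

variable {k : Type*} [Field k]

/-- The adelic matrix `(T^n 0; 0 1)`, with `T` at the place at infinity. -/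
def diagInf (k : Type*) [Field k] (n : ℕ) : GL2A k := pairGL 1 (affineGL (infPow k (-n)) 0)

@[simp] lemma ofInf_fst (z : (FInf k)ˣ) : (ofInf z : Adele k).1 = 1 := rfl
@[simp] lemma ofInf_snd (z : (FInf k)ˣ) : (ofInf z : Adele k).2 = z := rfl
@[simp] lemma ofFin_fst (z : (FinAdele k)ˣ) : (ofFin z : Adele k).1 = z := rfl
@[simp] lemma ofFin_snd (z : (FinAdele k)ˣ) : (ofFin z : Adele k).2 = 1 := rfl

lemma gFin_scalarGL_ofInf (z : (FInf k)ˣ) : gFin k (scalarGL (ofInf z)) = 1 := by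
  rw [scalarGL_eq, gFin, gl_map_triGL]
  exact gl_ext (by simp) (by simp) (by simp) (by simp)

lemma gInf_scalarGL_ofInf (z : (FInf k)ˣ) : gInf k (scalarGL (ofInf z)) = scalarGL z := by
  rw [scalarGL_eq, scalarGL_eq, gInf, gl_map_triGL]
  exact gl_ext (by simp) (by simp) (by simp) (by simp)

lemma diagGLFin_poly_mem (γ : GL (Fin 2) k[X]) : diagGLFin k
    (Matrix.GeneralLinearGroup.map (algebraMap k[X] (RatFunc k)) γ) ∈ intGL (finIntegers k) := by
  rw [mem_intGL]
  intro i j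
  rw [← map_inv, ← map_inv]
  exact ⟨isFinIntegral_polyFin (γ i j), isFinIntegral_polyFin (γ⁻¹ i j)⟩

lemma diagGLInf_poly (γ : GL (Fin 2) k[X]) : diagGLInf k
    (Matrix.GeneralLinearGroup.map (algebraMap k[X] (RatFunc k)) γ) =
      Matrix.GeneralLinearGroup.map (polyInf k) γ := rfl

lemma mem_gl2O_iff {g : GL2A k} : g ∈ gl2O k ↔
    gFin k g ∈ intGL (finIntegers k) ∧ gInf k g ∈ intGL (infIntegers k) := Iff.rfl

/-- Reduction theory: `GL₂(𝔸)` is the union of the double cosets of `(T^n 0; 0 1)_∞`, for `n ≥ 0`,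
with respect to `GL₂(F)` and `Z(𝔸) GL₂(𝒪)`. -/
lemma exists_reduction (g : GL2A k) : ∃ (γ : GL (Fin 2) (RatFunc k)) (n : ℕ),
    ∃ z ∈ Subgroup.center (GL2A k), ∃ κ ∈ gl2O k, g = diagGL k γ * diagInf k n * z * κ := by
  obtain ⟨γ, κ, hκ, h1⟩ := exists_diagGLFin_mul (gFin k g)
  -- After γ has made the finite component integral, GL₂(A) can still act on the left: it preserves
  -- GL₂(𝒪_f) and performs the reduction at infinity.
  obtain ⟨n, _, ⟨γ', rfl⟩, κ', hκ', h2⟩ := infEquiv_diag ((diagGLInf k γ)⁻¹ * gInf k g)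
  obtain ⟨z, hz, κ'', hκ'', rfl⟩ := Subgroup.mem_sup_of_normal_left.mp hκ'
  obtain ⟨z, rfl⟩ := mem_center_iff.mp hz
  have h3 := diagGLFin_poly_mem γ'
  have h5 := diagGLInf_poly γ'
  generalize Matrix.GeneralLinearGroup.map (algebraMap k[X] (RatFunc k)) γ' = δ at h3 h5
  refine ⟨γ * δ, n, scalarGL (ofInf z), scalarGL_mem_center _,
    pairGL ((diagGLFin k δ)⁻¹ * κ) κ'', mem_gl2O_iff.mpr ⟨?_, ?_⟩, gl2A_ext ?_ ?_⟩
  · rw [gFin_pairGL]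
    exact Subgroup.mul_mem _ (Subgroup.inv_mem _ h3) hκ
  · rw [gInf_pairGL]
    exact hκ''
  · rw [map_mul, map_mul, map_mul, gFin_scalarGL_ofInf, gFin_pairGL, gFin_diagGL, diagInf,
      gFin_pairGL, h1, map_mul, mul_one, mul_one, mul_assoc, mul_inv_cancel_left]
  · rw [inv_mul_eq_iff_eq_mul] at h2
    rw [map_mul, map_mul, map_mul, gInf_scalarGL_ofInf, gInf_pairGL, gInf_diagGL, diagInf,
      gInf_pairGL, h2, map_mul, h5]
    simp only [mul_assoc]

end Global

section Vanishing

variable {k : Type*} [Field k]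

/-! ### Cusp forms have finite support -/

/-- The conjugate is 1 plus u times the product of a column of κ⁻¹ and a row of κ, so it is
congruent to 1 modulo J. -/
lemma conj_affineGL_mem {R : Type*} [CommRing R] {S : Subring R} {J : AddSubgroup R}
    {hJ : ∀ s ∈ S, ∀ x ∈ J, s * x ∈ J} (hJS : ∀ x ∈ J, x ∈ S) {κ : GL (Fin 2) R}
    (hκ : κ ∈ intGL S) {u : R} (hu : u ∈ J) : κ⁻¹ * affineGL 1 u * κ ∈ k0GL S J hJ := by
  rw [mem_intGL] at hκ
  have key : ∀ i j, (κ⁻¹ * affineGL 1 u * κ) i j =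
      (1 : GL (Fin 2) R) i j + κ⁻¹ i 0 * κ 1 j * u := by
    intro i j
    have h := gl_mul_apply κ⁻¹ κ i j
    rw [inv_mul_cancel] at h
    rw [h, gl_mul_apply, gl_mul_apply, gl_mul_apply]
    simp
    ring
  have hJ' : ∀ i j, κ⁻¹ i 0 * κ 1 j * u ∈ J := fun i j =>
    hJ _ (S.mul_mem (hκ _ _).2 (hκ _ _).1) _ hu
  refine mem_k0GL_of_det ?_ ?_ ?_
  · intro i j
    rw [key, gl_one_apply]
    refine S.add_mem ?_ (hJS _ (hJ' i j))
    split_ifs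
    exacts [S.one_mem, S.zero_mem]
  · have h1 : Matrix.GeneralLinearGroup.det (affineGL 1 u : GL (Fin 2) R) = 1 := by
      rw [affineGL_eq, det_triGL, mul_one]
    have : Matrix.GeneralLinearGroup.det (κ⁻¹ * affineGL 1 u * κ) = 1 := by
      rw [map_mul, map_mul, h1, map_inv]
      simp
    rw [this]
    simp [S.one_mem]
  · rw [key, gl_one_apply, if_neg one_ne_zero, zero_add]
    exact hJ' 1 0

lemma gFin_affineGL (x : (Adele k)ˣ) (y : Adele k) :
    gFin k (affineGL x y) = affineGL (finPart x) y.1 := gl_ext rfl rfl rfl rfl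

/-- The infinite component of an idele. -/
def infPart (x : (Adele k)ˣ) : (FInf k)ˣ := (MulEquiv.prodUnits x).2

lemma gInf_affineGL (x : (Adele k)ˣ) (y : Adele k) :
    gInf k (affineGL x y) = affineGL (infPart x) y.2 := gl_ext rfl rfl rfl rfl

lemma gFin_affineGL_one (y : Adele k) : gFin k (affineGL 1 y) = affineGL 1 y.1 := by
  rw [gFin_affineGL]; congr 1

lemma gInf_affineGL_one (y : Adele k) : gInf k (affineGL 1 y) = affineGL 1 y.2 := by
  rw [gInf_affineGL]; congr 1

lemma diagGL_affineGL_one (a : RatFunc k) : diagGL k (affineGL 1 a) =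
    affineGL 1 (algebraMap (RatFunc k) (Adele k) a) := by
  apply gl_ext <;> simp [diagGL]

lemma conj_affineGL_mem_k0 (n : Ideal k[X]) {κ : GL2A k} (hκ : κ ∈ gl2O k) {u : Adele k}
    (h1 : InIdeal n u.1) (h2 : Valued.v u.2 < 1) : κ⁻¹ * affineGL 1 u * κ ∈ k0 n := by
  rw [mem_k0_iff]
  simp only [map_mul, map_inv]
  rw [gFin_affineGL_one, gInf_affineGL_one]
  exact ⟨conj_affineGL_mem (fun _ h => InIdeal.isFinIntegral h) hκ.1 h1,
    conj_affineGL_mem (fun _ h => (mem_infMaxIdeal.mp h).le) hκ.2 (mem_infMaxIdeal.mpr h2)⟩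

/-- Write y = pb + po with p a generator of 𝔫, b rational and o in 𝒪_f × 𝔪_∞. Moving po across the
diagonal matrix multiplies its component at infinity by T^{-N}, which absorbs the growth of p
because deg 𝔫 ≤ N. -/
lemma unipotent_mul_diagInf {n : Ideal k[X]} (hn : n ≠ ⊥) {N : ℕ} (hN : idealDeg n ≤ N)
    (y : Adele k) : ∃ (a : RatFunc k) (u : Adele k), InIdeal n u.1 ∧ Valued.v u.2 < 1 ∧
      affineGL 1 y * diagInf k N = diagGL k (affineGL 1 a) * diagInf k N * affineGL 1 u := by
  set p := Submodule.IsPrincipal.generator n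
  have hp : p ≠ 0 := generator_ne_zero hn
  set c := diagUnit k (polyUnit p hp)
  obtain ⟨b, hb1, hb2⟩ := exists_ratFunc_sub_adele (((c⁻¹ : (Adele k)ˣ) : Adele k) * y)
  set o := ((c⁻¹ : (Adele k)ˣ) : Adele k) * y - algebraMap (RatFunc k) (Adele k) b
  have hy : y = algebraMap (RatFunc k) (Adele k) (algebraMap _ _ p * b) + c * o := by
    rw [map_mul]
    change y = (c : Adele k) * _ + _
    rw [← mul_add]
    simp [o]
  have hc2 : (c : Adele k).2 = polyInf k p := rfl
  refine ⟨algebraMap _ _ p * b, ((c : Adele k).1 * o.1,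
    ((infPow k (-N))⁻¹ : (FInf k)ˣ) * ((c : Adele k).2 * o.2)), ⟨o.1, hb1, rfl⟩, ?_, ?_⟩
  · rw [Units.val_inv_eq_inv_val, map_mul, map_mul, map_inv₀, valued_infPow, hc2, valued_polyInf hp,
      neg_neg, ← mul_assoc]
    refine (mul_le_mul_of_nonneg_right (?_ : _ ≤ (1 : WithZero (Multiplicative ℤ))) zero_le).trans_lt
      (by rwa [one_mul])
    rw [← WithZero.exp_neg, ← WithZero.exp_add, ← WithZero.exp_zero, WithZero.exp_le_exp]
    have : p.natDegree ≤ N := hN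
    omega
  · rw [diagGL_affineGL_one]
    refine gl2A_ext ?_ ?_
    · rw [map_mul, map_mul, map_mul, gFin_affineGL_one, gFin_affineGL_one, gFin_affineGL_one,
        diagInf, gFin_pairGL, mul_one, mul_one, affineGL_mul]
      conv_lhs => rw [hy]
      congr 1
      · simp
      · simp; ring
    · rw [map_mul, map_mul, map_mul, gInf_affineGL_one, gInf_affineGL_one, gInf_affineGL_one,
        diagInf, gInf_pairGL, affineGL_mul, affineGL_mul, affineGL_mul]
      conv_lhs => rw [hy]
      congr 1
      · simp
      · simp; ring

/-- High in the cusp every unipotent translation is absorbed on the left by GL₂(F) and on the right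
by the level, so φ is constant on the unipotent orbit. The vanishing integral over F\𝔸 is then this
constant. -/
lemma cuspForm_vanishing [Finite k] {n : Ideal k[X]} (hn : n ≠ ⊥) {φ : GL2A k → ℚ}
    (hφ : IsAutomorphicForm n φ) (hc : IsCuspidal φ) {N : ℕ} (hN : idealDeg n ≤ N) {κ : GL2A k}
    (hκ : κ ∈ gl2O k) : φ (diagInf k N * κ) = 0 := by
  obtain ⟨ν, hν, hν1⟩ := exists_addHaar_probability (k := k)
  have h := hc ν hν hν1 (diagInf k N * κ)
  have h1 : ∀ y, φ (affineGL 1 y * (diagInf k N * κ)) = φ (diagInf k N * κ) := by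
    intro y
    obtain ⟨a, u, hu1, hu2, e⟩ := unipotent_mul_diagInf hn hN y
    have h2 : affineGL 1 y * (diagInf k N * κ) =
        diagGL k (affineGL 1 a) * ((diagInf k N * κ) * (κ⁻¹ * affineGL 1 u * κ)) := by
      rw [← mul_assoc, e]; group
    rw [h2, hφ.left_invariant, hφ.right_invariant]
    rw [← coe_k0]
    exact conj_affineGL_mem_k0 n hκ hu1 hu2
  simp_rw [h1] at h
  simpa using h

/-- The image of `𝕂₀(𝔪∞)` in `GL₂(𝔸) / Z(𝔸)`. -/
def k0Bar (m : Ideal k[X]) : Subgroup (PGL2A k) := (k0 m).map (QuotientGroup.mk' _)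

lemma coe_k0Bar (m : Ideal k[X]) :
    (k0Bar m : Set (PGL2A k)) = (QuotientGroup.mk : GL2A k → PGL2A k) '' K0Inf m := by
  rw [k0Bar, Subgroup.coe_map, coe_k0]
  rfl

lemma isOpen_k0Bar {m : Ideal k[X]} (hm : m ≠ ⊥) : IsOpen (k0Bar m : Set (PGL2A k)) := by
  rw [coe_k0Bar]
  exact QuotientGroup.isOpenMap_coe _ (isOpen_K0Inf hm)

lemma isOpen_coset {m : Ideal k[X]} (hm : m ≠ ⊥) (p : PGL2A k) :
    IsOpen {x | p⁻¹ * x ∈ k0Bar m} :=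
  (isOpen_k0Bar hm).preimage (continuous_const.mul continuous_id)

lemma measure_coset (μG : Measure (PGL2A k)) [μG.IsHaarMeasure] (m : Ideal k[X]) (p : PGL2A k) :
    μG {x | p⁻¹ * x ∈ k0Bar m} = μG (k0Bar m) :=
  measure_preimage_mul μG p⁻¹ (k0Bar m : Set (PGL2A k))

lemma measure_k0Bar_le (μG : Measure (PGL2A k))
    (hμ1 : μG ((QuotientGroup.mk : GL2A k → PGL2A k) '' GL2O k) = 1) (m : Ideal k[X]) :
    μG (k0Bar m) ≤ 1 := by
  rw [← hμ1, coe_k0Bar, ← coe_gl2O, ← coe_k0]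
  exact measure_mono (Set.image_mono (k0_le_gl2O m))

/-- The image of 𝕂₀(𝔪∞) is open, hence of positive measure, and its cosets inside the image of
GL₂(𝒪) are disjoint in a set of measure 1. -/
lemma exists_finite_cosets (μG : Measure (PGL2A k)) [hμ : μG.IsHaarMeasure]
    (hμ1 : μG ((QuotientGroup.mk : GL2A k → PGL2A k) '' GL2O k) = 1) {m : Ideal k[X]} (hm : m ≠ ⊥) :
    ∃ T : Set (GL2A k), T.Finite ∧ ∀ κ ∈ gl2O k, ∃ t ∈ T, ∃ z ∈ Subgroup.center (GL2A k),
      ∃ κ' ∈ k0 m, κ = t * z * κ' := by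
  let ι := {c : PGL2A k ⧸ k0Bar m // ∃ κ ∈ gl2O k, QuotientGroup.mk (QuotientGroup.mk κ) = c}
  let As : ι → Set (PGL2A k) := fun c => QuotientGroup.mk ⁻¹' {c.1}
  have hAs : ∀ c : ι, ∃ p : PGL2A k, As c = {x | p⁻¹ * x ∈ k0Bar m} := by
    rintro ⟨c, κ, hκ, rfl⟩
    refine ⟨QuotientGroup.mk κ, ?_⟩
    ext x
    rw [Set.mem_preimage, Set.mem_singleton_iff, eq_comm, QuotientGroup.eq]
    rfl
  have hmeas : ∀ c, μG (k0Bar m) ≤ μG (As c) := by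
    intro c
    obtain ⟨p, hp⟩ := hAs c
    rw [hp, measure_coset]
  have hfin := Measure.finite_const_le_meas_of_disjoint_iUnion μG (ε := μG (k0Bar m))
    ((isOpen_k0Bar hm).measure_pos μG ⟨1, one_mem _⟩) (As := As)
    (fun c => by
      obtain ⟨p, hp⟩ := hAs c
      rw [hp]
      exact (isOpen_coset hm p).measurableSet)
    (fun c d hcd => by
      rw [Function.onFun, Set.disjoint_left]
      intro x hx hx'
      exact hcd (Subtype.ext (hx.symm.trans hx')))
    (by
      refine ne_top_of_le_ne_top ENNReal.one_ne_top (hμ1 ▸ measure_mono ?_)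
      refine Set.iUnion_subset ?_
      rintro ⟨c, κ, hκ, rfl⟩ x hx
      rw [Set.mem_preimage, Set.mem_singleton_iff, eq_comm, QuotientGroup.eq] at hx
      obtain ⟨κ', hκ', h⟩ := hx
      refine ⟨κ * κ', ?_, ?_⟩
      · rw [← coe_gl2O]
        exact mul_mem hκ (k0_le_gl2O m hκ')
      · rw [QuotientGroup.mk_mul]
        change (κ : PGL2A k) * QuotientGroup.mk' _ κ' = x
        rw [h, mul_inv_cancel_left])
  have : Finite ι := by
    rw [← Set.finite_univ_iff]
    exact hfin.subset fun c _ => hmeas c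
  choose f hf hfc using fun c : ι => c.2
  refine ⟨Set.range f, Set.finite_range f, fun κ hκ => ?_⟩
  let c : ι := ⟨QuotientGroup.mk (QuotientGroup.mk κ), κ, hκ, rfl⟩
  have h := hfc c
  rw [QuotientGroup.eq] at h
  obtain ⟨κ', hκ', h⟩ := h
  have h2 : (κ' : PGL2A k) = ((f c)⁻¹ * κ : GL2A k) := h
  rw [QuotientGroup.eq] at h2
  refine ⟨f c, ⟨c, rfl⟩, _, h2, κ', hκ', ?_⟩
  rw [mul_assoc, ← Subgroup.mem_center_iff.mp h2 κ']
  group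

/-- By reduction theory only the diagonal matrices with exponent below deg 𝔫 matter, since φ
vanishes beyond; finitely many cosets then refine GL₂(𝒪) to level 𝔪∞. -/
lemma exists_finite_support [Finite k] (μG : Measure (PGL2A k)) [hμ : μG.IsHaarMeasure]
    (hμ1 : μG ((QuotientGroup.mk : GL2A k → PGL2A k) '' GL2O k) = 1) {m n : Ideal k[X]}
    (hm : m ≠ ⊥) (hn : n ≠ ⊥) {φ : GL2A k → ℚ}
    (hφ : IsAutomorphicForm n φ) (hc : IsCuspidal φ) :
    ∃ S : Set (GL2A k), S.Finite ∧ ∀ g, φ g ≠ 0 → ∃ γ, ∃ s ∈ S, ∃ z ∈ Subgroup.center (GL2A k),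
      ∃ κ ∈ k0 m, g = diagGL k γ * s * z * κ := by
  obtain ⟨T, hT, h⟩ := exists_finite_cosets μG hμ1 hm
  refine ⟨Set.image2 (fun N t => diagInf k N * t) (Set.Iio (idealDeg n)) T,
    (Set.finite_Iio _).image2 _ hT, fun g hg => ?_⟩
  obtain ⟨γ, N, z, hz, κ, hκ, rfl⟩ := exists_reduction g
  have hz' := Subgroup.mem_center_iff.mp hz
  have e1 : diagGL k γ * diagInf k N * z * κ = diagGL k γ * (diagInf k N * κ * z) := by
    rw [mul_assoc _ z κ, ← hz' κ]; group
  have hN : N < idealDeg n := by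
    by_contra hN
    apply hg
    rw [e1, hφ.left_invariant, hφ.central _ _ hz]
    exact cuspForm_vanishing hn hφ hc (not_lt.mp hN) hκ
  obtain ⟨t, ht, z', hzz, κ', hκ', rfl⟩ := h κ hκ
  refine ⟨γ, _, Set.mem_image2_of_mem hN ht, z * z', mul_mem hz hzz, κ', hκ', ?_⟩
  rw [mul_assoc _ z, ← mul_assoc z, ← mul_assoc z, ← hz' t]
  group

end Vanishing

section DirichletCharacters

/-! ### Dirichlet characters modulo `𝔪` -/

variable {k : Type*} [Field k]

/-- Being invertible modulo 𝔪 is a condition at each place dividing 𝔪 separately. This local form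
makes χ₀ multiplicative at its zeros too. -/
lemma exists_unit_congr_iff {m : Ideal k[X]} (hm : m ≠ ⊥) {u : FinAdele k} (hu : IsFinIntegral u) :
    (∃ z : (FinAdele k)ˣ, IsFinIntegralUnit z ∧ InIdeal m (u - z)) ↔
      ∀ v : HeightOneSpectrum k[X], v.intValuation (Submodule.IsPrincipal.generator m) < 1 →
        Valued.v (u v) = 1 := by
  classical
  constructor
  · rintro ⟨z, hz, h⟩ v hv
    have h1 := isFinIntegralUnit_iff.mp hz v
    have h2 : Valued.v (u v - (z : FinAdele k) v) < 1 := ((inIdeal_iff hm).mp h v).trans_lt hv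
    have h3 : u v = (z : FinAdele k) v + (u v - (z : FinAdele k) v) := by ring
    rw [h3, Valuation.map_add_eq_of_lt_left _ (h2.trans_eq h1.symm), h1]
  · intro h
    -- Take u itself at the places dividing 𝔪, and 1 elsewhere, where 𝔪 imposes nothing beyond
    -- integrality.
    let f : ∀ v : HeightOneSpectrum k[X], v.adicCompletion (RatFunc k) := fun v =>
      if v.intValuation (Submodule.IsPrincipal.generator m) < 1 then u v else 1
    have hf : ∀ v, Valued.v (f v) = 1 := by
      intro v
      simp only [f]
      split_ifs with hv
      · exact h v hv
      · exact map_one _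
    let z : (FinAdele k)ˣ :=
      { val := finAdeleOfIntegral f fun v => (hf v).le
        inv := finAdeleOfIntegral (fun v => (f v)⁻¹) fun v => by
          rw [HeightOneSpectrum.mem_adicCompletionIntegers, map_inv₀, hf, inv_one]
        val_inv := by
          refine DFunLike.ext _ _ fun v => ?_
          have : f v ≠ 0 := fun h0 => by simpa [h0] using hf v
          exact mul_inv_cancel₀ this
        inv_val := by
          refine DFunLike.ext _ _ fun v => ?_
          have : f v ≠ 0 := fun h0 => by simpa [h0] using hf v
          exact inv_mul_cancel₀ this }
    refine ⟨z, isFinIntegralUnit_iff.mpr hf, (inIdeal_iff hm).mpr fun v => ?_⟩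
    change Valued.v (u v - f v) ≤ _
    simp only [f]
    split_ifs with hv
    · rw [sub_self, map_zero]
      exact zero_le
    · have h1 : v.intValuation (Submodule.IsPrincipal.generator m) = 1 :=
        le_antisymm (v.intValuation_le_one _) (not_lt.mp hv)
      rw [h1]
      exact (Valuation.map_sub _ _ _).trans (max_le (isFinIntegral_iff.mp hu v) (map_one _).le)

variable {m : Ideal k[X]} {χ : (FinAdele k)ˣ →* ℂˣ}

/-- The unit chosen in the definition differs from z by a unit congruent to 1 modulo 𝔪, on which χ
is trivial. -/
lemma chi0_eq (hχ : IsDirichletCharacter m χ) {u : FinAdele k} {z : (FinAdele k)ˣ}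
    (hz : IsFinIntegralUnit z) (h : InIdeal m (u - z)) : chi0 m χ u = χ z := by
  have hex : ∃ z : (FinAdele k)ˣ, IsFinIntegral (z : FinAdele k) ∧
      IsFinIntegral ((z⁻¹ : (FinAdele k)ˣ) : FinAdele k) ∧ InIdeal m (u - z) := ⟨z, hz.1, hz.2, h⟩
  rw [chi0, dif_pos hex]
  obtain ⟨h1, h2, h3⟩ := hex.choose_spec
  set w := hex.choose
  have h4 : χ (z⁻¹ * w) = 1 := by
    have h5 := hz.inv.mul (show IsFinIntegralUnit w from ⟨h1, h2⟩)
    refine hχ.trivial_congruence _ h5.1 h5.2 ?_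
    have : ((z⁻¹ * w : (FinAdele k)ˣ) : FinAdele k) - 1 =
        ((z⁻¹ : (FinAdele k)ˣ) : FinAdele k) * ((u - z) - (u - w)) := by
      rw [Units.val_mul, sub_sub_sub_cancel_left, mul_sub, Units.inv_mul]
    rw [this]
    exact (h.sub h3).mul_left hz.2
  rw [map_mul, map_inv, inv_mul_eq_one] at h4
  rw [h4]

lemma chi0_eq_zero {u : FinAdele k}
    (h : ¬ ∃ z : (FinAdele k)ˣ, IsFinIntegralUnit z ∧ InIdeal m (u - z)) : chi0 m χ u = 0 := by
  rw [chi0, dif_neg]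
  rintro ⟨z, h1, h2, h3⟩
  exact h ⟨z, ⟨h1, h2⟩, h3⟩

lemma exists_of_chi0_ne_zero {u : FinAdele k} (h : chi0 m χ u ≠ 0) :
    ∃ z : (FinAdele k)ˣ, IsFinIntegralUnit z ∧ InIdeal m (u - z) := by
  by_contra hc
  exact h (chi0_eq_zero hc)

lemma chi0_unit (hχ : IsDirichletCharacter m χ) {z : (FinAdele k)ˣ}
    (hz : IsFinIntegralUnit z) : chi0 m χ z = χ z :=
  chi0_eq hχ hz (by rw [sub_self]; exact (finIdeal m).zero_mem)

lemma chi0_congr (hχ : IsDirichletCharacter m χ) {u w : FinAdele k} (h : InIdeal m (u - w)) :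
    chi0 m χ u = chi0 m χ w := by
  by_cases hu : ∃ z : (FinAdele k)ˣ, IsFinIntegralUnit z ∧ InIdeal m (u - z)
  · obtain ⟨z, hz, h1⟩ := hu
    rw [chi0_eq hχ hz h1, chi0_eq hχ hz]
    simpa using h1.sub h
  · rw [chi0_eq_zero hu, chi0_eq_zero]
    rintro ⟨z, hz, h1⟩
    exact hu ⟨z, hz, by simpa using h1.add h⟩

/-- Among integral elements a product is invertible modulo 𝔪 exactly when both factors are, so the
two sides vanish together. -/
lemma chi0_mul (hm : m ≠ ⊥) (hχ : IsDirichletCharacter m χ) {u w : FinAdele k}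
    (hu : IsFinIntegral u) (hw : IsFinIntegral w) :
    chi0 m χ (u * w) = chi0 m χ u * chi0 m χ w := by
  by_cases h1 : ∃ z : (FinAdele k)ˣ, IsFinIntegralUnit z ∧ InIdeal m (u - z)
  · by_cases h2 : ∃ z : (FinAdele k)ˣ, IsFinIntegralUnit z ∧ InIdeal m (w - z)
    · obtain ⟨z, hz, h1⟩ := h1
      obtain ⟨z', hz', h2⟩ := h2
      rw [chi0_eq hχ hz h1, chi0_eq hχ hz' h2, chi0_eq hχ (hz.mul hz'), map_mul, Units.val_mul]
      have : u * w - (z * z' : (FinAdele k)ˣ) = u * (w - z') + z' * (u - z) := by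
        rw [Units.val_mul]; ring
      rw [this]
      exact (h2.mul_left hu).add (h1.mul_left hz'.1)
    · rw [chi0_eq_zero h2, mul_zero, chi0_eq_zero]
      intro h3
      rw [exists_unit_congr_iff hm ((finIntegers k).mul_mem hu hw)] at h3
      rw [exists_unit_congr_iff hm hw] at h2
      rw [exists_unit_congr_iff hm hu] at h1
      refine h2 fun v hv => ?_
      simpa [h1 v hv] using h3 v hv
  · rw [chi0_eq_zero h1, zero_mul, chi0_eq_zero]
    intro h3
    rw [exists_unit_congr_iff hm ((finIntegers k).mul_mem hu hw)] at h3
    rw [exists_unit_congr_iff hm hu] at h1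
    refine h1 fun v hv => ?_
    have h4 := h3 v hv
    rw [finAdele_mul_apply, map_mul] at h4
    refine le_antisymm (isFinIntegral_iff.mp hu v) ?_
    rw [← h4]
    exact mul_le_of_le_one_right' (isFinIntegral_iff.mp hw v)

/-- Two powers of z have the same residue modulo 𝔪, by the pigeonhole principle, so χ(z) is a root
of unity. -/
lemma norm_chi_unit [Finite k] (hm : m ≠ ⊥) (hχ : IsDirichletCharacter m χ) {z : (FinAdele k)ˣ}
    (hz : IsFinIntegralUnit z) : ‖(χ z : ℂ)‖ = 1 := by
  have hpow : ∀ i : ℕ, IsFinIntegralUnit (z ^ i) := by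
    intro i
    induction i with
    | zero => rw [pow_zero]; exact ⟨(finIntegers k).one_mem, by rw [inv_one]; exact (finIntegers k).one_mem⟩
    | succ i ih => rw [pow_succ]; exact ih.mul hz
  choose β hβ y hy h using fun i : ℕ => exists_poly_sub_mul (generator_ne_zero hm) (hpow i).1
  have hfin : (Set.range β).Finite := by
    refine (finite_degree_lt (Submodule.IsPrincipal.generator m).degree).subset ?_
    rintro _ ⟨i, rfl⟩
    exact hβ i
  obtain ⟨i, j, hij, he⟩ : ∃ i j, i < j ∧ β i = β j := by
    have : ¬ Function.Injective β := fun hinj => Set.infinite_range_of_injective hinj hfin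
    rw [Function.Injective] at this
    push Not at this
    obtain ⟨i, j, h1, h2⟩ := this
    rcases lt_or_gt_of_ne h2 with h3 | h3
    · exact ⟨i, j, h3, h1⟩
    · exact ⟨j, i, h3, h1.symm⟩
  have h1 : χ (z ^ i) = χ (z ^ j) := by
    apply Units.ext
    rw [← chi0_unit hχ (hpow i), ← chi0_unit hχ (hpow j)]
    refine chi0_congr hχ ⟨y i - y j, (finIntegers k).sub_mem (hy i) (hy j), ?_⟩
    rw [h i, h j, he, mul_sub]
    change _ = polyFin k _ * _ - polyFin k _ * _
    ring
  rw [map_pow, map_pow, ← Nat.add_sub_of_le hij.le, pow_add] at h1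
  have h2 : (χ z) ^ (j - i) = 1 := by simpa using h1.symm
  have h3 : (χ z : ℂ) ^ (j - i) = 1 := by rw [← Units.val_pow_eq_pow_val, h2, Units.val_one]
  exact Complex.norm_eq_one_of_pow_eq_one h3 (Nat.sub_pos_of_lt hij).ne'

lemma norm_chi0_le_one [Finite k] (hm : m ≠ ⊥) (hχ : IsDirichletCharacter m χ) (u : FinAdele k) :
    ‖chi0 m χ u‖ ≤ 1 := by
  by_cases h : ∃ z : (FinAdele k)ˣ, IsFinIntegralUnit z ∧ InIdeal m (u - z)
  · obtain ⟨z, hz, h⟩ := h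
    rw [chi0_eq hχ hz h, norm_chi_unit hm hχ hz]
  · rw [chi0_eq_zero h, norm_zero]
    exact zero_le_one

end DirichletCharacters

section Section

/-! ### The function on `GL₂(𝔸)` whose sum over `GL₂(F)` is the Eisenstein series -/

variable {k : Type*} [Field k]

lemma finPart_mul (x y : (Adele k)ˣ) : finPart (x * y) = finPart x * finPart y := rfl

lemma finPart_det (g : GL2A k) : finPart (Matrix.GeneralLinearGroup.det g) =
    Matrix.GeneralLinearGroup.det (gFin k g) := by
  ext1
  rw [gl_det, gFin_apply, gFin_apply, gFin_apply, gFin_apply]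
  change ((Matrix.GeneralLinearGroup.det g : (Adele k)ˣ) : Adele k).1 = _
  rw [gl_det]
  rfl

lemma det_snd (g : GL2A k) : ((Matrix.GeneralLinearGroup.det g : (Adele k)ˣ) : Adele k).2 =
    Matrix.GeneralLinearGroup.det (gInf k g) := by
  rw [gl_det, gl_det]
  rfl

lemma ofFin_mul (x y : (FinAdele k)ˣ) : ofFin (x * y) = ofFin x * ofFin y := by
  rw [ofFin, ofFin, ofFin, ← map_mul, Prod.mk_mul_mk, one_mul]

lemma ofFin_one : ofFin (1 : (FinAdele k)ˣ) = 1 := by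
  rw [ofFin]
  exact map_one MulEquiv.prodUnits.symm

lemma isFinIntegralUnit_det {m : Ideal k[X]} {κ : GL (Fin 2) (FinAdele k)} (h : κ ∈ k0Fin m) :
    IsFinIntegralUnit (Matrix.GeneralLinearGroup.det κ) :=
  ⟨(gl_det_mem_of_mem h).1, (gl_det_mem_of_mem h).2⟩

lemma valued_det_of_mem_k0InfComp {κ : GL (Fin 2) (FInf k)} (h : κ ∈ k0InfComp k) :
    Valued.v (Matrix.GeneralLinearGroup.det κ : FInf k) = 1 := by
  obtain ⟨h1, h2⟩ := gl_det_mem_of_mem h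
  rw [mem_infIntegers] at h1 h2
  refine le_antisymm h1 ?_
  have h3 : Valued.v ((Matrix.GeneralLinearGroup.det κ : FInf k) *
      ((Matrix.GeneralLinearGroup.det κ)⁻¹ : (FInf k)ˣ)) = 1 := by
    rw [Units.mul_inv, map_one]
  rw [← h3, map_mul]
  exact mul_le_of_le_one_right' h2

/-- The determinant is a unit and the product of the off-diagonal entries is not, so the product of
the diagonal entries is a unit. -/
lemma valued_diag_of_mem_k0InfComp {κ : GL (Fin 2) (FInf k)} (h : κ ∈ k0InfComp k) :
    Valued.v (κ 0 0) = 1 ∧ Valued.v (κ 1 1) = 1 := by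
  have hd := valued_det_of_mem_k0InfComp h
  rw [gl_det] at hd
  obtain ⟨h1, h2⟩ := h
  have h00 : Valued.v (κ 0 0) ≤ 1 := (h1 0 0).1
  have h11 : Valued.v (κ 1 1) ≤ 1 := (h1 1 1).1
  have h01 : Valued.v (κ 0 1) ≤ 1 := (h1 0 1).1
  rw [mem_infMaxIdeal] at h2
  have h3 : Valued.v (κ 0 1 * κ 1 0) < 1 := by
    rw [map_mul]
    exact (mul_le_of_le_one_left' h01).trans_lt h2
  have h4 : Valued.v (κ 0 0 * κ 1 1) = 1 := by
    have e : κ 0 0 * κ 1 1 = (κ 0 0 * κ 1 1 - κ 0 1 * κ 1 0) + κ 0 1 * κ 1 0 := by ring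
    rw [e, Valuation.map_add_eq_of_lt_left _ (h3.trans_eq hd.symm), hd]
  rw [map_mul] at h4
  exact ⟨le_antisymm h00 (h4 ▸ mul_le_of_le_one_right' h11),
    le_antisymm h11 (h4 ▸ mul_le_of_le_one_left' h00)⟩

/-- Modulo 𝔪 the matrix is upper triangular. This identity lets the factor χ(det)⁻¹ cancel the
characters of the two rows. -/
lemma chi0_diag_of_mem_k0Fin {m : Ideal k[X]} (hm : m ≠ ⊥) {χ : (FinAdele k)ˣ →* ℂˣ}
    (hχ : IsDirichletCharacter m χ) {κ : GL (Fin 2) (FinAdele k)} (h : κ ∈ k0Fin m) :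
    chi0 m χ (κ 0 0) * chi0 m χ (κ 1 1) = χ (Matrix.GeneralLinearGroup.det κ) := by
  have h1 : ∀ i j, IsFinIntegral (κ i j) := fun i j => (h.1 i j).1
  rw [← chi0_mul hm hχ (h1 0 0) (h1 1 1), ← chi0_unit hχ (isFinIntegralUnit_det h), gl_det]
  refine chi0_congr hχ ?_
  rw [sub_sub_cancel]
  exact (mem_finIdeal.mp h.2).mul_left (h1 0 1)

/-- The support of the function whose sum over `GL₂(F)` is the Eisenstein series. -/
structure InSupport (m : Ideal k[X]) (g : GL2A k) : Prop where
  integral : ∀ i j, IsFinIntegral (g i j).1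
  top : Valued.v (g 0 1).2 ≤ Valued.v (g 0 0).2
  bot : Valued.v (g 1 0).2 < Valued.v (g 1 1).2
  ideal : InIdeal m (g 1 0).1

/-- At infinity the Iwahori group preserves both inequalities between the entries of a row, because
its lower left entry is not a unit while its diagonal entries are; the dominant entries keep their
absolute values. -/
lemma InSupport.mul_k0 {m : Ideal k[X]} {g κ : GL2A k} (h : InSupport m g) (hκ : κ ∈ k0 m) :
    InSupport m (g * κ) ∧ Valued.v ((g * κ) 0 0).2 = Valued.v (g 0 0).2 ∧
      Valued.v ((g * κ) 1 1).2 = Valued.v (g 1 1).2 := by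
  have hf : ∀ i j, IsFinIntegral (κ i j).1 := fun i j => (hκ.1.1 i j).1
  have hi : ∀ i j, Valued.v (κ i j).2 ≤ 1 := fun i j => (hκ.2.1 i j).1
  have hm10 : InIdeal m (κ 1 0).1 := hκ.1.2
  have hi10 : Valued.v (κ 1 0).2 < 1 := mem_infMaxIdeal.mp hκ.2.2
  obtain ⟨hi00, hi11⟩ := valued_diag_of_mem_k0InfComp hκ.2
  rw [gInf_apply] at hi00 hi11
  have e1 : ∀ i j, ((g * κ) i j).1 = (g i 0).1 * (κ 0 j).1 + (g i 1).1 * (κ 1 j).1 := by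
    intro i j
    rw [gl_mul_apply]; rfl
  have e2 : ∀ i j, ((g * κ) i j).2 = (g i 0).2 * (κ 0 j).2 + (g i 1).2 * (κ 1 j).2 := by
    intro i j
    rw [gl_mul_apply]; rfl
  have hne : (g 0 0).2 ≠ 0 := by
    intro h0
    have h1 : (g 0 1).2 = 0 := by simpa [h0] using h.top
    apply adeleUnit_snd_ne_zero (Matrix.GeneralLinearGroup.det g)
    rw [gl_det]
    change (g 0 0).2 * (g 1 1).2 - (g 0 1).2 * (g 1 0).2 = 0
    rw [h0, h1]; ring
  have h00 : Valued.v ((g * κ) 0 0).2 = Valued.v (g 0 0).2 := by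
    have h1 : Valued.v ((g 0 0).2 * (κ 0 0).2) = Valued.v (g 0 0).2 := by rw [map_mul, hi00, mul_one]
    rw [e2, Valuation.map_add_eq_of_lt_left, h1]
    rw [h1, map_mul]
    calc Valued.v (g 0 1).2 * Valued.v (κ 1 0).2 ≤ Valued.v (g 0 0).2 * Valued.v (κ 1 0).2 :=
          mul_le_mul_left h.top _
      _ < Valued.v (g 0 0).2 * 1 :=
          mul_lt_mul_of_pos_left hi10 (zero_lt_iff.mpr ((_root_.map_ne_zero _).mpr hne))
      _ = _ := mul_one _
  have h11 : Valued.v ((g * κ) 1 1).2 = Valued.v (g 1 1).2 := by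
    have h1 : Valued.v ((g 1 1).2 * (κ 1 1).2) = Valued.v (g 1 1).2 := by rw [map_mul, hi11, mul_one]
    rw [e2, Valuation.map_add_eq_of_lt_right, h1]
    rw [h1, map_mul]
    exact (mul_le_of_le_one_right' (hi _ _)).trans_lt h.bot
  refine ⟨⟨fun i j => ?_, ?_, ?_, ?_⟩, h00, h11⟩
  · rw [e1]
    exact (finIntegers k).add_mem ((finIntegers k).mul_mem (h.integral _ _) (hf _ _))
      ((finIntegers k).mul_mem (h.integral _ _) (hf _ _))
  · rw [h00, e2]
    refine (Valuation.map_add _ _ _).trans (max_le ?_ ?_)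
    · rw [map_mul]; exact mul_le_of_le_one_right' (hi _ _)
    · rw [map_mul]; exact (mul_le_of_le_one_right' (hi _ _)).trans h.top
  · rw [h11, e2]
    refine (Valuation.map_add _ _ _).trans_lt (max_lt ?_ ?_)
    · rw [map_mul]; exact (mul_le_of_le_one_right' (hi _ _)).trans_lt h.bot
    · rw [map_mul]
      calc Valued.v (g 1 1).2 * Valued.v (κ 1 0).2 < Valued.v (g 1 1).2 * 1 :=
            mul_lt_mul_of_pos_left hi10 (zero_le.trans_lt h.bot)
        _ = _ := mul_one _
  · rw [e1]
    exact (h.ideal.mul_right (hf _ _)).add (hm10.mul_left (h.integral _ _))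

lemma inSupport_mul_k0_iff {m : Ideal k[X]} {g κ : GL2A k} (hκ : κ ∈ k0 m) :
    InSupport m (g * κ) ↔ InSupport m g := by
  refine ⟨fun h => ?_, fun h => (h.mul_k0 hκ).1⟩
  simpa using (h.mul_k0 (inv_mem hκ)).1

open scoped Classical in
/-- The value at `g` of the function whose sum over `GL₂(F)` is the Eisenstein series, up to an
element of the group `G`. -/
def secVal (m : Ideal k[X]) (χ : (FinAdele k)ˣ →* ℂˣ) (x y : ℂ) (g : GL2A k) : ℂ :=
  if InSupport m g then
    ((χ (finPart (Matrix.GeneralLinearGroup.det g)) : ℂˣ) : ℂ)⁻¹ *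
      (x * y) ^ ideleDeg (Matrix.GeneralLinearGroup.det g) *
      (chi0 m χ (g 0 0).1 * chi0 m χ (g 1 1).1 *
        x ^ (-2 * ordInf (g 0 0).2) * y ^ (-2 * ordInf (g 1 1).2))
  else 0

lemma secVal_of_inSupport {m : Ideal k[X]} {χ : (FinAdele k)ˣ →* ℂˣ} {x y : ℂ} {g : GL2A k}
    (h : InSupport m g) : secVal m χ x y g =
    ((χ (finPart (Matrix.GeneralLinearGroup.det g)) : ℂˣ) : ℂ)⁻¹ *
      (x * y) ^ ideleDeg (Matrix.GeneralLinearGroup.det g) *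
      (chi0 m χ (g 0 0).1 * chi0 m χ (g 1 1).1 *
        x ^ (-2 * ordInf (g 0 0).2) * y ^ (-2 * ordInf (g 1 1).2)) := if_pos h

lemma secVal_of_not {m : Ideal k[X]} {χ : (FinAdele k)ˣ →* ℂˣ} {x y : ℂ} {g : GL2A k}
    (h : ¬ InSupport m g) : secVal m χ x y g = 0 := if_neg h

lemma ordInf_eq_of_valued {x y : FInf k} (h : Valued.v x = Valued.v y) : ordInf x = ordInf y := by
  rw [ordInf, ordInf, h]

lemma ideleDeg_eq_zero {x : (Adele k)ˣ} (h1 : IsFinIntegralUnit (finPart x))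
    (h2 : Valued.v (x : Adele k).2 = 1) : ideleDeg x = 0 := by
  rw [ideleDeg, divisor_deg, ideleDiv]
  change finDeg k (finDiv (finPart x)) + ordInf (x : Adele k).2 = 0
  rw [finDiv_eq_zero_iff.mpr h1, map_zero, ordInf, h2]
  simp

/-- Right translation by κ multiplies the two row characters by χ₀ of the diagonal of κ, which is
χ(det κ), and this is undone by χ(det)⁻¹. Degrees do not change. -/
lemma secVal_mul_k0 {m : Ideal k[X]} (hm : m ≠ ⊥) {χ : (FinAdele k)ˣ →* ℂˣ}
    (hχ : IsDirichletCharacter m χ) {x y : ℂ} {g κ : GL2A k} (hκ : κ ∈ k0 m) :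
    secVal m χ x y (g * κ) = secVal m χ x y g := by
  by_cases h : InSupport m g
  · obtain ⟨h1, h2, h3⟩ := h.mul_k0 hκ
    have hf : ∀ i j, IsFinIntegral (κ i j).1 := fun i j => (hκ.1.1 i j).1
    have hm10 : InIdeal m (κ 1 0).1 := hκ.1.2
    have hd : ideleDeg (Matrix.GeneralLinearGroup.det κ) = 0 := by
      refine ideleDeg_eq_zero ?_ ?_
      · rw [finPart_det]; exact isFinIntegralUnit_det hκ.1
      · rw [det_snd]; exact valued_det_of_mem_k0InfComp hκ.2
    have e00 : chi0 m χ ((g * κ) 0 0).1 = chi0 m χ (g 0 0).1 * chi0 m χ (κ 0 0).1 := by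
      rw [← chi0_mul hm hχ (h.integral _ _) (hf _ _)]
      refine chi0_congr hχ ?_
      rw [gl_mul_apply]
      change InIdeal m ((g 0 0).1 * (κ 0 0).1 + (g 0 1).1 * (κ 1 0).1 - (g 0 0).1 * (κ 0 0).1)
      rw [add_sub_cancel_left]
      exact hm10.mul_left (h.integral _ _)
    have e11 : chi0 m χ ((g * κ) 1 1).1 = chi0 m χ (g 1 1).1 * chi0 m χ (κ 1 1).1 := by
      rw [← chi0_mul hm hχ (h.integral _ _) (hf _ _)]
      refine chi0_congr hχ ?_
      rw [gl_mul_apply]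
      change InIdeal m ((g 1 0).1 * (κ 0 1).1 + (g 1 1).1 * (κ 1 1).1 - (g 1 1).1 * (κ 1 1).1)
      rw [add_sub_cancel_right]
      exact h.ideal.mul_right (hf _ _)
    have e3 := chi0_diag_of_mem_k0Fin hm hχ hκ.1
    rw [gFin_apply, gFin_apply] at e3
    rw [secVal_of_inSupport h1, secVal_of_inSupport h, e00, e11, ordInf_eq_of_valued h2,
      ordInf_eq_of_valued h3, map_mul, ideleDeg_mul, hd, add_zero, finPart_mul, map_mul,
      finPart_det κ, Units.val_mul, ← e3]
    have e4 : chi0 m χ (κ 0 0).1 * chi0 m χ (κ 1 1).1 ≠ 0 := by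
      rw [e3]; exact Units.ne_zero _
    obtain ⟨h5, h6⟩ := mul_ne_zero_iff.mp e4
    field_simp
  · rw [secVal_of_not h, secVal_of_not]
    rwa [inSupport_mul_k0_iff hκ]

@[simp] lemma det_scalarGL {R : Type*} [CommRing R] (z : Rˣ) :
    Matrix.GeneralLinearGroup.det (scalarGL z) = z * z := by
  rw [scalarGL_eq, det_triGL]

lemma mul_scalarGL_apply {R : Type*} [CommRing R] (g : GL (Fin 2) R) (z : Rˣ) (i j : Fin 2) :
    (g * scalarGL z) i j = g i j * z := by
  rw [scalarGL_eq, gl_mul_apply]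
  fin_cases j <;> simp

lemma finPart_ofInf (z : (FInf k)ˣ) : finPart (ofInf z) = 1 := rfl

lemma ideleDeg_ofInf (z : (FInf k)ˣ) : ideleDeg (ofInf z) = ordInf (z : FInf k) := by
  rw [ideleDeg, divisor_deg, ideleDiv, finPart_ofInf, finDiv_one, map_zero, zero_add, ofInf_snd]

lemma inSupport_mul_inf {m : Ideal k[X]} {g : GL2A k} (h : InSupport m g) (z : (FInf k)ˣ) :
    InSupport m (g * scalarGL (ofInf z)) := by
  have hz : Valued.v (z : FInf k) ≠ 0 := (_root_.map_ne_zero _).mpr z.ne_zero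
  have e1 : ∀ i j, ((g * scalarGL (ofInf z)) i j).1 = (g i j).1 := fun i j => by
    rw [mul_scalarGL_apply, Prod.fst_mul, ofInf_fst, mul_one]
  have e2 : ∀ i j, ((g * scalarGL (ofInf z)) i j).2 = (g i j).2 * z := fun i j => by
    rw [mul_scalarGL_apply, Prod.snd_mul, ofInf_snd]
  refine ⟨fun i j => ?_, ?_, ?_, ?_⟩
  · rw [e1]; exact h.integral i j
  · rw [e2, e2, map_mul, map_mul]
    exact mul_le_mul_left h.top _
  · rw [e2, e2, map_mul, map_mul]
    exact mul_lt_mul_of_pos_right h.bot (zero_lt_iff.mpr hz)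
  · rw [e1]; exact h.ideal

lemma InSupport.diag_ne_zero {m : Ideal k[X]} {g : GL2A k} (h : InSupport m g) :
    (g 0 0).2 ≠ 0 ∧ (g 1 1).2 ≠ 0 := by
  constructor
  · intro h0
    have h1 : (g 0 1).2 = 0 := by simpa [h0] using h.top
    apply adeleUnit_snd_ne_zero (Matrix.GeneralLinearGroup.det g)
    rw [gl_det]
    change (g 0 0).2 * (g 1 1).2 - (g 0 1).2 * (g 1 0).2 = 0
    rw [h0, h1]; ring
  · intro h0
    have h1 := h.bot
    rw [h0, map_zero] at h1
    exact not_lt_zero h1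

/-- Homogeneity: a scalar z at infinity adds twice its valuation to the degree of the determinant,
which cancels the change in the two exponents -2∞(·). -/
lemma secVal_mul_inf {m : Ideal k[X]} {χ : (FinAdele k)ˣ →* ℂˣ} {x y : ℂ} (hx : x ≠ 0) (hy : y ≠ 0)
    (g : GL2A k) (z : (FInf k)ˣ) :
    secVal m χ x y (g * scalarGL (ofInf z)) = secVal m χ x y g := by
  by_cases h : InSupport m g
  · obtain ⟨h00, h11⟩ := h.diag_ne_zero
    rw [secVal_of_inSupport h, secVal_of_inSupport (inSupport_mul_inf h z), map_mul, det_scalarGL,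
      finPart_mul, finPart_mul, finPart_ofInf, mul_one, mul_one, ideleDeg_mul, ideleDeg_mul,
      ideleDeg_ofInf, mul_scalarGL_apply, mul_scalarGL_apply, Prod.fst_mul, Prod.fst_mul,
      Prod.snd_mul, Prod.snd_mul, ofInf_fst, mul_one, mul_one, ofInf_snd, ordInf_mul h00 z.ne_zero,
      ordInf_mul h11 z.ne_zero, mul_add (-2), mul_add (-2), zpow_add₀ hx, zpow_add₀ hy,
      zpow_add₀ (mul_ne_zero hx hy)]
    set n := ordInf (z : FInf k)
    have e : (x * y) ^ (n + n) * (x ^ (-2 * n) * y ^ (-2 * n)) = 1 := by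
      rw [mul_zpow, mul_mul_mul_comm, ← zpow_add₀ hx, ← zpow_add₀ hy]
      have : n + n + -2 * n = 0 := by ring
      rw [this, zpow_zero, zpow_zero, one_mul]
    linear_combination ((χ (finPart (Matrix.GeneralLinearGroup.det g)) : ℂˣ) : ℂ)⁻¹ *
      (x * y) ^ ideleDeg (Matrix.GeneralLinearGroup.det g) *
      (chi0 m χ (g 0 0).1 * chi0 m χ (g 1 1).1 *
        x ^ (-2 * ordInf (g 0 0).2) * y ^ (-2 * ordInf (g 1 1).2)) * e
  · rw [secVal_of_not h, secVal_of_not]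
    intro h1
    apply h
    have h2 := inSupport_mul_inf h1 z⁻¹
    have e : ofInf z * ofInf z⁻¹ = 1 := by
      rw [ofInf, ofInf, ← map_mul, Prod.mk_mul_mk, mul_inv_cancel, one_mul]
      exact map_one _
    rwa [mul_assoc, ← map_mul, e, map_one, mul_one] at h2

variable {G : Type*} [CommGroup G]

/-- The element of `G` attached to the finite part of the inverse of the determinant. -/
def secClass (pr : (Adele k)ˣ →* G) (g : GL2A k) : G :=
  (pr (ofFin (finPart (Matrix.GeneralLinearGroup.det g))))⁻¹

lemma secClass_mul (pr : (Adele k)ˣ →* G) (g h : GL2A k) :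
    secClass pr (g * h) = secClass pr g * secClass pr h := by
  rw [secClass, secClass, secClass, map_mul, finPart_mul, ofFin_mul, map_mul, mul_inv]

lemma secClass_k0 {pr : (Adele k)ˣ →* G} (hpr : IsFiniteQuotient pr) {m : Ideal k[X]} {κ : GL2A k}
    (hκ : κ ∈ k0 m) : secClass pr κ = 1 := by
  have h := isFinIntegralUnit_det hκ.1
  rw [secClass, finPart_det, hpr.trivial_integral _ h.1 h.2, inv_one]

lemma secClass_inf (pr : (Adele k)ˣ →* G) (z : (FInf k)ˣ) :
    secClass pr (scalarGL (ofInf z)) = 1 := by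
  rw [secClass, det_scalarGL, finPart_mul, finPart_ofInf, mul_one, ofFin_one, map_one, inv_one]

open scoped Classical in
/-- The coefficient at `h` of the function whose sum over `GL₂(F)` is the Eisenstein series. -/
def secCoeff (m : Ideal k[X]) (χ : (FinAdele k)ˣ →* ℂˣ) (pr : (Adele k)ˣ →* G) (x y : ℂ) (h : G)
    (g : GL2A k) : ℂ :=
  if secClass pr g = h then secVal m χ x y g else 0

lemma norm_secCoeff_le (m : Ideal k[X]) (χ : (FinAdele k)ˣ →* ℂˣ) (pr : (Adele k)ˣ →* G) (x y : ℂ)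
    (h : G) (g : GL2A k) : ‖secCoeff m χ pr x y h g‖ ≤ ‖secVal m χ x y g‖ := by
  rw [secCoeff]
  split_ifs
  · exact le_rfl
  · rw [norm_zero]; exact norm_nonneg _

lemma secCoeff_mul_k0 {m : Ideal k[X]} (hm : m ≠ ⊥) {χ : (FinAdele k)ˣ →* ℂˣ}
    (hχ : IsDirichletCharacter m χ) {pr : (Adele k)ˣ →* G} (hpr : IsFiniteQuotient pr) {x y : ℂ}
    (h : G) {g κ : GL2A k} (hκ : κ ∈ k0 m) :
    secCoeff m χ pr x y h (g * κ) = secCoeff m χ pr x y h g := by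
  rw [secCoeff, secCoeff, secVal_mul_k0 hm hχ hκ, secClass_mul, secClass_k0 hpr hκ, mul_one]

lemma secCoeff_mul_inf {m : Ideal k[X]} {χ : (FinAdele k)ˣ →* ℂˣ} {pr : (Adele k)ˣ →* G} {x y : ℂ}
    (hx : x ≠ 0) (hy : y ≠ 0) (h : G) (g : GL2A k) (z : (FInf k)ˣ) :
    secCoeff m χ pr x y h (g * scalarGL (ofInf z)) = secCoeff m χ pr x y h g := by
  rw [secCoeff, secCoeff, secVal_mul_inf hx hy, secClass_mul, secClass_inf, mul_one]

end Section

section Rows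

/-! ### The Eisenstein series as a sum over `GL₂(F)` -/

variable {k : Type*} [Field k]

lemma diagGL_mul_apply (γ : GL (Fin 2) (RatFunc k)) (g : GL2A k) (i j : Fin 2) :
    (diagGL k γ * g) i j = rowMul (γ.1 i) g j := by
  rw [gl_mul_apply, rowMul, Matrix.vecMul, dotProduct, Fin.sum_univ_two]
  rfl

lemma rowMul_smul (c : RatFunc k) (f : Fin 2 → RatFunc k) (g : GL2A k) (j : Fin 2) :
    rowMul (c • f) g j = algebraMap (RatFunc k) (Adele k) c * rowMul f g j := by
  simp only [rowMul, Matrix.vecMul, dotProduct, Fin.sum_univ_two, Pi.smul_apply, smul_eq_mul, map_mul]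
  ring

/-- If the two vectors were proportional, the first would satisfy the strict inequality that defines
V(g), like the second; but U(g) excludes it. -/
lemma pair_det_ne_zero {g : GL2A k} (p : setU g × setV g) :
    p.1.1 0 * p.2.1 1 - p.1.1 1 * p.2.1 0 ≠ 0 := by
  obtain ⟨⟨u, ⟨hu0, huw⟩, huv⟩, ⟨v, ⟨hv0, hvw⟩, hv⟩⟩ := p
  change u 0 * v 1 - u 1 * v 0 ≠ 0
  intro h
  apply huv
  have key : ∃ c : RatFunc k, u = c • v := by
    by_cases h0 : v 0 = 0
    · have h1 : v 1 ≠ 0 := by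
        intro h1
        apply hv0
        ext i
        fin_cases i
        exacts [h0, h1]
      refine ⟨u 1 / v 1, ?_⟩
      ext i
      fin_cases i
      · change u 0 = u 1 / v 1 * v 0
        rw [h0, mul_zero, sub_zero] at h
        rw [h0, mul_zero]
        exact (mul_eq_zero.mp h).resolve_right h1
      · change u 1 = u 1 / v 1 * v 1
        field_simp
    · refine ⟨u 0 / v 0, ?_⟩
      ext i
      fin_cases i
      · change u 0 = u 0 / v 0 * v 0
        field_simp
      · change u 1 = u 0 / v 0 * v 1
        field_simp
        linear_combination -h
  obtain ⟨c, rfl⟩ := key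
  have hc : c ≠ 0 := by
    rintro rfl
    exact hu0 (zero_smul _ _)
  refine ⟨⟨hu0, huw⟩, ?_⟩
  rw [rowMul_smul, rowMul_smul, Prod.snd_mul, Prod.snd_mul, map_mul, map_mul]
  refine mul_lt_mul_of_pos_left hv (zero_lt_iff.mpr ?_)
  rw [_root_.map_ne_zero]
  exact (_root_.map_ne_zero (algebraMap (RatFunc k) (FInf k))).mpr hc

/-- The matrix with rows in `U(g)` and `V(g)`. -/
def pairMatrix {g : GL2A k} (p : setU g × setV g) : GL (Fin 2) (RatFunc k) :=
  Matrix.GeneralLinearGroup.mkOfDetNeZero !![p.1.1 0, p.1.1 1; p.2.1 0, p.2.1 1]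
    (by rw [Matrix.det_fin_two_of]; exact pair_det_ne_zero p)

lemma pairMatrix_zero {g : GL2A k} (p : setU g × setV g) : (pairMatrix p).1 0 = p.1.1 := by
  ext j
  fin_cases j <;> rfl

lemma pairMatrix_one {g : GL2A k} (p : setU g × setV g) : (pairMatrix p).1 1 = p.2.1 := by
  ext j
  fin_cases j <;> rfl

lemma pairMatrix_injective {g : GL2A k} : Function.Injective (pairMatrix (g := g)) := by
  intro p p' h
  refine Prod.ext (Subtype.ext ?_) (Subtype.ext ?_)
  · rw [← pairMatrix_zero p, h, pairMatrix_zero]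
  · rw [← pairMatrix_one p, h, pairMatrix_one]

lemma exists_pairMatrix {m : Ideal k[X]} {g : GL2A k} {γ : GL (Fin 2) (RatFunc k)}
    (h : InSupport m (diagGL k γ * g)) : ∃ p : setU g × setV g, pairMatrix p = γ := by
  have hint := h.integral
  have h1 := h.top
  have h2 := h.bot
  simp only [diagGL_mul_apply] at hint h1 h2
  have hdet := (Matrix.GeneralLinearGroup.det γ).ne_zero
  rw [gl_det] at hdet
  have hne : ∀ i, γ.1 i ≠ 0 := by
    intro i h0
    apply hdet
    have h3 := congrFun h0
    fin_cases i
    · change γ.1 0 0 * _ - γ.1 0 1 * _ = 0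
      have e0 : γ.1 0 0 = 0 := h3 0
      have e1 : γ.1 0 1 = 0 := h3 1
      rw [e0, e1]; ring
    · change _ * γ.1 1 1 - _ * γ.1 1 0 = 0
      have e0 : γ.1 1 0 = 0 := h3 0
      have e1 : γ.1 1 1 = 0 := h3 1
      rw [e0, e1]; ring
  refine ⟨⟨⟨γ.1 0, ⟨hne 0, hint 0⟩, fun h3 => not_lt.mpr h1 h3.2⟩, ⟨γ.1 1, ⟨hne 1, hint 1⟩, h2⟩⟩, ?_⟩
  apply gl_ext <;> rfl

variable {G : Type*} [CommGroup G]

lemma ofFin_mul_ofInf (x : (Adele k)ˣ) (z : (FInf k)ˣ) (hz : (z : FInf k) = (x : Adele k).2) :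
    ofFin (finPart x) * ofInf z = x := by
  ext1
  refine Prod.ext ?_ ?_
  · rw [Units.val_mul, Prod.fst_mul, ofInf_fst, ofFin_fst, mul_one]; rfl
  · rw [Units.val_mul, Prod.snd_mul, ofInf_snd, ofFin_snd, one_mul, hz]

/-- The quotient map kills the principal idele of d, so its components at infinity and at the finite
places have inverse classes. -/
lemma infClass_eq {pr : (Adele k)ˣ →* G} (hpr : IsFiniteQuotient pr) (d : (RatFunc k)ˣ) :
    infClass pr d = (pr (ofFin (finDiagUnit k d)))⁻¹ := by
  rw [infClass, dif_neg d.ne_zero, eq_inv_iff_mul_eq_one, mul_comm, ← map_mul,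
    ← hpr.trivial_principal d]
  exact congrArg pr (ofFin_mul_ofInf (diagUnit k d) _ rfl)

lemma det_diagGL (γ : GL (Fin 2) (RatFunc k)) : Matrix.GeneralLinearGroup.det (diagGL k γ) =
    diagUnit k (Matrix.GeneralLinearGroup.det γ) := by
  ext1
  rw [gl_det, coe_diagUnit, gl_det, map_sub, map_mul, map_mul]
  rfl

lemma secClass_diagGL {pr : (Adele k)ˣ →* G} (hpr : IsFiniteQuotient pr)
    (γ : GL (Fin 2) (RatFunc k)) :
    secClass pr (diagGL k γ) = infClass pr (γ.1 0 0 * γ.1 1 1 - γ.1 0 1 * γ.1 1 0) := by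
  have h := infClass_eq hpr (Matrix.GeneralLinearGroup.det γ)
  rw [gl_det] at h
  rw [secClass, det_diagGL, finPart_diagUnit]
  exact h.symm

lemma ordInfPair_of_le {w : Fin 2 → Adele k} (h : Valued.v (w 1).2 ≤ Valued.v (w 0).2) :
    ordInfPair w = ordInf (w 0).2 := by
  rw [ordInfPair, max_eq_left h, ordInf]

lemma ordInfPair_of_lt {w : Fin 2 → Adele k} (h : Valued.v (w 0).2 < Valued.v (w 1).2) :
    ordInfPair w = ordInf (w 1).2 := by
  rw [ordInfPair, max_eq_right h.le, ordInf]

lemma secVal_pairMatrix {m : Ideal k[X]} {χ : (FinAdele k)ˣ →* ℂˣ} (hχ : IsDirichletCharacter m χ)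
    (x y : ℂ) {g : GL2A k} (p : setU g × setV g) :
    secVal m χ x y (diagGL k (pairMatrix p) * g) =
      ((χ (finPart (Matrix.GeneralLinearGroup.det g)) : ℂˣ) : ℂ)⁻¹ *
        (x * y) ^ ideleDeg (Matrix.GeneralLinearGroup.det g) *
      (chi1 m χ (rowMul p.1.1 g) * chi2 m χ (rowMul p.2.1 g) *
        x ^ (-2 * ordInfPair (rowMul p.1.1 g)) * y ^ (-2 * ordInfPair (rowMul p.2.1 g))) := by
  have hu := p.1.2
  have hv := p.2.2
  have hu2 : Valued.v (rowMul p.1.1 g 1).2 ≤ Valued.v (rowMul p.1.1 g 0).2 :=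
    not_lt.mp fun h => hu.2 ⟨hu.1, h⟩
  have hv2 : Valued.v (rowMul p.2.1 g 0).2 < Valued.v (rowMul p.2.1 g 1).2 := hv.2
  have e0 : ∀ j, (diagGL k (pairMatrix p) * g) 0 j = rowMul p.1.1 g j := fun j => by
    rw [diagGL_mul_apply, pairMatrix_zero]
  have e1 : ∀ j, (diagGL k (pairMatrix p) * g) 1 j = rowMul p.2.1 g j := fun j => by
    rw [diagGL_mul_apply, pairMatrix_one]
  by_cases hI : InIdeal m (rowMul p.2.1 g 0).1
  · have hs : InSupport m (diagGL k (pairMatrix p) * g) := by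
      refine ⟨fun i j => ?_, ?_, ?_, ?_⟩
      · rw [diagGL_mul_apply]
        fin_cases i
        · change IsFinIntegral (rowMul ((pairMatrix p).1 0) g j).1
          rw [pairMatrix_zero]; exact hu.1.2 j
        · change IsFinIntegral (rowMul ((pairMatrix p).1 1) g j).1
          rw [pairMatrix_one]; exact hv.1.2 j
      · rwa [e0, e0]
      · rwa [e1, e1]
      · rwa [e1]
    rw [secVal_of_inSupport hs, e0, e1, map_mul, det_diagGL, finPart_mul, finPart_diagUnit, map_mul,
      hχ.trivial_principal, one_mul, ideleDeg_mul, ideleDeg_diagUnit, zero_add, chi1, chi2,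
      if_pos hI, ordInfPair_of_le hu2, ordInfPair_of_lt hv2]
  · rw [secVal_of_not, chi2, if_neg hI]
    · ring
    · intro h
      apply hI
      have := h.ideal
      rwa [e1] at this

/-- The class of det γ at infinity is the inverse of its finite class, so it merges with that of g
into the class attached to γg. The scalar prefactor of the series is likewise unchanged when g
becomes γg, since det γ is principal. -/
lemma eisTerm_coeff {m : Ideal k[X]} {χ : (FinAdele k)ˣ →* ℂˣ} (hχ : IsDirichletCharacter m χ)
    {pr : (Adele k)ˣ →* G} (hpr : IsFiniteQuotient pr) {x y : ℂ} (g : GL2A k)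
    (p : setU g × setV g) (h : G) :
    ((χ (finPart (Matrix.GeneralLinearGroup.det g)) : ℂˣ) : ℂ)⁻¹ *
      (x * y) ^ ideleDeg (Matrix.GeneralLinearGroup.det g) *
        (eisTerm m χ pr g x y p).coeff h =
      secCoeff m χ pr x y (secClass pr g * h) (diagGL k (pairMatrix p) * g) := by
  classical
  have hc : secClass pr (diagGL k (pairMatrix p)) =
      infClass pr (p.1.1 0 * p.2.1 1 - p.1.1 1 * p.2.1 0) := by
    rw [secClass_diagGL hpr, pairMatrix_zero, pairMatrix_one]
  rw [eisTerm, MonoidAlgebra.coeff_single, Finsupp.single_apply, secCoeff, secVal_pairMatrix hχ, secClass_mul, hc,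
    mul_comm _ (secClass pr g)]
  simp only [mul_right_inj]
  split_ifs
  · rfl
  · rw [mul_zero]

variable {m : Ideal k[X]} {χ : (FinAdele k)ˣ →* ℂˣ} {pr : (Adele k)ˣ →* G} {x y : ℂ}

lemma gsummable_eisTerm (hχ : IsDirichletCharacter m χ) (hpr : IsFiniteQuotient pr) (hx : x ≠ 0)
    (hy : y ≠ 0) (g : GL2A k) (hs : Summable fun γ => secVal m χ x y (diagGL k γ * g)) :
    GSummable (eisTerm m χ pr g x y) := by
  intro h
  set c := ((χ (finPart (Matrix.GeneralLinearGroup.det g)) : ℂˣ) : ℂ)⁻¹ *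
      (x * y) ^ ideleDeg (Matrix.GeneralLinearGroup.det g)
  have hc : c ≠ 0 := mul_ne_zero (inv_ne_zero (Units.ne_zero _)) (zpow_ne_zero _ (mul_ne_zero hx hy))
  rw [← summable_mul_left_iff hc]
  have h1 : Summable fun γ => secCoeff m χ pr x y (secClass pr g * h) (diagGL k γ * g) :=
    Summable.of_norm_bounded hs.norm fun γ => norm_secCoeff_le _ _ _ _ _ _ _
  refine (h1.comp_injective (pairMatrix_injective (g := g))).congr fun p => ?_
  exact (eisTerm_coeff hχ hpr g p h).symm

/-- The matrices that do not come from a pair in U(g) × V(g) contribute 0. Everything about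
invariance and unfolding is read off from this form of the series. -/
lemma eisenstein_coeff [Finite G] (hχ : IsDirichletCharacter m χ) (hpr : IsFiniteQuotient pr)
    (g : GL2A k) (h : G) : (eisenstein m χ pr g x y).coeff h =
      ∑' γ, secCoeff m χ pr x y h (diagGL k γ * g) := by
  have hinj : Function.Injective (pairMatrix (g := g)) := pairMatrix_injective
  rw [← hinj.tsum_eq (f := fun γ => secCoeff m χ pr x y h (diagGL k γ * g)), eisenstein,
    MonoidAlgebra.coeff_single_mul_apply]
  · change _ * ∑' p, _ = _
    rw [← tsum_mul_left]
    refine tsum_congr fun p => ?_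
    rw [eisTerm_coeff hχ hpr, secClass, inv_inv, inv_mul_cancel_left]
  · intro γ hγ
    rw [Function.mem_support] at hγ
    refine exists_pairMatrix (m := m) ?_
    by_contra hc
    apply hγ
    rw [secCoeff, secVal_of_not hc, ite_self]

lemma monoidAlgebra_ext {G : Type*} {a b : MonoidAlgebra ℂ G} (h : ∀ g, a.coeff g = b.coeff g) : a = b :=
  MonoidAlgebra.coeff_injective (Finsupp.ext h)

lemma eisenstein_diagGL_mul [Finite G] (hχ : IsDirichletCharacter m χ) (hpr : IsFiniteQuotient pr)
    (γ : GL (Fin 2) (RatFunc k)) (g : GL2A k) :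
    eisenstein m χ pr (diagGL k γ * g) x y = eisenstein m χ pr g x y := by
  refine monoidAlgebra_ext fun h => ?_
  rw [eisenstein_coeff hχ hpr, eisenstein_coeff hχ hpr,
    ← (Equiv.mulRight γ).tsum_eq fun δ => secCoeff m χ pr x y h (diagGL k δ * g)]
  refine tsum_congr fun δ => ?_
  rw [Equiv.coe_mulRight, map_mul, mul_assoc]

lemma eisenstein_mul_k0 [Finite G] (hm : m ≠ ⊥) (hχ : IsDirichletCharacter m χ)
    (hpr : IsFiniteQuotient pr) (g : GL2A k) {κ : GL2A k} (hκ : κ ∈ k0 m) :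
    eisenstein m χ pr (g * κ) x y = eisenstein m χ pr g x y := by
  refine monoidAlgebra_ext fun h => ?_
  rw [eisenstein_coeff hχ hpr, eisenstein_coeff hχ hpr]
  refine tsum_congr fun δ => ?_
  rw [← mul_assoc, secCoeff_mul_k0 hm hχ hpr h hκ]

lemma eisenstein_mul_inf [Finite G] (hχ : IsDirichletCharacter m χ) (hpr : IsFiniteQuotient pr)
    (hx : x ≠ 0) (hy : y ≠ 0) (g : GL2A k) (z : (FInf k)ˣ) :
    eisenstein m χ pr (g * scalarGL (ofInf z)) x y = eisenstein m χ pr g x y := by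
  refine monoidAlgebra_ext fun h => ?_
  rw [eisenstein_coeff hχ hpr, eisenstein_coeff hχ hpr]
  refine tsum_congr fun δ => ?_
  rw [← mul_assoc, secCoeff_mul_inf hx hy]

lemma scalarGL_ofFin_mem_k0 {u : (FinAdele k)ˣ} (hu : IsFinIntegralUnit u) (m : Ideal k[X]) :
    scalarGL (ofFin u) ∈ k0 m := by
  have e1 : gFin k (scalarGL (ofFin u)) = triGL u u 0 := by
    rw [scalarGL_eq]
    apply gl_ext <;> simp [gFin_apply]
  have e2 : gInf k (scalarGL (ofFin u)) = 1 := by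
    rw [scalarGL_eq]
    apply gl_ext <;> simp [gInf_apply, gl_one_apply]
  refine mem_k0_iff.mpr ⟨?_, ?_⟩
  · rw [e1]
    exact triGL_mem_k0GL hu.1 hu.2 hu.1 hu.2 (finIntegers k).zero_mem
  · rw [e2]
    exact one_mem _

/-- The idele class group of `F` is generated by `𝒪_f^*` and `F_∞^*`. -/
lemma exists_idele_factorization (z : (Adele k)ˣ) : ∃ (a : (RatFunc k)ˣ) (u : (FinAdele k)ˣ)
    (w : (FInf k)ˣ), IsFinIntegralUnit u ∧ z = diagUnit k a * ofFin u * ofInf w := by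
  obtain ⟨a, ha⟩ := exists_ratFunc_unit (finPart z)
  have hne : ((diagUnit k a : (Adele k)ˣ) : Adele k).2 ≠ 0 := adeleUnit_snd_ne_zero _
  refine ⟨a, _, Units.mk0 ((z : Adele k).2 / (diagUnit k a : Adele k).2)
    (div_ne_zero (adeleUnit_snd_ne_zero z) hne), ha, ?_⟩
  ext1
  refine Prod.ext ?_ ?_
  · rw [Units.val_mul, Units.val_mul, Prod.fst_mul, Prod.fst_mul, ofInf_fst, ofFin_fst, mul_one]
    change _ = ((finDiagUnit k a : (FinAdele k)ˣ) : FinAdele k) * _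
    rw [← Units.val_mul, mul_inv_cancel_left]
    rfl
  · rw [Units.val_mul, Units.val_mul, Prod.snd_mul, Prod.snd_mul, ofInf_snd, ofFin_snd, mul_one,
      Units.val_mk0, mul_div_cancel₀ _ hne]

lemma diagGL_scalarGL (a : (RatFunc k)ˣ) : diagGL k (scalarGL a) = scalarGL (diagUnit k a) := by
  rw [scalarGL_eq, scalarGL_eq, diagGL, gl_map_triGL, map_zero]
  rfl

/-- A central idele factors through F^*, absorbed on the left, 𝒪_f^*, which lies in 𝕂₀(𝔪∞), and
F_∞^*, under which the section is homogeneous of degree 0. -/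
lemma eisenstein_mul_center [Finite G] (hm : m ≠ ⊥) (hχ : IsDirichletCharacter m χ)
    (hpr : IsFiniteQuotient pr) (hx : x ≠ 0) (hy : y ≠ 0) (g : GL2A k) {z : GL2A k}
    (hz : z ∈ Subgroup.center (GL2A k)) :
    eisenstein m χ pr (g * z) x y = eisenstein m χ pr g x y := by
  obtain ⟨z, rfl⟩ := mem_center_iff.mp hz
  obtain ⟨a, u, w, hu, rfl⟩ := exists_idele_factorization z
  have e : (scalarGL (diagUnit k a * ofFin u * ofInf w) : GL2A k) =
      scalarGL (diagUnit k a) * scalarGL (ofFin u) * scalarGL (ofInf w) := by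
    rw [scalarGL, map_mul, map_mul]
  rw [e, ← mul_assoc, eisenstein_mul_inf hχ hpr hx hy, ← mul_assoc,
    eisenstein_mul_k0 hm hχ hpr _ (scalarGL_ofFin_mem_k0 hu m), ← scalarGL_comm, ← diagGL_scalarGL,
    eisenstein_diagGL_mul hχ hpr]

end Rows

section Convergence

/-! ### Absolute convergence of the Eisenstein series -/

variable {k : Type*} [Field k]

lemma card_natDegree_eq_le [Finite k] (n : ℕ) :
    Finite {p : k[X] // p.natDegree = n} ∧
      Nat.card {p : k[X] // p.natDegree = n} ≤ Nat.card k ^ (n + 1) := by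
  have hfin : Finite (degreeLT k (n + 1)) := Finite.of_equiv _ (degreeLTEquiv k (n + 1)).symm.toEquiv
  let f : {p : k[X] // p.natDegree = n} → degreeLT k (n + 1) := fun p =>
    ⟨p.1, mem_degreeLT.mpr (degree_le_natDegree.trans_lt (by
      rw [p.2]; exact_mod_cast Nat.lt_succ_self n))⟩
  have hf : Function.Injective f := fun p r h => Subtype.ext (congrArg (fun a => a.1) h)
  refine ⟨Finite.of_injective f hf, ?_⟩
  calc Nat.card {p : k[X] // p.natDegree = n} ≤ Nat.card (degreeLT k (n + 1)) :=
        Nat.card_le_card_of_injective f hf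
    _ = Nat.card (Fin (n + 1) → k) := Nat.card_congr (degreeLTEquiv k (n + 1)).toEquiv
    _ = _ := by rw [Nat.card_fun, Nat.card_fin]

/-- At most q^{n+1} polynomials have degree n, so the series is dominated by a geometric one of
ratio qX. -/
lemma summable_pow_natDegree [Finite k] {X : ℝ} (hX : 0 ≤ X) (hqX : Nat.card k * X < 1) :
    Summable fun p : k[X] => X ^ p.natDegree := by
  rw [← (Equiv.sigmaFiberEquiv (fun p : k[X] => p.natDegree)).summable_iff]
  refine (summable_sigma_of_nonneg fun a => ?_).mpr ?_
  · exact pow_nonneg hX _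
  have he : ∀ n (p : {p : k[X] // p.natDegree = n}), ((fun p : k[X] => X ^ p.natDegree) ∘
      (Equiv.sigmaFiberEquiv (fun p : k[X] => p.natDegree))) ⟨n, p⟩ = X ^ n := by
    rintro n ⟨p, hp⟩
    change X ^ p.natDegree = _
    rw [hp]
  refine ⟨fun n => ?_, ?_⟩
  · have := (card_natDegree_eq_le (k := k) n).1
    exact Summable.of_finite
  · refine Summable.of_nonneg_of_le (fun n => tsum_nonneg fun _ => pow_nonneg hX _) (fun n => ?_)
      ((summable_geometric_of_lt_one (by positivity) hqX).mul_left (Nat.card k : ℝ))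
    simp only [he]
    rw [tsum_const, nsmul_eq_mul, mul_pow, ← mul_assoc, ← pow_succ']
    refine mul_le_mul_of_nonneg_right ?_ (pow_nonneg hX _)
    exact_mod_cast (card_natDegree_eq_le n).2

lemma exists_poly_mul_integral (x : FinAdele k) :
    ∃ p : k[X], p ≠ 0 ∧ IsFinIntegral (polyFin k p * x) := by
  obtain ⟨a, ha⟩ := exists_ratFunc_sub_integral x
  refine ⟨a.denom, a.denom_ne_zero, ?_⟩
  have h1 : polyFin k a.denom * algebraMap (RatFunc k) (FinAdele k) a = polyFin k a.num := by
    change algebraMap (RatFunc k) (FinAdele k) (algebraMap k[X] (RatFunc k) a.denom) * _ =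
      algebraMap (RatFunc k) (FinAdele k) (algebraMap k[X] (RatFunc k) a.num)
    rw [← map_mul]
    congr 1
    have h0 := (map_ne_zero_iff _ (IsFractionRing.injective k[X] (RatFunc k))).mpr a.denom_ne_zero
    have h1 := RatFunc.num_div_denom a
    rw [div_eq_iff h0] at h1
    rw [h1, mul_comm]
  have h2 : polyFin k a.denom * x = polyFin k a.denom * (x - algebraMap (RatFunc k) (FinAdele k) a) +
      polyFin k a.num := by rw [mul_sub, h1, sub_add_cancel]
  rw [h2]
  exact (finIntegers k).add_mem ((finIntegers k).mul_mem (isFinIntegral_polyFin _) ha)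
    (isFinIntegral_polyFin _)

lemma exists_poly_mul_integral_finite {ι : Type*} (s : Finset ι) (x : ι → FinAdele k) :
    ∃ p : k[X], p ≠ 0 ∧ ∀ i ∈ s, IsFinIntegral (polyFin k p * x i) := by
  choose p hp h using fun i => exists_poly_mul_integral (x i)
  refine ⟨∏ i ∈ s, p i, Finset.prod_ne_zero_iff.mpr fun i _ => hp i, fun i hi => ?_⟩
  classical
  rw [← Finset.mul_prod_erase s p hi, map_mul, mul_right_comm, mul_comm (_ * x i)]
  rw [mul_comm]
  exact (finIntegers k).mul_mem (h i) (isFinIntegral_polyFin _)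

lemma rowMul_inv (f : Fin 2 → RatFunc k) (g : GL2A k) (i : Fin 2) :
    algebraMap (RatFunc k) (Adele k) (f i) = rowMul f g 0 * g⁻¹ 0 i + rowMul f g 1 * g⁻¹ 1 i := by
  have h : (rowMul f g) ᵥ* (g⁻¹ : GL2A k).1 = fun i => algebraMap (RatFunc k) (Adele k) (f i) := by
    rw [rowMul, Matrix.vecMul_vecMul, ← Units.val_mul, mul_inv_cancel, Units.val_one,
      Matrix.vecMul_one]
  rw [← congrFun h i, Matrix.vecMul, dotProduct, Fin.sum_univ_two]

/-- Recover f as (fg)g⁻¹: fg is integral at the finite places, so the denominators come from the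
entries of g⁻¹ and are bounded independently of f. -/
lemma exists_denominator (g : GL2A k) : ∃ N : k[X], N ≠ 0 ∧ ∀ f ∈ setW g, ∀ i,
    ∃ p : k[X], algebraMap k[X] (RatFunc k) p = algebraMap k[X] (RatFunc k) N * f i := by
  obtain ⟨N, hN, h⟩ := exists_poly_mul_integral_finite (Finset.univ : Finset (Fin 2 × Fin 2))
    fun ij => (g⁻¹ ij.1 ij.2).1
  refine ⟨N, hN, fun f hf i => ?_⟩
  rw [← isFinIntegral_algebraMap_iff, map_mul]
  change IsFinIntegral (polyFin k N * (algebraMap (RatFunc k) (Adele k) (f i)).1)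
  rw [rowMul_inv f g i]
  have e : polyFin k N * (rowMul f g 0 * g⁻¹ 0 i + rowMul f g 1 * g⁻¹ 1 i).1 =
      (rowMul f g 0).1 * (polyFin k N * (g⁻¹ 0 i).1) +
        (rowMul f g 1).1 * (polyFin k N * (g⁻¹ 1 i).1) := by
    change polyFin k N * ((rowMul f g 0).1 * (g⁻¹ 0 i).1 + (rowMul f g 1).1 * (g⁻¹ 1 i).1) = _
    ring
  rw [e]
  exact (finIntegers k).add_mem ((finIntegers k).mul_mem (hf.2 0) (h (0, i) (Finset.mem_univ _)))
    ((finIntegers k).mul_mem (hf.2 1) (h (1, i) (Finset.mem_univ _)))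

lemma exists_exp_bound {ι : Type*} (s : Finset ι) (x : ι → FInf k) :
    ∃ C : ℤ, ∀ i ∈ s, Valued.v (x i) ≤ WithZero.exp C := by
  classical
  induction s using Finset.induction_on with
  | empty => exact ⟨0, by simp⟩
  | insert a s _ ih =>
    obtain ⟨C, hC⟩ := ih
    refine ⟨max C (WithZero.log (Valued.v (x a))), fun i hi => ?_⟩
    rcases Finset.mem_insert.mp hi with rfl | hi
    · exact WithZero.le_exp_log.trans (WithZero.exp_le_exp.mpr (le_max_right _ _))
    · exact (hC i hi).trans (WithZero.exp_le_exp.mpr (le_max_left _ _))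

/-- The same recovery of f from fg, at infinity: the degrees of f exceed the size of fg by at most a
constant depending on g⁻¹. -/
lemma exists_degree_bound (g : GL2A k) : ∃ C : ℤ, ∀ (f : Fin 2 → RatFunc k) (i : Fin 2), f i ≠ 0 →
    (f i).intDegree ≤ -ordInfPair (rowMul f g) + C := by
  obtain ⟨C, h⟩ := exists_exp_bound (Finset.univ : Finset (Fin 2 × Fin 2))
    fun ij => (g⁻¹ ij.1 ij.2).2
  refine ⟨C, fun f i hf => ?_⟩
  have h1 : algebraMap (RatFunc k) (FInf k) (f i) =
      (rowMul f g 0).2 * (g⁻¹ 0 i).2 + (rowMul f g 1).2 * (g⁻¹ 1 i).2 :=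
    congrArg Prod.snd (rowMul_inv f g i)
  set M := max (Valued.v (rowMul f g 0).2) (Valued.v (rowMul f g 1).2) with hM
  have h2 : WithZero.exp (f i).intDegree ≤ M * WithZero.exp C := by
    rw [← valued_inf_algebraMap hf, h1]
    refine (Valuation.map_add _ _ _).trans (max_le ?_ ?_)
    · rw [map_mul]
      exact mul_le_mul' (le_max_left _ _) (h (0, i) (Finset.mem_univ _))
    · rw [map_mul]
      exact mul_le_mul' (le_max_right _ _) (h (1, i) (Finset.mem_univ _))
  have hM0 : M ≠ 0 := by
    intro h0
    rw [h0, zero_mul, le_zero_iff] at h2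
    exact WithZero.exp_ne_zero h2
  have h3 : M = WithZero.exp (-ordInfPair (rowMul f g)) := by
    rw [ordInfPair, neg_neg, WithZero.exp_log hM0]
  rw [h3, ← WithZero.exp_add, WithZero.exp_le_exp] at h2
  exact h2

lemma summable_pow_prod {Y : Type*} (d : Y → ℕ) {X : ℝ} (hX : 0 ≤ X)
    (hs : Summable fun p : Y => X ^ d p) : Summable fun z : Y × Y => X ^ d z.1 * X ^ d z.2 :=
  hs.mul_of_nonneg hs (fun p => pow_nonneg hX (d p)) fun p => pow_nonneg hX (d p)

/-- The exponent 2D dominates the sum of the two degrees up to a constant, so the series is bounded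
by part of a product of two series over polynomials. -/
lemma summable_zpow_of_le {ι Y : Type*} (d : Y → ℕ) {p : ι → Y × Y} (hp : Function.Injective p)
    {D : ι → ℤ} {C : ℤ} (h0 : ∀ i, (d (p i).1 : ℤ) ≤ D i + C) (h1 : ∀ i, (d (p i).2 : ℤ) ≤ D i + C)
    {X : ℝ} (hX : 0 < X) (hX1 : X ≤ 1) (hs : Summable fun p : Y => X ^ d p) :
    Summable fun i => X ^ (2 * D i) := by
  refine Summable.of_nonneg_of_le (fun i => zpow_nonneg hX.le _) (fun i => ?_)
    (((summable_pow_prod d hX.le hs).comp_injective hp).mul_left (X ^ (-2 * C)))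
  have e : X ^ (-2 * C) * (X ^ d (p i).1 * X ^ d (p i).2) =
      X ^ (-2 * C + (d (p i).1 + d (p i).2)) := by
    rw [zpow_add₀ hX.ne', zpow_add₀ hX.ne', zpow_natCast, zpow_natCast]
  refine le_of_le_of_eq ?_ e.symm
  refine zpow_le_zpow_right_of_le_one₀ hX hX1 ?_
  linarith [h0 i, h1 i]

lemma exists_natDegree_bound (g : GL2A k) : ∃ (p : setW g → k[X] × k[X]) (C : ℤ),
    Function.Injective p ∧ ∀ f : setW g,
      ((p f).1.natDegree : ℤ) ≤ -ordInfPair (rowMul f.1 g) + C ∧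
      ((p f).2.natDegree : ℤ) ≤ -ordInfPair (rowMul f.1 g) + C := by
  obtain ⟨N, hN, hp⟩ := exists_denominator g
  obtain ⟨C, hC⟩ := exists_degree_bound g
  choose p hp using fun (f : setW g) => hp f.1 f.2
  have hN' := polyUnit_aux hN
  have hdeg : ∀ (f : setW g) i, f.1 i ≠ 0 →
      ((p f i).natDegree : ℤ) ≤ -ordInfPair (rowMul f.1 g) + (C + N.natDegree) := by
    intro f i hi
    have h1 := hC f.1 i hi
    have h2 := congrArg RatFunc.intDegree (hp f i)
    rw [RatFunc.intDegree_mul hN' hi, RatFunc.intDegree_polynomial, RatFunc.intDegree_polynomial] at h2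
    linarith
  have hdeg' : ∀ (f : setW g) i,
      ((p f i).natDegree : ℤ) ≤ -ordInfPair (rowMul f.1 g) + (C + N.natDegree) := by
    intro f i
    by_cases hi : f.1 i = 0
    · have h1 := hp f i
      rw [hi, mul_zero, map_eq_zero_iff _ (IsFractionRing.injective k[X] (RatFunc k))] at h1
      rw [h1, natDegree_zero]
      -- A zero entry has `natDegree` 0, so the bound requires a nonnegative right side; the other,
      -- nonzero, entry supplies it.
      obtain ⟨j, hj⟩ := Function.ne_iff.mp f.2.1
      exact (Int.natCast_nonneg _).trans (hdeg f j hj)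
    · exact hdeg f i hi
  refine ⟨fun f => (p f 0, p f 1), C + N.natDegree, fun f f' h => ?_,
    fun f => ⟨hdeg' f 0, hdeg' f 1⟩⟩
  rw [Prod.mk.injEq] at h
  refine Subtype.ext (funext fun i => mul_left_cancel₀ hN' ?_)
  rw [← hp, ← hp]
  fin_cases i
  · exact congrArg _ h.1
  · exact congrArg _ h.2

lemma summable_setW [Finite k] (g : GL2A k) {X : ℝ} (hX : 0 < X) (hqX : Nat.card k * X < 1) :
    Summable fun f : setW g => X ^ (-2 * ordInfPair (rowMul f.1 g)) := by
  obtain ⟨p, C, hp, h⟩ := exists_natDegree_bound g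
  have hX1 : X ≤ 1 := by
    by_contra h
    have h2 : (1 : ℝ) ≤ Nat.card k := by exact_mod_cast Nat.card_pos
    exact absurd hqX (not_lt.mpr ((not_le.mp h).le.trans (le_mul_of_one_le_left hX.le h2)))
  refine (summable_zpow_of_le natDegree hp (fun f => (h f).1) (fun f => (h f).2) hX hX1
    (summable_pow_natDegree hX.le hqX)).congr fun f => ?_
  rw [neg_mul, mul_neg]

lemma summable_of_subset {α : Type*} {F : α → ℝ} {s t : Set α} (ht : Summable fun a : t => F a)
    (h : s ⊆ t) : Summable fun a : s => F a :=
  ht.comp_injective (Set.inclusion_injective h)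

/-- Characters have norm at most 1, so up to a constant the series is dominated by the product of a
sum over U(g) in |x| and a sum over V(g) in |y|. -/
lemma summable_secVal [Finite k] {m : Ideal k[X]} (hm : m ≠ ⊥) {χ : (FinAdele k)ˣ →* ℂˣ}
    (hχ : IsDirichletCharacter m χ) {x y : ℂ} (hx : x ≠ 0) (hy : y ≠ 0)
    (hqx : Nat.card k * ‖x‖ < 1) (hqy : Nat.card k * ‖y‖ < 1) (g : GL2A k) :
    Summable fun γ => secVal m χ x y (diagGL k γ * g) := by
  rw [← (pairMatrix_injective (g := g)).summable_iff]
  · have h1 : Summable fun u : setU g => ‖x‖ ^ (-2 * ordInfPair (rowMul u.1 g)) :=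
      summable_of_subset (F := fun u => ‖x‖ ^ (-2 * ordInfPair (rowMul u g)))
        (summable_setW g (norm_pos_iff.mpr hx) hqx) Set.sdiff_subset
    have h2 : Summable fun v : setV g => ‖y‖ ^ (-2 * ordInfPair (rowMul v.1 g)) :=
      summable_of_subset (F := fun u => ‖y‖ ^ (-2 * ordInfPair (rowMul u g)))
        (summable_setW g (norm_pos_iff.mpr hy) hqy) fun _ h => h.1
    have h3 := h1.mul_of_nonneg h2 (fun _ => zpow_nonneg (norm_nonneg _) _)
      fun _ => zpow_nonneg (norm_nonneg _) _
    set c := ((χ (finPart (Matrix.GeneralLinearGroup.det g)) : ℂˣ) : ℂ)⁻¹ *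
      (x * y) ^ ideleDeg (Matrix.GeneralLinearGroup.det g)
    refine Summable.of_norm_bounded (h3.mul_left ‖c‖) fun p => ?_
    rw [Function.comp_apply, secVal_pairMatrix hχ, norm_mul]
    refine mul_le_mul_of_nonneg_left ?_ (norm_nonneg _)
    rw [norm_mul, norm_mul, norm_mul, norm_zpow, norm_zpow]
    refine mul_le_mul_of_nonneg_right ?_ (zpow_nonneg (norm_nonneg _) _)
    refine mul_le_of_le_one_left (zpow_nonneg (norm_nonneg _) _) ?_
    refine mul_le_one₀ (norm_chi0_le_one hm hχ _) (norm_nonneg _) ?_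
    rw [chi2]
    split_ifs
    · exact norm_chi0_le_one hm hχ _
    · rw [norm_zero]; exact zero_le_one
  · intro γ hγ
    refine secVal_of_not fun h => hγ ?_
    exact exists_pairMatrix h

end Convergence

/-! ### Nonzero ideals and integral finite ideles -/

section Ideals

variable {k : Type*} [Field k]

/-- The nonzero ideals of `A`. -/
abbrev NzIdeal (k : Type*) [Field k] : Type _ := {a : Ideal k[X] // a ≠ ⊥}

/-- The generator of a nonzero ideal, as an element of `F^*`. -/
def genUnit (a : NzIdeal k) : (RatFunc k)ˣ := polyUnit _ (generator_ne_zero a.2)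

lemma finGenUnit_val (a : NzIdeal k) : finGenUnit a.1 = finDiagUnit k (genUnit a) :=
  finGenUnit_eq a.2

lemma coe_finGenUnit_val (a : NzIdeal k) :
    (finGenUnit a.1 : FinAdele k) = polyFin k (Submodule.IsPrincipal.generator a.1) :=
  coe_finGenUnit a.2

lemma exists_poly_of_isFinIntegralUnit {c : (FinAdele k)ˣ} (hc : IsFinIntegral (c : FinAdele k))
    {f : (RatFunc k)ˣ} (hf : IsFinIntegralUnit ((finDiagUnit k f)⁻¹ * c)) :
    ∃ (p : k[X]) (hp : p ≠ 0), polyUnit p hp = f := by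
  have h1 : IsFinIntegral (algebraMap (RatFunc k) (FinAdele k) f) := by
    have h2 : algebraMap (RatFunc k) (FinAdele k) f =
        c * ((((finDiagUnit k f)⁻¹ * c)⁻¹ : (FinAdele k)ˣ) : FinAdele k) := by
      rw [← coe_finDiagUnit, mul_inv, inv_inv, mul_comm (finDiagUnit k f), ← Units.val_mul,
        mul_inv_cancel_left]
    rw [h2]
    exact (finIntegers k).mul_mem hc hf.2
  obtain ⟨p, hp⟩ := isFinIntegral_algebraMap_iff.mp h1
  have hp0 : p ≠ 0 := by
    rintro rfl
    rw [map_zero] at hp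
    exact f.ne_zero hp.symm
  exact ⟨p, hp0, Units.ext hp⟩

lemma exists_ideal_of_isFinIntegral {c : (FinAdele k)ˣ} (hc : IsFinIntegral (c : FinAdele k)) :
    ∃ a : NzIdeal k, IsFinIntegralUnit ((finGenUnit a.1)⁻¹ * c) := by
  obtain ⟨f, hf⟩ := exists_ratFunc_unit c
  obtain ⟨p, hp, rfl⟩ := exists_poly_of_isFinIntegralUnit hc hf
  have ha : Ideal.span {p} ≠ ⊥ := by rwa [Ne, Ideal.span_singleton_eq_bot]
  refine ⟨⟨Ideal.span {p}, ha⟩, ?_⟩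
  rw [← finDiv_eq_iff] at hf ⊢
  rw [hf, finGenUnit_eq ha]
  exact finDiv_polyUnit_of_associated (Submodule.IsPrincipal.associated_generator_span_self p).symm _ _

lemma eq_of_finDiv_finGenUnit {a b : NzIdeal k}
    (h : finDiv (finGenUnit a.1) = finDiv (finGenUnit b.1)) : a = b := by
  have key : ∀ {a b : NzIdeal k}, finDiv (finGenUnit a.1) = finDiv (finGenUnit b.1) →
      a.1 ≤ b.1 := by
    intro a b h
    rw [finDiv_eq_iff] at h
    have h1 : polyFin k (Submodule.IsPrincipal.generator a.1) =
        polyFin k (Submodule.IsPrincipal.generator b.1) *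
          (((finGenUnit b.1)⁻¹ * finGenUnit a.1 : (FinAdele k)ˣ) : FinAdele k) := by
      rw [← coe_finGenUnit_val, ← coe_finGenUnit_val, ← Units.val_mul, mul_inv_cancel_left]
    have h2 := dvd_of_polyFin_eq_mul (generator_ne_zero b.2) h.1 h1
    rw [← Ideal.span_singleton_generator a.1, ← Ideal.span_singleton_generator b.1,
      Ideal.span_singleton_le_span_singleton]
    exact h2
  exact Subtype.ext (le_antisymm (key h) (key h.symm))

end Ideals

section Cells

/-! ### The support of the Eisenstein section is a union of double cosets -/

variable {k : Type*} [Field k]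

/-- The index set of the cells. -/
abbrev CellIndex (k : Type*) [Field k] : Type _ :=
  Σ p : NzIdeal k × NzIdeal k × ℤ,
    {β : k[X] // β.degree < (Submodule.IsPrincipal.generator p.1.1).degree}

/-- The idele with finite component a generator of the ideal `a` and infinite component `T^{-N}`. -/
def cellIdele (a : NzIdeal k) (N : ℤ) : (Adele k)ˣ := ofFin (finGenUnit a.1) * ofInf (infPow k N)

/-- A representative of a cell. -/
def cellRep (i : CellIndex k) : GL2A k :=
  diagGL k (triGL 1 (genUnit i.1.2.1) 0) *
    affineGL (cellIdele i.1.1 i.1.2.2) ((polyFin k i.2.1, 0) : Adele k)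

lemma cellIdele_fst (a : NzIdeal k) (N : ℤ) :
    (cellIdele a N : Adele k).1 = (finGenUnit a.1 : FinAdele k) := by
  rw [cellIdele, Units.val_mul, Prod.fst_mul, ofFin_fst, ofInf_fst, mul_one]

lemma cellIdele_snd (a : NzIdeal k) (N : ℤ) :
    (cellIdele a N : Adele k).2 = (infPow k N : FInf k) := by
  rw [cellIdele, Units.val_mul, Prod.snd_mul, ofFin_snd, ofInf_snd, one_mul]

lemma gFin_cellRep (i : CellIndex k) : gFin k (cellRep i) =
    triGL (finGenUnit i.1.1.1) (finGenUnit i.1.2.1.1) (polyFin k i.2.1) := by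
  rw [cellRep, map_mul, gFin_diagGL, diagGLFin, gl_map_triGL, map_zero, finGenUnit_val i.1.2.1]
  apply gl_ext
  · rw [gl_mul_apply, gFin_apply, gFin_apply]
    simp [cellIdele_fst]
  · rw [gl_mul_apply, gFin_apply, gFin_apply]
    simp
  · rw [gl_mul_apply, gFin_apply, gFin_apply]
    simp
  · rw [gl_mul_apply, gFin_apply, gFin_apply]
    simp [finDiagUnit]

/-- The generator of a nonzero ideal, as an element of `F_∞^*`. -/
def genUnitInf (a : NzIdeal k) : (FInf k)ˣ :=
  Units.map (algebraMap (RatFunc k) (FInf k)).toMonoidHom (genUnit a)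

lemma gInf_cellRep (i : CellIndex k) : gInf k (cellRep i) =
    triGL (infPow k i.1.2.2) (genUnitInf i.1.2.1) 0 := by
  rw [cellRep, map_mul, gInf_diagGL, diagGLInf, gl_map_triGL, map_zero]
  apply gl_ext
  · rw [gl_mul_apply, gInf_apply, gInf_apply]
    simp [cellIdele_snd]
  · rw [gl_mul_apply, gInf_apply, gInf_apply]
    simp
  · rw [gl_mul_apply, gInf_apply, gInf_apply]
    simp
  · rw [gl_mul_apply, gInf_apply, gInf_apply]
    simp [genUnitInf]

lemma scalarGL_mul {R : Type*} [CommRing R] (z w : Rˣ) :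
    (scalarGL (z * w) : GL (Fin 2) R) = scalarGL z * scalarGL w := map_mul _ z w

lemma scalarGL_inv {R : Type*} [CommRing R] (z : Rˣ) :
    (scalarGL z⁻¹ : GL (Fin 2) R) = (scalarGL z)⁻¹ := map_inv _ z

lemma scalarGL_one {R : Type*} [CommRing R] : (scalarGL 1 : GL (Fin 2) R) = 1 :=
  map_one (Matrix.GeneralLinearGroup.scalar (Fin 2))

lemma scalarGL_inv_mul_cancel {R : Type*} [CommRing R] (z : Rˣ) (g : GL (Fin 2) R) :
    scalarGL z⁻¹ * (scalarGL z * g) = g := by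
  rw [scalarGL_inv, inv_mul_cancel_left]

/-- The group `Z(F_∞) 𝕂₀(𝔪∞)`. -/
def zk0 (m : Ideal k[X]) : Subgroup (GL2A k) where
  carrier := {g | ∃ z : (FInf k)ˣ, ∃ κ ∈ k0 m, g = scalarGL (ofInf z) * κ}
  mul_mem' := by
    rintro _ _ ⟨z, κ, hκ, rfl⟩ ⟨z', κ', hκ', rfl⟩
    refine ⟨z * z', κ * κ', mul_mem hκ hκ', ?_⟩
    have e : ofInf (z * z') = ofInf z * ofInf z' := by
      rw [ofInf, ofInf, ofInf, ← map_mul, Prod.mk_mul_mk, one_mul]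
    rw [e, scalarGL_mul, mul_assoc, mul_assoc, ← mul_assoc κ, ← scalarGL_comm, mul_assoc]
  one_mem' := ⟨1, 1, one_mem _, by
    have e : ofInf (1 : (FInf k)ˣ) = 1 := by
      rw [ofInf]; exact map_one MulEquiv.prodUnits.symm
    rw [e, scalarGL_one, mul_one]⟩
  inv_mem' := by
    rintro _ ⟨z, κ, hκ, rfl⟩
    refine ⟨z⁻¹, κ⁻¹, inv_mem hκ, ?_⟩
    have e : ofInf z⁻¹ = (ofInf z)⁻¹ := by
      rw [ofInf, ofInf, ← map_inv, Prod.inv_mk, inv_one]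
    rw [mul_inv_rev, e, scalarGL_comm, scalarGL_inv]

lemma mem_zk0_iff {m : Ideal k[X]} {g : GL2A k} :
    g ∈ zk0 m ↔ gFin k g ∈ k0Fin m ∧ ∃ z : (FInf k)ˣ, scalarGL z * gInf k g ∈ k0InfComp k := by
  constructor
  · rintro ⟨z, κ, hκ, rfl⟩
    rw [map_mul, map_mul, gFin_scalarGL_ofInf, one_mul, gInf_scalarGL_ofInf]
    refine ⟨hκ.1, z⁻¹, ?_⟩
    rw [scalarGL_inv_mul_cancel]
    exact hκ.2
  · rintro ⟨h1, z, h2⟩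
    refine ⟨z⁻¹, pairGL (gFin k g) (scalarGL z * gInf k g), mem_k0_iff.mpr ⟨?_, ?_⟩,
      gl2A_ext ?_ ?_⟩
    · rwa [gFin_pairGL]
    · rwa [gInf_pairGL]
    · rw [map_mul, gFin_scalarGL_ofInf, one_mul, gFin_pairGL]
    · rw [map_mul, gInf_scalarGL_ofInf, gInf_pairGL,
        scalarGL_inv_mul_cancel]

/-- Iwasawa decomposition makes g triangular up to a compact factor; class number one normalizes the
diagonal, and division with remainder normalizes the corner. -/
lemma exists_fin_cell {m : Ideal k[X]} (hm : m ≠ ⊥) {g : GL (Fin 2) (FinAdele k)}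
    (hint : ∀ i j, IsFinIntegral (g i j)) (hI : InIdeal m (g 1 0))
    (hu : ∃ z : (FinAdele k)ˣ, IsFinIntegralUnit z ∧ InIdeal m (g 1 1 - z)) :
    ∃ (a w : NzIdeal k) (β : k[X]), β.degree < (Submodule.IsPrincipal.generator a.1).degree ∧
      (triGL (finGenUnit a.1) (finGenUnit w.1) (polyFin k β))⁻¹ * g ∈ k0Fin m := by
  rw [exists_unit_congr_iff hm (hint 1 1)] at hu
  obtain ⟨a, d, b, κ, hκ, -, rfl, hv⟩ := exists_iwasawa g
  set g := triGL a d b * κ with hg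
  -- At a place dividing 𝔪 the lower right entry of g is a unit, so the lower left entry of κ is
  -- g₁₀/g₁₁ and has the valuation of g₁₀, which lies in 𝔪. Elsewhere 𝔪 gives no condition beyond
  -- integrality.
  have hκm : κ ∈ k0Fin m := by
    refine ⟨mem_intGL.mp hκ, mem_finIdeal.mpr ((inIdeal_iff hm).mpr fun v => ?_)⟩
    rcases lt_or_eq_of_le (v.intValuation_le_one (Submodule.IsPrincipal.generator m)) with h1 | h1
    · have h2 := hu v h1
      have h3 := (inIdeal_iff hm).mp hI v
      rw [hv, localLower, if_pos (h3.trans (h1.le.trans_eq h2.symm)), map_div₀, h2, div_one]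
      exact h3
    · rw [h1]
      exact isFinIntegral_iff.mp (mem_intGL.mp hκ 1 0).1 v
  have htri : ∀ i j, IsFinIntegral (triGL a d b i j) := by
    intro i j
    have e : triGL a d b = g * κ⁻¹ := by rw [hg, mul_inv_cancel_right]
    rw [e, gl_mul_apply]
    exact (finIntegers k).add_mem ((finIntegers k).mul_mem (hint _ _) (mem_intGL.mp hκ _ _).2)
      ((finIntegers k).mul_mem (hint _ _) (mem_intGL.mp hκ _ _).2)
  obtain ⟨I, hI⟩ := exists_ideal_of_isFinIntegral (c := a) (htri 0 0)
  obtain ⟨J, hJ⟩ := exists_ideal_of_isFinIntegral (c := d) (htri 1 1)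
  set u := (finGenUnit I.1)⁻¹ * a with hu'
  set w := (finGenUnit J.1)⁻¹ * d with hw'
  obtain ⟨β, hβ, y, hy, h⟩ := exists_poly_sub_mul (generator_ne_zero I.2)
    ((finIntegers k).mul_mem (htri 0 1) hJ.2)
  refine ⟨I, J, β, hβ, ?_⟩
  have e : g = triGL (finGenUnit I.1) (finGenUnit J.1) (polyFin k β) * (triGL u w (y * w) * κ) := by
    rw [← mul_assoc, triGL_mul, hg, hu', hw', mul_inv_cancel_left, mul_inv_cancel_left, ← hw']
    congr 2
    have h' : b * ((w⁻¹ : (FinAdele k)ˣ) : FinAdele k) = _ := h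
    rw [coe_finGenUnit_val, ← mul_assoc, ← add_mul, add_comm, ← h', Units.inv_mul_cancel_right]
  rw [e, inv_mul_cancel_left]
  exact mul_mem (triGL_mem_k0GL hI.1 hI.2 hJ.1 hJ.2 ((finIntegers k).mul_mem hy hJ.1)) hκm

lemma exists_inf_cell {g : GL (Fin 2) (FInf k)} (h1 : Valued.v (g 0 1) ≤ Valued.v (g 0 0))
    (h2 : Valued.v (g 1 0) < Valued.v (g 1 1)) (ω : (FInf k)ˣ) :
    ∃ (N : ℤ) (z : (FInf k)ˣ), scalarGL z * ((triGL (infPow k N) ω 0)⁻¹ * g) ∈ k0InfComp k := by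
  have hd : g 1 1 ≠ 0 := by
    intro h0
    rw [h0, map_zero] at h2
    exact not_lt_zero h2
  have ha : g 0 0 ≠ 0 := by
    intro h0
    have h3 : g 0 1 = 0 := by simpa [h0] using h1
    apply (Matrix.GeneralLinearGroup.det g).ne_zero
    rw [gl_det, h0, h3]; ring
  set a := Units.mk0 _ ha with haa
  set d := Units.mk0 _ hd with hdd
  set N := ordInf ((a * ω / d : (FInf k)ˣ) : FInf k) with hN
  have hva := (infPow k N).ne_zero
  have hω := ω.ne_zero
  have hvN : Valued.v (infPow k N : FInf k) = Valued.v ((a * ω / d : (FInf k)ˣ) : FInf k) := by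
    rw [valued_infPow, hN, valued_eq_exp_ordInf (Units.ne_zero _)]
  -- This scalar makes the lower right entry equal to 1; N is then forced by asking that the upper
  -- left entry be a unit.
  refine ⟨N, ω / d, ?_⟩
  have e : ∀ i j, (scalarGL (ω / d) * ((triGL (infPow k N) ω 0)⁻¹ * g)) i j =
      !![(infPow k N : FInf k)⁻¹ * (ω / g 1 1) * g 0 0, (infPow k N : FInf k)⁻¹ * (ω / g 1 1) * g 0 1;
        g 1 0 / g 1 1, 1] i j := by
    have e0 : (triGL (infPow k N) ω 0)⁻¹ = triGL (infPow k N)⁻¹ ω⁻¹ 0 := by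
      rw [inv_eq_iff_mul_eq_one, triGL_mul]
      apply gl_ext <;> simp [gl_one_apply]
    rw [e0, scalarGL_eq, ← mul_assoc, triGL_mul]
    intro i j
    rw [gl_mul_apply]
    fin_cases i <;> fin_cases j <;> simp [hdd]
    · left; ring
    · left; ring
    · field_simp
    · field_simp
  have h00 : Valued.v ((infPow k N : FInf k)⁻¹ * (ω / g 1 1) * g 0 0) = 1 := by
    have h3 : (ω : FInf k) / g 1 1 * g 0 0 = ((a * ω / d : (FInf k)ˣ) : FInf k) := by
      rw [Units.val_div_eq_div_val, Units.val_mul, haa, hdd, Units.val_mk0, Units.val_mk0]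
      ring
    rw [mul_assoc, h3, map_mul, map_inv₀, hvN, inv_mul_cancel₀]
    exact (_root_.map_ne_zero _).mpr (Units.ne_zero _)
  have h10 : Valued.v (g 1 0 / g 1 1) < 1 := by
    rw [map_div₀]
    exact (div_lt_one₀ (zero_le.trans_lt h2)).mpr h2
  have h01 : Valued.v ((infPow k N : FInf k)⁻¹ * (ω / g 1 1) * g 0 1) ≤ 1 := by
    rw [← h00, map_mul, map_mul _ _ (g 0 0)]
    exact mul_le_mul_right h1 _
  have hdet : Valued.v (Matrix.GeneralLinearGroup.det
      (scalarGL (ω / d) * ((triGL (infPow k N) ω 0)⁻¹ * g)) : FInf k) = 1 := by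
    rw [gl_det, e, e, e, e]
    change Valued.v ((infPow k N : FInf k)⁻¹ * (ω / g 1 1) * g 0 0 * 1 -
      (infPow k N : FInf k)⁻¹ * (ω / g 1 1) * g 0 1 * (g 1 0 / g 1 1)) = 1
    rw [mul_one, Valuation.map_sub_eq_of_lt_left, h00]
    rw [h00, map_mul]
    exact (mul_le_of_le_one_left' h01).trans_lt h10
  refine mem_k0GL_of_det (fun i j => ?_) (infUnit_mem hdet).2 (mem_infMaxIdeal.mpr ?_)
  · rw [e, mem_infIntegers]
    fin_cases i <;> fin_cases j
    exacts [h00.le, h01, h10.le, (map_one _).le]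
  · rw [e]
    exact h10

/-- Every element of the support of the section lies in some cell. -/
lemma exists_cell {m : Ideal k[X]} (hm : m ≠ ⊥) {χ : (FinAdele k)ˣ →* ℂˣ} {x y : ℂ} {g : GL2A k}
    (h : secVal m χ x y g ≠ 0) : ∃ i : CellIndex k, (cellRep i)⁻¹ * g ∈ zk0 m := by
  have hs : InSupport m g := by
    by_contra hc
    exact h (secVal_of_not hc)
  rw [secVal_of_inSupport hs] at h
  have h11 : chi0 m χ (g 1 1).1 ≠ 0 := by
    intro h0
    apply h
    rw [h0]; ring
  obtain ⟨a, w, β, hβ, h1⟩ := exists_fin_cell (g := gFin k g) hm hs.integral hs.ideal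
    (exists_of_chi0_ne_zero h11)
  obtain ⟨N, z, h2⟩ := exists_inf_cell (g := gInf k g) hs.top hs.bot (genUnitInf w)
  refine ⟨⟨(a, w, N), ⟨β, hβ⟩⟩, mem_zk0_iff.mpr ⟨?_, z, ?_⟩⟩
  · rwa [map_mul, map_inv, gFin_cellRep]
  · rwa [map_mul, map_inv, gInf_cellRep]

lemma finDiv_le_of_eq_mul {c d : (FinAdele k)ˣ} {e : FinAdele k} (he : IsFinIntegral e)
    (h : (c : FinAdele k) = d * e) (v : HeightOneSpectrum k[X]) : finDiv d v ≤ finDiv c v := by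
  have h1 : Valued.v ((c : FinAdele k) v) ≤ Valued.v ((d : FinAdele k) v) := by
    rw [h, finAdele_mul_apply, map_mul]
    exact mul_le_of_le_one_right' (isFinIntegral_iff.mp he v)
  rw [valued_finUnit, valued_finUnit, WithZero.exp_le_exp] at h1
  linarith

/-- The cells are disjoint. -/
lemma cell_unique {m : Ideal k[X]} {i j : CellIndex k} (h : (cellRep i)⁻¹ * cellRep j ∈ zk0 m) :
    i = j := by
  rw [mem_zk0_iff, map_mul, map_mul, map_inv, map_inv, gFin_cellRep, gFin_cellRep, gInf_cellRep,
    gInf_cellRep] at h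
  obtain ⟨⟨a, w, N⟩, β, hβ⟩ := i
  obtain ⟨⟨a', w', N'⟩, β', hβ'⟩ := j
  dsimp only at h hβ hβ'
  obtain ⟨hf, z, hi⟩ := h
  set κ := (triGL (finGenUnit a.1) (finGenUnit w.1) (polyFin k β))⁻¹ *
    triGL (finGenUnit a'.1) (finGenUnit w'.1) (polyFin k β') with hκ
  have e1 : triGL (finGenUnit a.1) (finGenUnit w.1) (polyFin k β) * κ =
      triGL (finGenUnit a'.1) (finGenUnit w'.1) (polyFin k β') := by rw [hκ, mul_inv_cancel_left]
  have e2 : triGL (finGenUnit a'.1) (finGenUnit w'.1) (polyFin k β') * κ⁻¹ =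
      triGL (finGenUnit a.1) (finGenUnit w.1) (polyFin k β) := by
    rw [← e1, mul_inv_cancel_right]
  have hent : ∀ {a w a' w' : (FinAdele k)ˣ} {b b' : FinAdele k} {κ : GL (Fin 2) (FinAdele k)},
      triGL a w b * κ = triGL a' w' b' → κ 1 0 = 0 ∧ (a' : FinAdele k) = a * κ 0 0 ∧
        (w' : FinAdele k) = w * κ 1 1 ∧ b' = a * κ 0 1 + b * κ 1 1 := by
    intro a w a' w' b b' κ e
    have h10 := congrArg (fun g : GL (Fin 2) (FinAdele k) => g 1 0) e
    have h00 := congrArg (fun g : GL (Fin 2) (FinAdele k) => g 0 0) e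
    have h11 := congrArg (fun g : GL (Fin 2) (FinAdele k) => g 1 1) e
    have h01 := congrArg (fun g : GL (Fin 2) (FinAdele k) => g 0 1) e
    simp only [gl_mul_apply, triGL_00, triGL_01, triGL_10, triGL_11, zero_mul, zero_add] at h10 h00 h11 h01
    have h : κ 1 0 = 0 := by
      rw [← Units.inv_mul_cancel_left w (κ 1 0), h10, mul_zero]
    rw [h, mul_zero, add_zero] at h00
    exact ⟨h, h00.symm, h11.symm, h01.symm⟩
  obtain ⟨-, f00, f11, f01⟩ := hent e1
  obtain ⟨-, b00, b11, -⟩ := hent e2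
  have hκ' := inv_mem hf
  -- The relations in both directions show that the diagonal entries divide each other, so the
  -- ideals agree.
  obtain rfl : a = a' := eq_of_finDiv_finGenUnit <| Finsupp.ext fun v => le_antisymm
    (finDiv_le_of_eq_mul (hf.1 0 0).1 f00 v) (finDiv_le_of_eq_mul (hκ'.1 0 0).1 b00 v)
  obtain rfl : w = w' := eq_of_finDiv_finGenUnit <| Finsupp.ext fun v => le_antisymm
    (finDiv_le_of_eq_mul (hf.1 1 1).1 f11 v) (finDiv_le_of_eq_mul (hκ'.1 1 1).1 b11 v)
  have hN : N = N' := by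
    have hinf : (triGL (infPow k N) (genUnitInf w) 0)⁻¹ * triGL (infPow k N') (genUnitInf w) 0 =
        triGL ((infPow k N)⁻¹ * infPow k N') 1 0 := by
      rw [inv_mul_eq_iff_eq_mul, triGL_mul]
      apply gl_ext <;> simp
    rw [hinf, scalarGL_eq, triGL_mul] at hi
    obtain ⟨h1, h2⟩ := valued_diag_of_mem_k0InfComp hi
    rw [triGL_00] at h1
    rw [triGL_11, mul_one] at h2
    rw [Units.val_mul, Units.val_mul, map_mul, h2, one_mul, map_mul, Units.val_inv_eq_inv_val,
      map_inv₀, valued_infPow, valued_infPow, ← WithZero.exp_neg, ← WithZero.exp_add,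
      WithZero.exp_eq_one] at h1
    linarith
  -- The two lower right entries are now the same fixed generator, not merely associated, so κ₁₁ is
  -- exactly 1 and β' - β is a multiple of the generator of 𝔞.
  have hk11 : κ 1 1 = 1 := by
    rw [← Units.inv_mul_cancel_left (finGenUnit w.1) (κ 1 1), ← f11, Units.inv_mul]
  have hβeq : β = β' := by
    have h1 : polyFin k (β' - β) = polyFin k (Submodule.IsPrincipal.generator a.1) * κ 0 1 := by
      rw [map_sub, f01, hk11, mul_one, add_sub_cancel_right, coe_finGenUnit_val]
    have h2 := dvd_of_polyFin_eq_mul (generator_ne_zero a.2) (hf.1 0 1).1 h1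
    have h3 := eq_zero_of_dvd_of_degree_lt h2 ((degree_sub_le _ _).trans_lt (max_lt hβ' hβ))
    exact (sub_eq_zero.mp h3).symm
  subst hN hβeq
  rfl

end Cells

/-! ### Countability of the index sets of the sums -/

section Countability

variable {k : Type*} [Field k]

instance countable_poly [Finite k] : Countable k[X] := by
  rw [← Set.countable_univ_iff]
  have h : (Set.univ : Set k[X]) ⊆ ⋃ n : ℕ, {p : k[X] | p.degree < n} := fun p _ =>
    Set.mem_iUnion.mpr ⟨p.natDegree + 1, degree_le_natDegree.trans_lt (by
      exact_mod_cast Nat.lt_succ_self _)⟩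
  exact (Set.countable_iUnion fun n : ℕ => (finite_degree_lt (n : WithBot ℕ)).countable).mono h

instance countable_ratFunc [Finite k] : Countable (RatFunc k) := by
  have h : Function.Injective fun a : RatFunc k => (a.num, a.denom) := by
    intro a b hab
    rw [Prod.mk.injEq] at hab
    rw [← RatFunc.num_div_denom a, ← RatFunc.num_div_denom b, hab.1, hab.2]
  exact h.countable

instance countable_gl [Finite k] : Countable (GL (Fin 2) (RatFunc k)) := by
  have h : Function.Injective fun g : GL (Fin 2) (RatFunc k) => (g 0 0, g 0 1, g 1 0, g 1 1) := by
    intro a b hab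
    simp only [Prod.mk.injEq] at hab
    exact gl_ext hab.1 hab.2.1 hab.2.2.1 hab.2.2.2
  exact h.countable

instance countable_rationalSubgroup [Finite k] : Countable (rationalSubgroup k) :=
  (MonoidHom.rangeRestrict_surjective
    ((QuotientGroup.mk' (Subgroup.center (GL2A k))).comp (diagGL k))).countable

lemma generator_injective : Function.Injective fun a : NzIdeal k =>
    (Submodule.IsPrincipal.generator a.1 : k[X]) := by
  intro a b h
  have h' : (Submodule.IsPrincipal.generator a.1 : k[X]) = Submodule.IsPrincipal.generator b.1 := h
  refine Subtype.ext ?_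
  rw [← Ideal.span_singleton_generator a.1, ← Ideal.span_singleton_generator b.1, h']

instance countable_nzIdeal [Finite k] : Countable (NzIdeal k) := generator_injective.countable

end Countability

section Fibres

/-! ### Fibres of `GL₂(F) → PGL₂(F)` in a cell -/

variable {k : Type*} [Field k]

lemma k0_le_zk0 (m : Ideal k[X]) : k0 m ≤ zk0 m := fun κ hκ => ⟨1, κ, hκ, by
  have e : ofInf (1 : (FInf k)ˣ) = 1 := by
    rw [ofInf]; exact map_one MulEquiv.prodUnits.symm
  rw [e, scalarGL_one, one_mul]⟩

lemma scalarGL_ofInf_mem_zk0 (m : Ideal k[X]) (z : (FInf k)ˣ) : scalarGL (ofInf z) ∈ zk0 m :=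
  ⟨z, 1, one_mem _, (mul_one _).symm⟩

lemma mk_scalarGL (z : (Adele k)ˣ) : (QuotientGroup.mk (scalarGL z) : PGL2A k) = 1 :=
  (QuotientGroup.eq_one_iff _).mpr (scalarGL_mem_center z)

/-- Every idele is a product of elements of F^*, 𝒪_f^* and F_∞^*. The last two already lie in
Z(F_∞)𝕂₀(𝔪∞), so the centre of GL₂(𝔸) costs only a rational scalar. -/
lemma mem_k0Bar_iff {m : Ideal k[X]} {g : GL2A k} : (QuotientGroup.mk g : PGL2A k) ∈ k0Bar m ↔
    ∃ a : (RatFunc k)ˣ, diagGL k (scalarGL a) * g ∈ zk0 m := by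
  constructor
  · rintro ⟨κ, hκ, h⟩
    have h2 : (κ : PGL2A k) = (g : PGL2A k) := h
    rw [QuotientGroup.eq] at h2
    obtain ⟨z, hz⟩ := mem_center_iff.mp h2
    obtain ⟨a, u, w, hu, rfl⟩ := exists_idele_factorization z
    refine ⟨a⁻¹, ?_⟩
    have e : g = κ * scalarGL (diagUnit k a * ofFin u * ofInf w) := by
      rw [hz, mul_inv_cancel_left]
    rw [e, scalarGL_mul, scalarGL_mul, scalarGL_inv, map_inv, diagGL_scalarGL, mul_assoc _ _ (scalarGL (ofInf w)),
      ← mul_assoc κ, ← scalarGL_comm, mul_assoc _ κ, inv_mul_cancel_left]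
    exact mul_mem (k0_le_zk0 m hκ) (mul_mem (k0_le_zk0 m (scalarGL_ofFin_mem_k0 hu m))
      (scalarGL_ofInf_mem_zk0 m w))
  · rintro ⟨a, z, κ, hκ, h⟩
    refine ⟨κ, hκ, ?_⟩
    have h2 := congrArg (QuotientGroup.mk : GL2A k → PGL2A k) h
    rw [QuotientGroup.mk_mul, QuotientGroup.mk_mul, diagGL_scalarGL, mk_scalarGL, mk_scalarGL,
      one_mul, one_mul] at h2
    exact h2.symm

/-- The component at infinity is free, being a scalar there; at the finite places the condition is
F^* ∩ 𝒪_f^* = k^*. -/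
lemma diagGL_scalarGL_mem_zk0_iff {m : Ideal k[X]} {a : (RatFunc k)ˣ} :
    diagGL k (scalarGL a) ∈ zk0 m ↔ ∃ c, constUnit k c = a := by
  rw [← isFinIntegralUnit_finDiagUnit_iff]
  have e : gFin k (diagGL k (scalarGL a)) = triGL (finDiagUnit k a) (finDiagUnit k a) 0 := by
    rw [gFin_diagGL, diagGLFin, scalarGL_eq, gl_map_triGL, map_zero]
    rfl
  constructor
  · intro h
    have h1 := (mem_zk0_iff.mp h).1
    rw [e] at h1
    refine ⟨(h1.1 0 0).1, ?_⟩
    have h2 := (h1.1 0 0).2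
    rw [← scalarGL_eq, ← scalarGL_inv, scalarGL_eq] at h2
    exact h2
  · intro h
    refine mem_zk0_iff.mpr ⟨?_, (Units.map (algebraMap (RatFunc k) (FInf k)).toMonoidHom a)⁻¹, ?_⟩
    · rw [e]
      exact triGL_mem_k0GL h.1 h.2 h.1 h.2 (finIntegers k).zero_mem
    · have e2 : gInf k (diagGL k (scalarGL a)) =
          scalarGL (Units.map (algebraMap (RatFunc k) (FInf k)).toMonoidHom a) := by
        rw [gInf_diagGL, diagGLInf, scalarGL_eq, gl_map_triGL, map_zero, scalarGL_eq]
      rw [e2, scalarGL_inv, inv_mul_cancel]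
      exact one_mem _

lemma diagGL_injective : Function.Injective (diagGL k) := by
  intro g h e
  have hinj : Function.Injective (algebraMap (RatFunc k) (Adele k)) := RingHom.injective _
  have key : ∀ i j, g i j = h i j := fun i j =>
    hinj (congrArg (fun x : GL2A k => x i j) e)
  exact gl_ext (key _ _) (key _ _) (key _ _) (key _ _)

/-- The element of the image of `GL₂(F)` attached to a matrix. -/
def ratMk (γ : GL (Fin 2) (RatFunc k)) : rationalSubgroup k :=
  ⟨QuotientGroup.mk (diagGL k γ), γ, rfl⟩

lemma ratMk_surjective : Function.Surjective (ratMk (k := k)) := by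
  rintro ⟨_, γ, rfl⟩
  exact ⟨γ, rfl⟩

lemma exists_scalar_of_ratMk_eq {γ γ' : GL (Fin 2) (RatFunc k)} (h : ratMk γ = ratMk γ') :
    ∃ a : (RatFunc k)ˣ, γ = scalarGL a * γ' := by
  have h1 : (QuotientGroup.mk (diagGL k γ') : PGL2A k) = QuotientGroup.mk (diagGL k γ) :=
    (congrArg Subtype.val h).symm
  rw [QuotientGroup.eq, ← map_inv, ← map_mul] at h1
  have h2 : γ'⁻¹ * γ ∈ Subgroup.center (GL (Fin 2) (RatFunc k)) := by
    rw [Subgroup.mem_center_iff] at h1 ⊢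
    intro g
    apply diagGL_injective
    exact (map_mul _ g _).trans ((h1 _).trans (map_mul _ _ g).symm)
  obtain ⟨a, ha⟩ := mem_center_iff.mp h2
  refine ⟨a, ?_⟩
  rw [scalarGL_comm, ha, mul_inv_cancel_left]

lemma ratMk_scalarGL_mul (a : (RatFunc k)ˣ) (γ : GL (Fin 2) (RatFunc k)) :
    ratMk (scalarGL a * γ) = ratMk γ := by
  refine Subtype.ext ?_
  change (QuotientGroup.mk (diagGL k _) : PGL2A k) = QuotientGroup.mk (diagGL k γ)
  rw [map_mul, QuotientGroup.mk_mul, diagGL_scalarGL, mk_scalarGL, one_mul]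

/-- The pairs of a cell and a matrix in `GL₂(F)` that moves `g` into that cell. -/
abbrev CellPairs (m : Ideal k[X]) (g : GL2A k) : Type _ :=
  {t : CellIndex k × GL (Fin 2) (RatFunc k) // (cellRep t.1)⁻¹ * (diagGL k t.2 * g) ∈ zk0 m}

/-- The translate by an element of `PGL₂(F)` of the image of a cell in `PGL₂(𝔸)`. -/
def cellSet (m : Ideal k[X]) (t : CellIndex k × rationalSubgroup k) : Set (PGL2A k) :=
  {p | (QuotientGroup.mk (cellRep t.1) : PGL2A k)⁻¹ * (t.2 * p) ∈ k0Bar m}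

/-- The pairs of a cell and a class in `PGL₂(F)` that moves the class `p` into that cell. -/
abbrev CellPairsBar (m : Ideal k[X]) (p : PGL2A k) : Type _ :=
  {t : CellIndex k × rationalSubgroup k // p ∈ cellSet m t}

lemma exists_cellPairs_lift {m : Ideal k[X]} {g : GL2A k}
    (t : CellPairsBar m (QuotientGroup.mk g : PGL2A k)) :
    ∃ γ : GL (Fin 2) (RatFunc k), ratMk γ = t.1.2 ∧
      (cellRep t.1.1)⁻¹ * (diagGL k γ * g) ∈ zk0 m := by
  obtain ⟨⟨i, δ⟩, h⟩ := t
  obtain ⟨γ, rfl⟩ := ratMk_surjective δ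
  have h1 : (QuotientGroup.mk ((cellRep i)⁻¹ * (diagGL k γ * g)) : PGL2A k) ∈ k0Bar m := h
  obtain ⟨a, ha⟩ := mem_k0Bar_iff.mp h1
  refine ⟨scalarGL a * γ, ratMk_scalarGL_mul a γ, ?_⟩
  rw [map_mul, mul_assoc, ← mul_assoc _ (diagGL k (scalarGL a)), diagGL_scalarGL, ← scalarGL_comm,
    mul_assoc, ← diagGL_scalarGL]
  exact ha

lemma cellPairs_scalar {m : Ideal k[X]} {g : GL2A k} {i : CellIndex k}
    {γ : GL (Fin 2) (RatFunc k)} (h : (cellRep i)⁻¹ * (diagGL k γ * g) ∈ zk0 m) (a : (RatFunc k)ˣ) :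
    (cellRep i)⁻¹ * (diagGL k (scalarGL a * γ) * g) ∈ zk0 m ↔ ∃ c, constUnit k c = a := by
  rw [← diagGL_scalarGL_mem_zk0_iff (m := m), map_mul, mul_assoc, ← mul_assoc _ (diagGL k (scalarGL a)),
    diagGL_scalarGL, ← scalarGL_comm, mul_assoc]
  exact Subgroup.mul_mem_cancel_right _ h

/-- The fibres of `GL₂(F) → PGL₂(F)` in a cell are torsors under `k^*`. -/
def cellPairsEquiv (m : Ideal k[X]) (g : GL2A k) :
    CellPairsBar m (QuotientGroup.mk g : PGL2A k) × kˣ ≃ CellPairs m g := by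
  -- One lift s of each class is fixed; the other lifts landing in the same cell are its multiples
  -- by constants.
  choose s hs1 hs2 using fun t => exists_cellPairs_lift (m := m) (g := g) t
  refine Equiv.ofBijective (fun t => ⟨(t.1.1.1, scalarGL (constUnit k t.2) * s t.1),
    (cellPairs_scalar (hs2 t.1) _).mpr ⟨t.2, rfl⟩⟩) ⟨?_, ?_⟩
  · rintro ⟨t, c⟩ ⟨t', c'⟩ h
    have h' := congrArg Subtype.val h
    dsimp only at h'
    rw [Prod.mk.injEq] at h'
    have ht : t = t' := by
      refine Subtype.ext (Prod.ext h'.1 ?_)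
      rw [← hs1 t, ← hs1 t', ← ratMk_scalarGL_mul (constUnit k c) (s t), h'.2, ratMk_scalarGL_mul]
    subst ht
    have h2 := mul_right_cancel h'.2
    have h3 : constUnit k c = constUnit k c' := by
      have := congrArg (fun x : GL (Fin 2) (RatFunc k) => x 0 0) h2
      rw [scalarGL_eq, scalarGL_eq] at this
      exact Units.ext this
    rw [constUnit_injective h3]
  · rintro ⟨⟨i, γ⟩, h⟩
    have hb : (QuotientGroup.mk (cellRep i) : PGL2A k)⁻¹ *
        (ratMk γ * (QuotientGroup.mk g : PGL2A k)) ∈ k0Bar m :=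
      mem_k0Bar_iff.mpr ⟨1, by rw [scalarGL_one, map_one, one_mul]; exact h⟩
    let t : CellPairsBar m (QuotientGroup.mk g : PGL2A k) := ⟨(i, ratMk γ), hb⟩
    obtain ⟨a, ha⟩ := exists_scalar_of_ratMk_eq (hs1 t).symm
    have h2 : (cellRep i)⁻¹ * (diagGL k (scalarGL a * s t) * g) ∈ zk0 m := ha ▸ h
    obtain ⟨c, rfl⟩ := (cellPairs_scalar (hs2 t) a).mp h2
    exact ⟨(t, c), Subtype.ext (Prod.ext rfl ha.symm)⟩

lemma cellPairsEquiv_fst (m : Ideal k[X]) (g : GL2A k)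
    (t : CellPairsBar m (QuotientGroup.mk g : PGL2A k) × kˣ) :
    (cellPairsEquiv m g t).1.1 = t.1.1.1 := rfl

/-- Since the cells are disjoint and cover the support of Ψ, every γ with Ψ(γg) ≠ 0 belongs to
exactly one cell, on which Ψ equals its value at the representative. -/
lemma hasSum_cellPairs {m : Ideal k[X]} {Ψ : GL2A k → ℂ}
    (hΨ : ∀ g, ∀ κ ∈ zk0 m, Ψ (g * κ) = Ψ g)
    (hsupp : ∀ g, Ψ g ≠ 0 → ∃ i : CellIndex k, (cellRep i)⁻¹ * g ∈ zk0 m) {g : GL2A k}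
    (hs : Summable fun γ => Ψ (diagGL k γ * g)) :
    HasSum (fun t : CellPairs m g => Ψ (cellRep t.1.1)) (∑' γ, Ψ (diagGL k γ * g)) := by
  let f : CellPairs m g → GL (Fin 2) (RatFunc k) := fun t => t.1.2
  have hinj : Function.Injective f := by
    rintro ⟨⟨i, γ⟩, h⟩ ⟨⟨j, γ'⟩, h'⟩ e
    obtain rfl : γ = γ' := e
    have h2 := mul_mem h (inv_mem h')
    rw [mul_inv_rev, inv_inv, mul_assoc, mul_inv_cancel_left] at h2
    obtain rfl := cell_unique h2
    rfl
  have h2 := (hinj.hasSum_iff (f := fun γ => Ψ (diagGL k γ * g)) (a := ∑' γ, Ψ (diagGL k γ * g))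
    (fun γ hγ => by
      by_contra hne
      obtain ⟨i, hi⟩ := hsupp _ hne
      exact hγ ⟨⟨(i, γ), hi⟩, rfl⟩)).mpr hs.hasSum
  have e : (fun t : CellPairs m g => Ψ (cellRep t.1.1)) = (fun γ => Ψ (diagGL k γ * g)) ∘ f := by
    funext t
    rw [Function.comp_apply, ← hΨ (cellRep t.1.1) _ t.2, mul_inv_cancel_left]
  rw [e]
  exact h2

lemma hasSum_prod_const {T K : Type*} [Finite K] {C : T → ℂ} {a : ℂ}
    (h : HasSum (fun t : T × K => C t.1) a) : HasSum (fun t => (Nat.card K : ℂ) * C t) a := by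
  have := Fintype.ofFinite K
  refine h.prod_fiberwise fun t => ?_
  have h4 := hasSum_fintype fun _ : K => C t
  rwa [Finset.sum_const, Finset.card_univ, nsmul_eq_mul, ← Nat.card_eq_fintype_card] at h4

lemma hasSum_indicator_of_subtype {T P : Type*} {S : T → Set P} {p : P} {C : T → ℂ} {a : ℂ}
    (h : HasSum (fun t : {t // p ∈ S t} => C t.1) a) :
    HasSum (fun t => (S t).indicator (fun _ => C t) p) a := by
  classical
  have h4 := (hasSum_subtype_iff_indicator (s := {t | p ∈ S t}) (f := C)).mp h
  refine h4.congr_fun fun t => ?_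
  simp only [Set.indicator_apply, Set.mem_ofPred_eq]

/-- Unfolding of a sum over `GL₂(F)`. -/
lemma hasSum_unfold [Finite k] {m : Ideal k[X]} {Ψ : GL2A k → ℂ}
    (hΨ : ∀ g, ∀ κ ∈ zk0 m, Ψ (g * κ) = Ψ g)
    (hsupp : ∀ g, Ψ g ≠ 0 → ∃ i : CellIndex k, (cellRep i)⁻¹ * g ∈ zk0 m) {g : GL2A k}
    (hs : Summable fun γ => Ψ (diagGL k γ * g)) :
    HasSum (fun t => (cellSet m t).indicator
      (fun _ => (Nat.card kˣ : ℂ) * Ψ (cellRep t.1)) (QuotientGroup.mk g))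
      (∑' γ, Ψ (diagGL k γ * g)) := by
  have e : (fun t : CellPairs m g => Ψ (cellRep t.1.1)) ∘ cellPairsEquiv m g =
      fun t : CellPairsBar m (QuotientGroup.mk g) × kˣ => Ψ (cellRep t.1.1.1) := by
    funext t
    rw [Function.comp_apply, cellPairsEquiv_fst]
  have h1 := hasSum_cellPairs hΨ hsupp hs
  rw [← (cellPairsEquiv m g).hasSum_iff, e] at h1
  have h3 := hasSum_prod_const (T := CellPairsBar m (QuotientGroup.mk g)) (K := kˣ)
    (C := fun t => Ψ (cellRep t.1.1)) h1
  exact hasSum_indicator_of_subtype h3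

end Fibres

/-! ### Termwise integration of series of indicator functions -/

section IntegralOfSeries

open scoped ENNReal

variable {T P : Type*} [MeasurableSpace P] {ν : Measure P} [Countable T] {S : T → Set P} {C : T → ℂ}
  {f : P → ℂ}

/-- The total mass of the absolute values is finite, so Tonelli bounds the integral of |f| and
dominated convergence allows termwise integration. -/
lemma integrable_of_hasSum_indicator (hS : ∀ t, MeasurableSet (S t))
    (hsum : ∑' t, ‖C t‖ₑ * ν (S t) ≠ ∞)
    (hf : ∀ p, HasSum (fun t => (S t).indicator (fun _ => C t) p) (f p)) :
    Integrable f ν ∧ HasSum (fun t => (ν.real (S t) : ℂ) * C t) (∫ p, f p ∂ν) := by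
  set F : T → P → ℂ := fun t => (S t).indicator fun _ => C t with hF
  have hmeas : ∀ t, AEStronglyMeasurable (F t) ν := fun t =>
    aestronglyMeasurable_const.indicator (hS t)
  have hlint : ∀ t, ∫⁻ p, ‖F t p‖ₑ ∂ν = ‖C t‖ₑ * ν (S t) := by
    intro t
    simp only [hF, enorm_indicator_eq_indicator_enorm]
    rw [lintegral_indicator_const (hS t)]
  have hfe : f = fun p => ∑' t, F t p := funext fun p => (hf p).tsum_eq.symm
  have htsum : ∑' t, ∫⁻ p, ‖F t p‖ₑ ∂ν ≠ ∞ := by simpa only [hlint] using hsum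
  have hfm : AEStronglyMeasurable f ν := by
    refine aestronglyMeasurable_of_tendsto_ae (Filter.atTop : Filter (Finset T))
      (f := fun s p => ∑ t ∈ s, F t p) (fun s => ?_) (Filter.Eventually.of_forall fun p => ?_)
    · exact Finset.aestronglyMeasurable_fun_sum s fun t _ => hmeas t
    · have := hf p
      rwa [HasSum, SummationFilter.unconditional_filter] at this
  refine ⟨⟨hfm, ?_⟩, ?_⟩
  · rw [HasFiniteIntegral]
    refine lt_of_le_of_lt ?_ htsum.lt_top
    rw [← lintegral_tsum fun t => (hmeas t).enorm]
    refine lintegral_mono fun p => ?_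
    rw [hfe]
    exact enorm_tsum_le_tsum_enorm
  · have h1 : ∀ t, ∫ p, F t p ∂ν = (ν.real (S t) : ℂ) * C t := fun t =>
      (integral_indicator_const (C t) (hS t)).trans Complex.real_smul
    rw [hfe, integral_tsum hmeas htsum]
    simp only [h1]
    refine (Summable.of_norm ?_).hasSum
    refine (ENNReal.summable_toReal hsum).congr fun t => ?_
    rw [norm_mul, ENNReal.toReal_mul, toReal_enorm, mul_comm, Measure.real, Complex.norm_real,
      Real.norm_of_nonneg ENNReal.toReal_nonneg]

lemma hasSum_fiberwise_mul {I D : Type*} {r : I × D → ℝ} {c : ℝ} {C : I → ℂ} {a : ℂ}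
    (h : HasSum (fun t => (r t : ℂ) * C t.1) a) (hr : ∀ i, HasSum (fun δ => r (i, δ)) c) :
    HasSum (fun i => (c : ℂ) * C i) a :=
  HasSum.prod_fiberwise (f := fun t => (r t : ℂ) * C t.1) (g := fun i => (c : ℂ) * C i) h
    fun i => HasSum.mul_right (C i) (Complex.hasSum_ofReal.mpr (hr i))

lemma tsum_prod_enorm_ne_top {I D : Type*} {S : I × D → Set P} {C : I → ℂ} (hC : Summable C)
    {c : ℝ≥0∞} (hc : c ≠ ∞) (hts : ∀ i, ∑' δ, ν (S (i, δ)) = c) :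
    ∑' t : I × D, ‖C t.1‖ₑ * ν (S t) ≠ ∞ := by
  rw [ENNReal.tsum_prod']
  simp only [ENNReal.tsum_mul_left, hts]
  rw [ENNReal.tsum_mul_right]
  refine ENNReal.mul_ne_top ?_ hc
  exact ENNReal.tsum_coe_ne_top_iff_summable.mpr (NNReal.summable_coe.mp hC.norm)

lemma hasSum_real_measure {D : Type*} {S : D → Set P} {c : ℝ≥0∞} (hc : c ≠ ∞)
    (hts : ∑' δ, ν (S δ) = c) : HasSum (fun δ => ν.real (S δ)) c.toReal := by
  have hne : ∀ δ, ν (S δ) ≠ ∞ := fun δ => by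
    refine ne_top_of_le_ne_top hc ?_
    rw [← hts]
    exact ENNReal.le_tsum δ
  have h4 := (ENNReal.summable_toReal (f := fun δ => ν (S δ)) (by rw [hts]; exact hc)).hasSum
  rw [← ENNReal.tsum_toReal_eq hne, hts] at h4
  exact h4

/-- The form needed for unfolding: the coefficient depends on the cell only, and the translates of
each cell have the same total measure c. -/
lemma integrable_of_hasSum_fiberwise {I D : Type*} [Countable I] [Countable D] {S : I × D → Set P}
    (hS : ∀ t, MeasurableSet (S t)) {C : I → ℂ} (hC : Summable C) {c : ℝ≥0∞} (hc : c ≠ ∞)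
    (hts : ∀ i, ∑' δ, ν (S (i, δ)) = c)
    (hf : ∀ p, HasSum (fun t => (S t).indicator (fun _ => C t.1) p) (f p)) :
    Integrable f ν ∧ HasSum (fun i => (c.toReal : ℂ) * C i) (∫ p, f p ∂ν) := by
  obtain ⟨h1, h2⟩ := integrable_of_hasSum_indicator (ν := ν) (S := S)
    (C := fun t : I × D => C t.1) hS (tsum_prod_enorm_ne_top hC hc hts) hf
  exact ⟨h1, hasSum_fiberwise_mul h2 fun i => hasSum_real_measure (S := fun δ => S (i, δ)) hc (hts i)⟩

end IntegralOfSeries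

/-- Through p the nonzero terms of F become part of a family over S × Γ, which converges absolutely
because S is finite and each slice does. -/
lemma summable_of_injective_prod {I S Γ : Type*} [Finite S] {A : S → ℂ} {B : S → Γ → ℂ}
    (hB : ∀ s, Summable (B s)) {F : I → ℂ} {Z : I → Prop} (hZ : ∀ i, ¬ Z i → F i = 0)
    {p : {i // Z i} → S × Γ} (hp : Function.Injective p)
    (hval : ∀ i : {i // Z i}, F i = A (p i).1 * B (p i).1 (p i).2) : Summable F := by
  have h1 : Summable fun x : S × Γ => ‖A x.1 * B x.1 x.2‖ :=
    (summable_prod_of_nonneg (f := fun x : S × Γ => ‖A x.1 * B x.1 x.2‖)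
      (fun x => norm_nonneg (A x.1 * B x.1 x.2))).mpr
      ⟨fun x => ((hB x).mul_left (A x)).norm, Summable.of_finite⟩
  have h2 : Summable fun i => A (p i).1 * B (p i).1 (p i).2 :=
    Summable.of_norm (h1.comp_injective hp)
  rw [← (Subtype.val_injective (p := Z)).summable_iff]
  · exact h2.congr fun i => (hval i).symm
  · intro i hi
    exact hZ i fun hz => hi ⟨⟨i, hz⟩, rfl⟩

/-! ### Unfolding over a fundamental domain -/

section Unfolding

open scoped ENNReal Pointwise

variable {k : Type*} [Field k]

lemma cellSet_eq (m : Ideal k[X]) (i : CellIndex k) (δ : rationalSubgroup k) :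
    cellSet m (i, δ) = δ⁻¹ • {x | (QuotientGroup.mk (cellRep i) : PGL2A k)⁻¹ * x ∈ k0Bar m} := by
  ext p
  rw [Set.mem_smul_set_iff_inv_smul_mem, inv_inv]
  rfl

lemma measurableSet_cellSet {m : Ideal k[X]} (hm : m ≠ ⊥) (t : CellIndex k × rationalSubgroup k) :
    MeasurableSet (cellSet m t) := by
  have h := isOpen_coset hm ((t.2 : PGL2A k)⁻¹ * (QuotientGroup.mk (cellRep t.1) : PGL2A k))
  have e : cellSet m t = {x | ((t.2 : PGL2A k)⁻¹ * (QuotientGroup.mk (cellRep t.1) : PGL2A k))⁻¹ * x ∈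
      k0Bar m} := by
    ext x
    rw [mul_inv_rev, inv_inv, Set.mem_ofPred_eq, mul_assoc]
    rfl
  rw [e]
  exact h.measurableSet

/-- The rational translates of the fundamental domain tile PGL₂(𝔸), so the pieces add up to one full
coset, and left invariance gives the measure of the subgroup. -/
lemma tsum_measure_cellSet [Finite k] (μG : Measure (PGL2A k)) [μG.IsHaarMeasure]
    {𝓕 : Set (PGL2A k)} (h𝓕 : IsFundamentalDomain (rationalSubgroup k) 𝓕 μG) {m : Ideal k[X]}
    (hm : m ≠ ⊥) (i : CellIndex k) :
    ∑' δ, μG.restrict 𝓕 (cellSet m (i, δ)) = μG (k0Bar m) := by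
  rw [← measure_coset μG m (QuotientGroup.mk (cellRep i) : PGL2A k), h𝓕.measure_eq_tsum,
    ← (Equiv.inv _).tsum_eq]
  refine tsum_congr fun δ => ?_
  rw [Measure.restrict_apply (measurableSet_cellSet hm _), cellSet_eq, Equiv.inv_apply, inv_inv]

lemma integral_unfold [Finite k] (μG : Measure (PGL2A k)) [μG.IsHaarMeasure]
    (hμ1 : μG ((QuotientGroup.mk : GL2A k → PGL2A k) '' GL2O k) = 1)
    {𝓕 : Set (PGL2A k)} (h𝓕 : IsFundamentalDomain (rationalSubgroup k) 𝓕 μG) {m : Ideal k[X]}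
    (hm : m ≠ ⊥) {C : CellIndex k → ℂ} (hC : Summable C) {f : PGL2A k → ℂ}
    (hf : ∀ p, HasSum (fun t => (cellSet m t).indicator (fun _ => C t.1) p) (f p)) :
    Integrable f (μG.restrict 𝓕) ∧
      HasSum (fun i => (μG.real (k0Bar m) : ℂ) * C i) (∫ p in 𝓕, f p ∂μG) := by
  have hK : μG (k0Bar m) ≠ ∞ :=
    ne_top_of_le_ne_top ENNReal.one_ne_top (measure_k0Bar_le μG hμ1 m)
  exact integrable_of_hasSum_fiberwise (ν := μG.restrict 𝓕) (measurableSet_cellSet hm) hC hK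
    (tsum_measure_cellSet μG h𝓕 hm) hf

/-- Absolute convergence over the cells of the product of a section and of a function with finite
support modulo `GL₂(F)`. -/
lemma summable_cells {m : Ideal k[X]} {Ψ φ : GL2A k → ℂ}
    (hΨ : ∀ g, ∀ κ ∈ zk0 m, Ψ (g * κ) = Ψ g) (hφ : ∀ g, ∀ κ ∈ zk0 m, φ (g * κ) = φ g)
    (hφl : ∀ γ g, φ (diagGL k γ * g) = φ g) {S : Set (GL2A k)} (hS : S.Finite)
    (hsupp : ∀ g, φ g ≠ 0 → ∃ γ, ∃ s ∈ S, (diagGL k γ * s)⁻¹ * g ∈ zk0 m)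
    (hsum : ∀ g, Summable fun γ => Ψ (diagGL k γ * g)) :
    Summable fun i => φ (cellRep i) * Ψ (cellRep i) := by
  have hfin : Finite S := hS
  -- A cell on which φ does not vanish contains some γs with s in the finite set S. The pair (s, γ)
  -- determines the cell, and the term equals φ(s)Ψ(γs).
  choose γ s hs h using fun i : {i : CellIndex k // φ (cellRep i) ≠ 0} => hsupp _ i.2
  let p : {i : CellIndex k // φ (cellRep i) ≠ 0} → S × GL (Fin 2) (RatFunc k) :=
    fun i => (⟨s i, hs i⟩, γ i)
  have hp : Function.Injective p := by
    intro i j hij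
    have h1 : s i = s j := congrArg (fun x => x.1.1) hij
    have h2 : γ i = γ j := congrArg (fun x => x.2) hij
    have h3 := mul_mem (inv_mem (h i)) (h j)
    rw [h1, h2, mul_inv_rev, inv_inv, mul_assoc, mul_inv_cancel_left] at h3
    exact Subtype.ext (cell_unique h3)
  have hval : ∀ i : {i : CellIndex k // φ (cellRep i) ≠ 0}, φ (cellRep i) * Ψ (cellRep i) =
      φ (s i) * Ψ (diagGL k (γ i) * s i) := by
    intro i
    have e : cellRep i.1 = diagGL k (γ i) * s i * ((diagGL k (γ i) * s i)⁻¹ * cellRep i.1) := by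
      rw [mul_inv_cancel_left]
    rw [e, hΨ _ _ (h i), hφ _ _ (h i), hφl]
  exact summable_of_injective_prod (A := fun s : S => φ s)
    (B := fun (s : S) γ => Ψ (diagGL k γ * s)) (F := fun i => φ (cellRep i) * Ψ (cellRep i))
    (fun s => hsum s) (fun i hi => by rw [not_not.mp hi, zero_mul]) hp hval

/-- The rational part of the central element is moved into γ; the other two parts lie in
Z(F_∞)𝕂₀(𝔪∞). -/
lemma exists_zk0_of_center {m : Ideal k[X]} {g s z κ : GL2A k} {γ : GL (Fin 2) (RatFunc k)}
    (hz : z ∈ Subgroup.center (GL2A k)) (hκ : κ ∈ k0 m) (h : g = diagGL k γ * s * z * κ) :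
    ∃ γ', (diagGL k γ' * s)⁻¹ * g ∈ zk0 m := by
  obtain ⟨z, rfl⟩ := mem_center_iff.mp hz
  obtain ⟨a, u, w, hu, rfl⟩ := exists_idele_factorization z
  refine ⟨scalarGL a * γ, ?_⟩
  have e : g = diagGL k (scalarGL a * γ) * s * (scalarGL (ofFin u) * scalarGL (ofInf w) * κ) := by
    rw [h, scalarGL_mul, scalarGL_mul, map_mul, diagGL_scalarGL, mul_assoc (scalarGL (diagUnit k a)),
      ← mul_assoc _ (scalarGL (diagUnit k a)), ← scalarGL_comm]
    simp only [mul_assoc]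
  rw [e, inv_mul_cancel_left]
  exact mul_mem (mul_mem (k0_le_zk0 m (scalarGL_ofFin_mem_k0 hu m)) (scalarGL_ofInf_mem_zk0 m w))
    (k0_le_zk0 m hκ)

variable {G : Type*} [CommGroup G]

lemma secVal_mul_zk0 {m : Ideal k[X]} (hm : m ≠ ⊥) {χ : (FinAdele k)ˣ →* ℂˣ}
    (hχ : IsDirichletCharacter m χ) {x y : ℂ} (hx : x ≠ 0) (hy : y ≠ 0) (g κ : GL2A k)
    (hκ : κ ∈ zk0 m) : secVal m χ x y (g * κ) = secVal m χ x y g := by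
  obtain ⟨z, κ, hκ, rfl⟩ := hκ
  rw [← mul_assoc, secVal_mul_k0 hm hχ hκ, secVal_mul_inf hx hy]

lemma secCoeff_mul_zk0 {m : Ideal k[X]} (hm : m ≠ ⊥) {χ : (FinAdele k)ˣ →* ℂˣ}
    (hχ : IsDirichletCharacter m χ) {pr : (Adele k)ˣ →* G} (hpr : IsFiniteQuotient pr) {x y : ℂ}
    (hx : x ≠ 0) (hy : y ≠ 0) (h : G) (g κ : GL2A k) (hκ : κ ∈ zk0 m) :
    secCoeff m χ pr x y h (g * κ) = secCoeff m χ pr x y h g := by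
  obtain ⟨z, κ, hκ, rfl⟩ := hκ
  rw [← mul_assoc, secCoeff_mul_k0 hm hχ hpr h hκ, secCoeff_mul_inf hx hy]

lemma IsAutomorphicForm.mul_zk0 {m n : Ideal k[X]} (hnm : n ∣ m) {φ : GL2A k → ℚ}
    (hφ : IsAutomorphicForm n φ) (g κ : GL2A k) (hκ : κ ∈ zk0 m) : φ (g * κ) = φ g := by
  obtain ⟨z, κ, hκ, rfl⟩ := hκ
  rw [← mul_assoc, hφ.right_invariant _ κ, hφ.central _ _ (scalarGL_mem_center _)]
  rw [← coe_k0]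
  exact k0_mono hnm hκ

/-- The integral of the product of the Eisenstein series and the form, as a sum over the cells. -/
lemma hasSum_integrand [Finite k] [Finite G] {m n : Ideal k[X]} (hm : m ≠ ⊥) (hnm : n ∣ m)
    {χ : (FinAdele k)ˣ →* ℂˣ} (hχ : IsDirichletCharacter m χ) {pr : (Adele k)ˣ →* G}
    (hpr : IsFiniteQuotient pr) {φ : GL2A k → ℚ} (hφ : IsAutomorphicForm n φ) (hc : IsCuspidal φ)
    (μG : Measure (PGL2A k)) [μG.IsHaarMeasure]
    (hμ1 : μG ((QuotientGroup.mk : GL2A k → PGL2A k) '' GL2O k) = 1)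
    {𝓕 : Set (PGL2A k)} (h𝓕 : IsFundamentalDomain (rationalSubgroup k) 𝓕 μG) {x y : ℂ} (hx : x ≠ 0)
    (hy : y ≠ 0) (hqx : Nat.card k * ‖x‖ < 1) (hqy : Nat.card k * ‖y‖ < 1) (h : G) :
    (Summable fun i => (φ (cellRep i) : ℂ) * secVal m χ x y (cellRep i)) ∧
    Integrable (fun p => (integrand m χ pr φ x y p).coeff h) (μG.restrict 𝓕) ∧
      HasSum (fun i => (μG.real (k0Bar m) : ℂ) *
        ((Nat.card kˣ : ℂ) * ((φ (cellRep i) : ℂ) * secCoeff m χ pr x y h (cellRep i))))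
        (∫ p in 𝓕, (integrand m χ pr φ x y p).coeff h ∂μG) := by
  have hn : n ≠ ⊥ := by
    rintro rfl
    exact hm (zero_dvd_iff.mp hnm)
  obtain ⟨S, hS, hsupp⟩ := exists_finite_support μG hμ1 hm hn hφ hc
  have hφz : ∀ g, ∀ κ ∈ zk0 m, (φ (g * κ) : ℂ) = φ g := fun g κ hκ => by
    rw [hφ.mul_zk0 hnm g κ hκ]
  have hφl : ∀ γ g, (φ (diagGL k γ * g) : ℂ) = φ g := fun γ g => by rw [hφ.left_invariant]
  have hsv := summable_secVal (k := k) hm hχ hx hy hqx hqy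
  have hsum : Summable fun i => (φ (cellRep i) : ℂ) * secVal m χ x y (cellRep i) := by
    refine summable_cells (Ψ := secVal m χ x y) (φ := fun g => (φ g : ℂ))
      (secVal_mul_zk0 hm hχ hx hy) hφz hφl hS (fun g hg => ?_) hsv
    obtain ⟨γ, s, hs, z, hz, κ, hκ, e⟩ := hsupp g (by exact_mod_cast hg)
    obtain ⟨γ', h'⟩ := exists_zk0_of_center hz hκ e
    exact ⟨γ', s, hs, h'⟩
  have hsum' : Summable fun i => (φ (cellRep i) : ℂ) * secCoeff m χ pr x y h (cellRep i) := by
    refine Summable.of_norm_bounded hsum.norm fun i => ?_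
    rw [norm_mul, norm_mul]
    exact mul_le_mul_of_nonneg_left (norm_secCoeff_le _ _ _ _ _ _ _) (norm_nonneg _)
  have hsc : ∀ g, Summable fun γ => (φ (diagGL k γ * g) : ℂ) *
      secCoeff m χ pr x y h (diagGL k γ * g) := by
    intro g
    simp only [hφl]
    exact (Summable.of_norm_bounded (hsv g).norm fun γ => norm_secCoeff_le _ _ _ _ _ _ _).mul_left _
  have hf : ∀ p : PGL2A k, HasSum (fun t => (cellSet m t).indicator (fun _ => (Nat.card kˣ : ℂ) *
      ((φ (cellRep t.1) : ℂ) * secCoeff m χ pr x y h (cellRep t.1))) p)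
      ((integrand m χ pr φ x y p).coeff h) := by
    intro p
    -- The unfolding is applied to the product of φ and the section: by left invariance φ may be
    -- taken inside the sum over GL₂(F).
    have h1 := hasSum_unfold (m := m) (g := Quotient.out p)
      (Ψ := fun g => (φ g : ℂ) * secCoeff m χ pr x y h g)
      (fun g κ hκ => by rw [hφz g κ hκ, secCoeff_mul_zk0 hm hχ hpr hx hy h g κ hκ])
      (fun g hg => exists_cell hm (χ := χ) (x := x) (y := y) (fun h0 => hg (by
        rw [secCoeff, h0, ite_self, mul_zero]))) (hsc _)
    have e1 : (QuotientGroup.mk (Quotient.out p) : PGL2A k) = p := QuotientGroup.out_eq' p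
    have e2 : (integrand m χ pr φ x y p).coeff h = ∑' γ, (φ (diagGL k γ * Quotient.out p) : ℂ) *
        secCoeff m χ pr x y h (diagGL k γ * Quotient.out p) := by
      simp only [hφl]
      rw [integrand, MonoidAlgebra.coeff_smul_apply, eisenstein_coeff hχ hpr, smul_eq_mul,
        tsum_mul_left]
    rw [e1] at h1
    rw [e2]
    exact h1
  obtain ⟨h2, h3⟩ := integral_unfold μG hμ1 h𝓕 hm (hsum'.mul_left (Nat.card kˣ : ℂ)) hf
  refine ⟨hsum, h2, ?_⟩
  exact h3

end Unfolding

/-! ### The factor at infinity of the Hasse–Weil L-function -/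

section LocalFactor

/-- For split multiplicative reduction the local polynomial is 1 - X, whose inverse is the geometric
series. -/
lemma coeff_localPowerSeries_of_split {R K : Type*} [CommRing R] [IsDomain R]
    [IsDiscreteValuationRing R] [Field K] [Algebra R K] [IsFractionRing R K]
    {W : WeierstrassCurve K} (h : (W.minimal R).HasSplitMultiplicativeReduction R) (n : ℕ) :
    PowerSeries.coeff n (W.localPowerSeries R) = 1 := by
  have h1 : ¬ (W.minimal R).HasGoodReduction R :=
    h.toHasMultiplicativeReduction.not_hasGoodReduction
  have h2 : W.localPolynomial R = 1 - X := by
    rw [WeierstrassCurve.localPolynomial]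
    rw [if_neg h1, if_pos h]
  have h3 : (W.localPolynomial R : PowerSeries ℤ) = 1 - PowerSeries.X := by
    rw [h2, Polynomial.coe_sub, Polynomial.coe_one, Polynomial.coe_X]
  have h4 : (1 - PowerSeries.X : PowerSeries ℤ) * W.localPowerSeries R = 1 := by
    rw [WeierstrassCurve.localPowerSeries, h3]
    exact PowerSeries.mul_invOfUnit _ _ (by simp)
  have h5 : W.localPowerSeries R = PowerSeries.mk 1 := by
    have h6 := PowerSeries.mk_one_mul_one_sub_eq_one ℤ
    calc W.localPowerSeries R
        = (PowerSeries.mk 1 * (1 - PowerSeries.X)) * W.localPowerSeries R := by rw [h6, one_mul]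
      _ = PowerSeries.mk 1 := by rw [mul_assoc, h4, mul_one]
  rw [h5, PowerSeries.coeff_mk, Pi.one_apply]

variable {k : Type*} [Field k]

lemma psiInf_eq_one {E : WeierstrassCurve (RatFunc k)} (hE : IsSplitAtInf E) (n : ℕ) :
    psiInf E n = 1 := coeff_localPowerSeries_of_split hE n

/-- All values of ψ_E^* on effective multiples of ∞ are 1, so the component at infinity matters only
through its sign. This is why degree truncated sums appear. -/
lemma psi_eq_ite {E : WeierstrassCurve (RatFunc k)} (hE : IsSplitAtInf E)
    {b : Ideal k[X]} (hb : b ≠ ⊥) {D : Divisor k} (hD : D.1 = finDiv (finGenUnit b)) :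
    psi E D = if 0 ≤ D.2 then psiIdeal E b else 0 := by
  have h0 : ∀ v, 0 ≤ finDiv (finGenUnit b) v := by
    rw [← isFinIntegral_unit_iff, coe_finGenUnit_val ⟨b, hb⟩]
    exact isFinIntegral_polyFin _
  classical
  have h1 : Divisor.IsEffective (finDiv (finGenUnit b), 0) := ⟨h0, le_rfl⟩
  rw [psiIdeal, psi, psi, psiInf_eq_one hE, psiInf_eq_one hE, hD, if_pos h1]
  exact if_congr ⟨fun h => h.2, fun h => ⟨hD ▸ h0, h⟩⟩ rfl rfl

end LocalFactor

/-! ### Orthogonality of additive characters modulo an ideal -/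

section CharacterSums

variable {k : Type*} [Field k]

instance [Finite k] (n : ℕ) : Finite (degreeLT k n) := Finite.of_equiv _ (degreeLTEquiv k n).symm.toEquiv

lemma card_degreeLT (n : ℕ) : Nat.card (degreeLT k n) = Nat.card k ^ n := by
  rw [Nat.card_congr (degreeLTEquiv k n).toEquiv, Nat.card_fun, Nat.card_eq_fintype_card (α := Fin n),
    Fintype.card_fin]

/-- The polynomials of degree less than the degree of `α`. -/
def residuesEquiv {α : k[X]} (hα : α ≠ 0) :
    degreeLT k α.natDegree ≃ {β : k[X] // β.degree < α.degree} :=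
  Equiv.subtypeEquivRight fun β => by rw [mem_degreeLT, degree_eq_natDegree hα]

instance [Finite k] (a : NzIdeal k) : Finite {β : k[X] // β.degree <
    (Submodule.IsPrincipal.generator a.1).degree} :=
  Finite.of_equiv _ (residuesEquiv (generator_ne_zero a.2))

variable {τ : AddChar (Adele k) ℂ} {δ : (Adele k)ˣ}

/-- The defining property of the different, restricted to the finite places by testing on adeles
with component 0 at infinity. -/
lemma isFinIntegral_iff_addChar (hτ : IsAdditiveCharacter τ δ) (x : FinAdele k) :
    IsFinIntegral ((((finPart δ)⁻¹ : (FinAdele k)ˣ) : FinAdele k) * x) ↔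
      ∀ y, IsFinIntegral y → τ ((x * y, 0) : Adele k) = 1 := by
  have h := hτ.different ((x, 0) : Adele k)
  have e1 : (∃ y, IsIntegralAdele y ∧ ((x, 0) : Adele k) = (δ : Adele k) * y) ↔
      IsFinIntegral ((((finPart δ)⁻¹ : (FinAdele k)ˣ) : FinAdele k) * x) := by
    rw [← exists_integral_mul_iff]
    constructor
    · rintro ⟨y, hy, h⟩
      exact ⟨y.1, hy.1, congrArg Prod.fst h⟩
    · rintro ⟨y, hy, h⟩
      refine ⟨(y, 0), ⟨hy, ?_⟩, ?_⟩
      · rw [map_zero]; exact zero_le_one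
      · refine Prod.ext h ?_
        rw [Prod.snd_mul, mul_zero]
  rw [← e1, ← h]
  constructor
  · intro h y hy
    have := h (y, 0) ⟨hy, by rw [map_zero]; exact zero_le_one⟩
    rwa [Prod.mk_mul_mk, mul_zero] at this
  · intro h y hy
    have := h y.1 hy.1
    rwa [show ((x, 0) : Adele k) * y = (x * y.1, 0) from Prod.ext rfl (zero_mul y.2)]

/-- The additive character `β ↦ τ(xβ)` on the polynomials of degree less than `n`. -/
def residueChar (τ : AddChar (Adele k) ℂ) (x : FinAdele k) (n : ℕ) :
    AddChar (degreeLT k n) ℂ where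
  toFun β := τ ((x * polyFin k β.1, 0) : Adele k)
  map_zero_eq_one' := by
    rw [ZeroMemClass.coe_zero, map_zero, mul_zero]
    exact τ.map_zero_eq_one
  map_add_eq_mul' β γ := by
    rw [← τ.map_add_eq_mul, Prod.mk_add_mk, add_zero, ← mul_add, ← map_add]
    rfl

/-- Orthogonality. The hypothesis on xα makes β ↦ τ(xβ) well defined on 𝒪_f modulo α, and that
character is trivial exactly when x lies in the finite part of 𝔡𝒪. -/
lemma sum_addChar_residues [Finite k] (hτ : IsAdditiveCharacter τ δ) {α : k[X]} (hα : α ≠ 0) {x : FinAdele k}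
    (hx : IsFinIntegral ((((finPart δ)⁻¹ : (FinAdele k)ˣ) : FinAdele k) * (x * polyFin k α)))
    (s : Fintype {β : k[X] // β.degree < α.degree}) [Decidable (IsFinIntegral
      ((((finPart δ)⁻¹ : (FinAdele k)ˣ) : FinAdele k) * x))] :
    ∑ β : {β : k[X] // β.degree < α.degree}, τ ((x * polyFin k β.1, 0) : Adele k) =
      if IsFinIntegral ((((finPart δ)⁻¹ : (FinAdele k)ˣ) : FinAdele k) * x) then
        (Nat.card k : ℂ) ^ α.natDegree else 0 := by
  classical
  have := Fintype.ofFinite (degreeLT k α.natDegree)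
  have h1 : ∑ β : {β : k[X] // β.degree < α.degree}, τ ((x * polyFin k β.1, 0) : Adele k) =
      ∑ β, residueChar τ x α.natDegree β := by
    rw [← Equiv.sum_comp (residuesEquiv hα)]
    rfl
  rw [h1, AddChar.sum_eq_ite, ← Nat.card_eq_fintype_card, card_degreeLT, Nat.cast_pow]
  refine if_congr ?_ rfl rfl
  rw [isFinIntegral_iff_addChar hτ]
  constructor
  · intro h y hy
    obtain ⟨β, hβ, z, hz, rfl⟩ := exists_poly_sub_mul hα hy
    have h2 : τ ((x * polyFin k β, 0) : Adele k) = 1 :=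
      DFunLike.congr_fun h (⟨β, by rwa [mem_degreeLT, ← degree_eq_natDegree hα]⟩ : degreeLT k _)
    have h3 := (isFinIntegral_iff_addChar hτ _).mp hx z hz
    have h4 : ((x * (polyFin k β + polyFin k α * z), 0) : Adele k) =
        (x * polyFin k β, 0) + (x * polyFin k α * z, 0) := by
      rw [Prod.mk_add_mk, add_zero, mul_add, mul_assoc]
    rw [h4, τ.map_add_eq_mul, h2, h3, one_mul]
  · intro h
    ext β
    exact h _ (isFinIntegral_polyFin _)

end CharacterSums

/-! ### Fourier coefficients summed over the residues modulo an ideal -/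

section Fourier

variable {k : Type*} [Field k]

/-- The element `d e c` of `F^*` attached to the generator of an ideal `e` and a constant `c`. -/
def twistedGen (d : (RatFunc k)ˣ) (p : NzIdeal k × kˣ) : (RatFunc k)ˣ :=
  d * (constUnit k p.2 * genUnit p.1)

lemma finDiv_twistedGen (d : (RatFunc k)ˣ) (p : NzIdeal k × kˣ) :
    finDiv (finDiagUnit k (twistedGen d p)) = finDiv (finDiagUnit k d) + finDiv (finGenUnit p.1.1) := by
  rw [twistedGen, map_mul, map_mul, finDiv_mul, finDiv_mul, ← finGenUnit_val,
    finDiv_eq_zero_iff.mpr (isFinIntegralUnit_finDiagUnit_iff.mpr ⟨p.2, rfl⟩), zero_add]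

lemma twistedGen_injective (d : (RatFunc k)ˣ) : Function.Injective (twistedGen d) := by
  rintro ⟨e, c⟩ ⟨e', c'⟩ h
  have h1 : e = e' := by
    apply eq_of_finDiv_finGenUnit
    have h2 := finDiv_twistedGen d (e, c)
    rw [h, finDiv_twistedGen, add_right_inj] at h2
    exact h2.symm
  subst h1
  rw [twistedGen, twistedGen, mul_right_inj, mul_left_inj] at h
  exact congrArg (Prod.mk e) (constUnit_injective h)

/-- Here d generates the finite divisor of c, so the η in c𝒪_f are d times nonzero polynomials, each
a constant times the chosen generator of an ideal. -/
lemma mem_range_twistedGen {d η : (RatFunc k)ˣ} {c : (FinAdele k)ˣ}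
    (hd : IsFinIntegralUnit ((finDiagUnit k d)⁻¹ * c)) :
    η ∈ Set.range (twistedGen d) ↔ IsFinIntegral ((c⁻¹ * finDiagUnit k η : (FinAdele k)ˣ) : FinAdele k) := by
  rw [← finDiv_eq_iff] at hd
  have h0 : finDiv (c⁻¹ * finDiagUnit k η) = finDiv (finDiagUnit k (d⁻¹ * η)) := by
    rw [map_mul, map_inv, finDiv_mul, finDiv_mul, finDiv_inv, finDiv_inv, hd]
  rw [isFinIntegral_unit_iff, h0, ← isFinIntegral_unit_iff]
  constructor
  · rintro ⟨p, rfl⟩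
    rw [isFinIntegral_unit_iff, map_mul, finDiv_mul, finDiv_twistedGen, map_inv, finDiv_inv,
      neg_add_cancel_left, ← isFinIntegral_unit_iff, coe_finGenUnit_val]
    exact isFinIntegral_polyFin _
  · intro h
    obtain ⟨e, he⟩ := exists_ideal_of_isFinIntegral h
    rw [finGenUnit_val, ← map_inv, ← map_mul, isFinIntegralUnit_finDiagUnit_iff] at he
    obtain ⟨u, hu⟩ := he
    refine ⟨(e, u), ?_⟩
    rw [twistedGen, hu, mul_comm _ (genUnit e), mul_inv_cancel_left, mul_inv_cancel_left]

lemma ideleDeg_cellIdele (a : NzIdeal k) (N : ℤ) :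
    ideleDeg (cellIdele a N) = idealDeg a.1 + N := by
  have h1 : finPart (cellIdele a N) = finGenUnit a.1 := Units.ext (cellIdele_fst a N)
  rw [ideleDeg, divisor_deg, ideleDiv, h1, finDeg_finGenUnit a.2, cellIdele_snd, ordInf_infPow]

lemma finPart_cellIdele (a : NzIdeal k) (N : ℤ) : finPart (cellIdele a N) = finGenUnit a.1 :=
  Units.ext (cellIdele_fst a N)

variable {E : WeierstrassCurve (RatFunc k)} {τ : AddChar (Adele k) ℂ} {δ : (Adele k)ˣ}
  {φ : GL2A k → ℚ}

/-- The coefficient of the ideal `e` in the sum of a form over the cells with parameters `a`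
and `N`. -/
def cellCoeff (E : WeierstrassCurve (RatFunc k)) (δ : (Adele k)ˣ) (a : NzIdeal k) (N : ℤ)
    (e : NzIdeal k) : ℂ :=
  (Nat.card k : ℂ) ^ (ideleDeg δ - N) *
    if (idealDeg e.1 : ℤ) ≤ N - ideleDeg δ then (psiIdeal E (a.1 * e.1) : ℂ) else 0

lemma finDiv_cell {d : (RatFunc k)ˣ} (hd : IsFinIntegralUnit ((finDiagUnit k d)⁻¹ * finPart δ))
    (a : NzIdeal k) (N : ℤ) (p : NzIdeal k × kˣ) :
    (ideleDiv (diagUnit k (twistedGen d p) * (cellIdele a N * δ⁻¹))).1 =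
      finDiv (finGenUnit (a.1 * p.1.1)) := by
  rw [← finDiv_eq_iff] at hd
  change finDiv (finPart (diagUnit k (twistedGen d p) * (cellIdele a N * δ⁻¹))) = _
  rw [finPart_mul, finPart_mul, finPart_diagUnit, finPart_cellIdele, finDiv_mul, finDiv_mul,
    finDiv_twistedGen, finDiv_finGenUnit_mul a.2 p.1.2, show finPart δ⁻¹ = (finPart δ)⁻¹ from rfl,
    finDiv_inv, hd]
  abel

lemma deg_cell (η : (RatFunc k)ˣ) (a : NzIdeal k) (N : ℤ) :
    (ideleDiv (diagUnit k η * (cellIdele a N * δ⁻¹))).deg = idealDeg a.1 + N - ideleDeg δ := by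
  change ideleDeg _ = _
  rw [ideleDeg_mul, ideleDeg_mul, ideleDeg_diagUnit, ideleDeg_inv, ideleDeg_cellIdele]
  ring

/-- For η = d·c·e the finite divisor of ηx is 𝔞𝔢 and, by the product formula, the component at
infinity is N - deg 𝔡 - deg 𝔢. The q^{deg 𝔞} residues cancel the contribution of 𝔞 to |ηx|. -/
lemma fourierTerm_cell [Finite k] (hE : IsSplitAtInf E) {d : (RatFunc k)ˣ}
    (hd : IsFinIntegralUnit ((finDiagUnit k d)⁻¹ * finPart δ)) (a : NzIdeal k) (N : ℤ)
    (p : NzIdeal k × kˣ) {D : Divisor k}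
    (hD : D = ideleDiv (diagUnit k (twistedGen d p) * (cellIdele a N * δ⁻¹))) :
    (((Divisor.abs D : ℝ) : ℂ) * (psi E D : ℂ)) * (Nat.card k : ℂ) ^ (idealDeg a.1) =
      cellCoeff E δ a N p.1 := by
  have h1 : D.1 = finDiv (finGenUnit (a.1 * p.1.1)) := hD ▸ finDiv_cell hd a N p
  have h2 : D.deg = idealDeg a.1 + N - ideleDeg δ := hD ▸ deg_cell _ a N
  have hne : a.1 * p.1.1 ≠ ⊥ := mul_ne_zero a.2 p.1.2
  have h3 : D.2 = N - ideleDeg δ - idealDeg p.1.1 := by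
    rw [divisor_deg, h1, finDeg_finGenUnit hne, idealDeg_mul a.2 p.1.2] at h2
    push_cast at h2
    linarith
  have hq : (Nat.card k : ℂ) ≠ 0 := Nat.cast_ne_zero.mpr Nat.card_pos.ne'
  have h4 : ((Divisor.abs D : ℝ) : ℂ) * (Nat.card k : ℂ) ^ (idealDeg a.1) =
      (Nat.card k : ℂ) ^ (ideleDeg δ - N) := by
    rw [Divisor.abs, h2]
    push_cast
    rw [← zpow_natCast, ← zpow_add₀ hq]
    congr 1
    ring
  rw [psi_eq_ite hE hne h1, h3, mul_right_comm, h4, cellCoeff, Int.cast_ite, Int.cast_zero]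
  congr 1
  refine if_congr ?_ rfl rfl
  rw [sub_nonneg]

/-- Summing the expansion over β leaves the η in 𝔡𝒪_f, parametrized by an ideal 𝔢 and a constant.
The constants do not affect the term, whence the factor |k^*|. -/
lemma hasSum_cell [Finite k] (hE : IsSplitAtInf E) (hτ : IsAdditiveCharacter τ δ)
    (hφ : IsFourierCoefficient τ δ φ fun D => ((Divisor.abs D : ℝ) : ℂ) * (psi E D : ℂ))
    (a : NzIdeal k) (N : ℤ) :
    HasSum (fun e => (Nat.card kˣ : ℂ) * cellCoeff E δ a N e)
      (∑' β : {β : k[X] // β.degree < (Submodule.IsPrincipal.generator a.1).degree},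
        ((φ (affineGL (cellIdele a N) ((polyFin k β.1, 0) : Adele k)) : ℚ) : ℂ)) := by
  classical
  have := Fintype.ofFinite
    {β : k[X] // β.degree < (Submodule.IsPrincipal.generator a.1).degree}
  obtain ⟨d, hd⟩ := exists_ratFunc_unit (finPart δ)
  rw [tsum_fintype]
  have h1 := hasSum_sum (s := Finset.univ) fun
    (β : {β : k[X] // β.degree < (Submodule.IsPrincipal.generator a.1).degree}) _ =>
      hφ.expansion (cellIdele a N * δ⁻¹) ((polyFin k β.1, 0) : Adele k)
  simp only [inv_mul_cancel_right, ← Finset.mul_sum] at h1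
  have h2 : ∀ η : (RatFunc k)ˣ,
      (∑ β : {β : k[X] // β.degree < (Submodule.IsPrincipal.generator a.1).degree},
        τ ((diagUnit k η : Adele k) * ((polyFin k β.1, 0) : Adele k))) =
      ∑ β : {β : k[X] // β.degree < (Submodule.IsPrincipal.generator a.1).degree},
        τ (((finDiagUnit k η : FinAdele k) * polyFin k β.1, 0) : Adele k) := by
    intro η
    refine Finset.sum_congr rfl fun β _ => congrArg τ (Prod.ext rfl ?_)
    rw [Prod.snd_mul, mul_zero]
  have h3 : ∀ η, η ∈ Set.range (twistedGen d) ↔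
      IsFinIntegral ((((finPart δ)⁻¹ : (FinAdele k)ˣ) : FinAdele k) * (finDiagUnit k η : FinAdele k)) := by
    intro η
    rw [mem_range_twistedGen hd, Units.val_mul]
  -- A nonzero coefficient needs an effective divisor, and this is precisely what makes β ↦ τ(ηβ) a
  -- character modulo 𝔞.
  have h4 : ∀ η : (RatFunc k)ˣ,
      psi E (ideleDiv (diagUnit k η * (cellIdele a N * δ⁻¹))) ≠ 0 →
      IsFinIntegral ((((finPart δ)⁻¹ : (FinAdele k)ˣ) : FinAdele k) *
        ((finDiagUnit k η : FinAdele k) * polyFin k (Submodule.IsPrincipal.generator a.1))) := by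
    intro η h
    rw [psi, ite_ne_right_iff] at h
    have h5 := isFinIntegral_unit_iff.mpr h.1.1
    change IsFinIntegral ((finPart (diagUnit k η * (cellIdele a N * δ⁻¹)) : (FinAdele k)ˣ) :
      FinAdele k) at h5
    rw [finPart_mul, finPart_mul, finPart_diagUnit, finPart_cellIdele, Units.val_mul, Units.val_mul,
      coe_finGenUnit_val, ← mul_assoc, mul_comm] at h5
    exact h5
  rw [← (twistedGen_injective d).hasSum_iff] at h1
  · refine hasSum_prod_const (T := NzIdeal k) (K := kˣ) (C := cellCoeff E δ a N) ?_
    convert h1 using 2 with p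
    rw [Function.comp_apply, h2, ← fourierTerm_cell hE hd a N p rfl]
    by_cases h0 : psi E (ideleDiv (diagUnit k (twistedGen d p) * (cellIdele a N * δ⁻¹))) = 0
    · rw [h0, Int.cast_zero, mul_zero, zero_mul, zero_mul]
    · rw [sum_addChar_residues hτ (generator_ne_zero a.2) (h4 _ h0),
        if_pos ((h3 _).mp ⟨p, rfl⟩)]
      rfl
  · intro η hη
    rw [h2]
    by_cases h0 : psi E (ideleDiv (diagUnit k η * (cellIdele a N * δ⁻¹))) = 0
    · rw [h0, Int.cast_zero, mul_zero, zero_mul]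
    · rw [sum_addChar_residues hτ (generator_ne_zero a.2) (h4 _ h0),
        if_neg fun h => hη ((h3 _).mpr h), mul_zero]

end Fourier

section CellValues

/-! ### The values of the section on the cells -/

variable {k : Type*} [Field k]

lemma det_cellRep (i : CellIndex k) : Matrix.GeneralLinearGroup.det (cellRep i) =
    diagUnit k (genUnit i.1.2.1) * cellIdele i.1.1 i.1.2.2 := by
  rw [cellRep, map_mul, det_diagGL, det_triGL, affineGL_eq, det_triGL, one_mul, mul_one]

lemma finPart_det_cellRep (i : CellIndex k) :
    finPart (Matrix.GeneralLinearGroup.det (cellRep i)) =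
      finGenUnit i.1.2.1.1 * finGenUnit i.1.1.1 := by
  rw [det_cellRep, finPart_mul, finPart_diagUnit, finPart_cellIdele, ← finGenUnit_val]

lemma ideleDeg_det_cellRep (i : CellIndex k) :
    ideleDeg (Matrix.GeneralLinearGroup.det (cellRep i)) = idealDeg i.1.1.1 + i.1.2.2 := by
  rw [det_cellRep, ideleDeg_mul, ideleDeg_diagUnit, zero_add, ideleDeg_cellIdele]

lemma ordInf_genUnitInf (w : NzIdeal k) : ordInf (genUnitInf w : FInf k) = -(idealDeg w.1 : ℤ) := by
  change ordInf (algebraMap (RatFunc k) (FInf k) (genUnit w : RatFunc k)) = _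
  rw [ordInf_algebraMap (genUnit w).ne_zero]
  change -(RatFunc.intDegree (algebraMap k[X] (RatFunc k) _)) = _
  rw [RatFunc.intDegree_polynomial]
  rfl

lemma cellRep_fst_apply (i : CellIndex k) (r s : Fin 2) : (cellRep i r s).1 =
    (triGL (finGenUnit i.1.1.1) (finGenUnit i.1.2.1.1) (polyFin k i.2.1) : GL (Fin 2) (FinAdele k))
      r s := by
  rw [← gFin_cellRep, gFin_apply]

lemma cellRep_snd_apply (i : CellIndex k) (r s : Fin 2) : (cellRep i r s).2 =
    (triGL (infPow k i.1.2.2) (genUnitInf i.1.2.1) 0 : GL (Fin 2) (FInf k)) r s := by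
  rw [← gInf_cellRep, gInf_apply]

lemma inSupport_cellRep (m : Ideal k[X]) (i : CellIndex k) : InSupport m (cellRep i) := by
  refine ⟨fun r s => ?_, ?_, ?_, ?_⟩
  · rw [cellRep_fst_apply]
    fin_cases r <;> fin_cases s
    · change IsFinIntegral (finGenUnit i.1.1.1 : FinAdele k)
      rw [coe_finGenUnit_val]
      exact isFinIntegral_polyFin _
    · exact isFinIntegral_polyFin _
    · exact (finIntegers k).zero_mem
    · change IsFinIntegral (finGenUnit i.1.2.1.1 : FinAdele k)
      rw [coe_finGenUnit_val]
      exact isFinIntegral_polyFin _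
  · rw [cellRep_snd_apply, cellRep_snd_apply, triGL_01, map_zero]
    exact zero_le
  · rw [cellRep_snd_apply, cellRep_snd_apply, triGL_10, map_zero, triGL_11]
    exact zero_lt_iff.mpr ((_root_.map_ne_zero _).mpr (Units.ne_zero _))
  · rw [cellRep_fst_apply, triGL_10]
    exact ⟨0, (finIntegers k).zero_mem, (mul_zero _).symm⟩

variable {m : Ideal k[X]} {χ : (FinAdele k)ˣ →* ℂˣ} {x y : ℂ}

lemma chi_finGenUnit (hχ : IsDirichletCharacter m χ) (a : NzIdeal k) : χ (finGenUnit a.1) = 1 := by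
  rw [finGenUnit_val, hχ.trivial_principal]

/-- The finite determinant is the principal idele of a generator of 𝔞𝔴, so χ(det) = 1; the
valuations at infinity of the diagonal are N and -deg 𝔴, and the degree of the determinant is deg 𝔞
+ N. The part depending on 𝔴 splits off. -/
lemma secVal_cellRep (hχ : IsDirichletCharacter m χ) (hx : x ≠ 0) (i : CellIndex k) :
    secVal m χ x y (cellRep i) = chiIdeal m χ i.1.2.1.1 * (y ^ 2) ^ idealDeg i.1.2.1.1 *
      (chiIdeal m χ i.1.1.1 * (x ^ ((idealDeg i.1.1.1 : ℤ) - i.1.2.2) *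
        y ^ ((idealDeg i.1.1.1 : ℤ) + i.1.2.2))) := by
  have e : x ^ ((idealDeg i.1.1.1 : ℤ) - i.1.2.2) =
      x ^ ((idealDeg i.1.1.1 : ℤ) + i.1.2.2) * x ^ (-2 * i.1.2.2) := by
    rw [← zpow_add₀ hx]
    congr 1
    ring
  rw [secVal_of_inSupport (inSupport_cellRep m i), finPart_det_cellRep, map_mul, chi_finGenUnit hχ,
    chi_finGenUnit hχ, ideleDeg_det_cellRep, cellRep_fst_apply, cellRep_fst_apply,
    cellRep_snd_apply, cellRep_snd_apply, triGL_00, triGL_11, triGL_00, triGL_11, ordInf_infPow,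
    ordInf_genUnitInf, chiIdeal, chiIdeal, coe_finGenUnit i.1.1.2, coe_finGenUnit i.1.2.1.2,
    mul_zpow, ← pow_mul, e,
    show (-2 : ℤ) * -(idealDeg i.1.2.1.1 : ℤ) = ((2 * idealDeg i.1.2.1.1 : ℕ) : ℤ) by push_cast; ring,
    zpow_natCast y (2 * idealDeg i.1.2.1.1)]
  rw [mul_one, Units.val_one, inv_one, one_mul]
  ring

lemma secClass_cellRep {G : Type*} [CommGroup G] (pr : (Adele k)ˣ →* G) (i : CellIndex k) :
    secClass pr (cellRep i) = (idealClass pr i.1.2.1.1)⁻¹ * (idealClass pr i.1.1.1)⁻¹ := by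
  rw [secClass, finPart_det_cellRep, ofFin_mul, map_mul, mul_inv, idealClass, idealClass]

lemma chiIdeal_top_ne_zero (hχ : IsDirichletCharacter m χ) : chiIdeal m χ ⊤ ≠ 0 := by
  have h1 : IsFinIntegralUnit (finGenUnit (⊤ : Ideal k[X])) := by
    rw [finGenUnit_eq top_ne_bot]
    refine isFinIntegralUnit_polyUnit (Ideal.span_singleton_eq_top.mp ?_)
    exact Ideal.span_singleton_generator ⊤
  rw [chiIdeal, ← coe_finGenUnit top_ne_bot, chi0_unit hχ h1]
  exact Units.ne_zero _

/-- A common prime factor prevents the generator from being a unit modulo 𝔪. The sums over ideals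
prime to 𝔪 may thus run over all nonzero ideals. -/
lemma chiIdeal_eq_zero (hm : m ≠ ⊥) (a : NzIdeal k) (h : ¬ IsCoprime a.1 m) :
    chiIdeal m χ a.1 = 0 := by
  rw [chiIdeal, ← coe_finGenUnit a.2, coe_finGenUnit_val]
  refine chi0_eq_zero fun hz => h ?_
  rw [exists_unit_congr_iff hm (isFinIntegral_polyFin _)] at hz
  rw [Ideal.isCoprime_iff_sup_eq]
  by_contra hne
  obtain ⟨P, hP, hle⟩ := Ideal.exists_le_maximal _ hne
  have hPne : P ≠ ⊥ := by
    rintro rfl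
    exact hm (le_bot_iff.mp (le_sup_right.trans hle))
  let v : HeightOneSpectrum k[X] := ⟨P, hP.isPrime, hPne⟩
  have h1 := hz v ((v.intValuation_lt_one_iff_mem _).mpr
    (hle (le_sup_right (a := a.1) (Submodule.IsPrincipal.generator_mem m))))
  rw [valued_polyFin] at h1
  exact ((v.intValuation_lt_one_iff_mem _).mpr
    (hle (le_sup_left (b := m) (Submodule.IsPrincipal.generator_mem a.1)))).ne h1

end CellValues

section GroupAlgebraSeries

/-! ### Series in the group algebra -/

variable {G : Type*}

/-- Convergence of a series in `ℂ[G]` to a given sum. -/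
def GHasSum {ι : Type*} (f : ι → MonoidAlgebra ℂ G) (a : MonoidAlgebra ℂ G) : Prop :=
  ∀ h, HasSum (fun i => (f i).coeff h) (a.coeff h)

lemma GSummable.gHasSum [Finite G] {ι : Type*} {f : ι → MonoidAlgebra ℂ G} (h : GSummable f) :
    GHasSum f (gsum f) := fun g => (h g).hasSum

lemma gSummable_single {ι : Type*} {c : ι → G} {z : ι → ℂ} (hz : Summable z) :
    GSummable fun i => MonoidAlgebra.single (c i) (z i) := by
  classical
  intro h
  refine Summable.of_norm_bounded (g := fun i => ‖z i‖) hz.norm fun i => ?_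
  rw [MonoidAlgebra.coeff_single, Finsupp.single_apply]
  split_ifs
  · exact le_rfl
  · rw [norm_zero]; exact norm_nonneg _

lemma coeff_mul_eq_sum [Group G] [Fintype G] (a b : MonoidAlgebra ℂ G) (h : G) :
    (a * b).coeff h = ∑ g, a.coeff g * b.coeff (g⁻¹ * h) := by
  have h1 : a = ∑ g, MonoidAlgebra.single g (a.coeff g) := by
    conv_lhs => rw [← MonoidAlgebra.sum_coeff_single a]
    exact Finsupp.sum_fintype _ _ fun g => MonoidAlgebra.single_zero g
  conv_lhs => rw [h1]
  rw [Finset.sum_mul, MonoidAlgebra.coeff_sum, Finsupp.finsetSum_apply]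
  exact Finset.sum_congr rfl fun g _ => MonoidAlgebra.coeff_single_mul_apply _ _ _ _

lemma hasSum_sum_mul_prod {S ι κ : Type*} {s : Finset S} {f : S → ι → ℂ} {f' : S → κ → ℂ}
    {a b : S → ℂ} (hf : ∀ g, HasSum (f g) (a g)) (hf' : ∀ g, HasSum (f' g) (b g)) :
    HasSum (fun p : ι × κ => ∑ g ∈ s, f g p.1 * f' g p.2) (∑ g ∈ s, a g * b g) :=
  hasSum_sum (f := fun g (p : ι × κ) => f g p.1 * f' g p.2) (a := fun g => a g * b g) fun g _ =>
    HasSum.mul (f := f g) (g := f' g) (hf g) (hf' g)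
      (summable_mul_of_summable_norm (f := f g) (g := f' g) (hf g).summable.norm
        (hf' g).summable.norm)

/-- Multiplication in ℂ[G] is a finite convolution, so this is a finite sum of products of
absolutely convergent complex series. -/
lemma GHasSum.mul [Group G] [Finite G] {ι κ : Type*} {f : ι → MonoidAlgebra ℂ G}
    {f' : κ → MonoidAlgebra ℂ G} {a b : MonoidAlgebra ℂ G} (hf : GHasSum f a) (hf' : GHasSum f' b) :
    GHasSum (fun p : ι × κ => f p.1 * f' p.2) (a * b) := by
  have := Fintype.ofFinite G
  intro h
  have h1 := hasSum_sum_mul_prod (s := Finset.univ) (f := fun g i => (f i).coeff g)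
    (f' := fun g i => (f' i).coeff (g⁻¹ * h)) (a := fun g => a.coeff g)
    (b := fun g => b.coeff (g⁻¹ * h)) hf fun g => hf' (g⁻¹ * h)
  rw [← coeff_mul_eq_sum] at h1
  exact h1.congr_fun fun p => coeff_mul_eq_sum _ _ _

end GroupAlgebraSeries

section DivisorSums

/-! ### Ideals of bounded degree and divisor sums -/

variable {k : Type*} [Field k]

lemma idealDeg_le_of_dvd {a r : Ideal k[X]} (hr : r ≠ ⊥) (h : a ∣ r) : idealDeg a ≤ idealDeg r := by
  obtain ⟨e, rfl⟩ := h
  have ha : a ≠ ⊥ := by rintro rfl; exact hr (zero_mul e)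
  have he : e ≠ ⊥ := by rintro rfl; exact hr (mul_zero a)
  rw [idealDeg_mul ha he]
  exact Nat.le_add_right _ _

variable {G : Type*} [CommGroup G] {m : Ideal k[X]} {χ : (FinAdele k)ˣ →* ℂˣ}
  {pr : (Adele k)ˣ →* G}

/-- The term `χ(𝔞) (𝔞^G)⁻¹ x^{deg 𝔞}`. -/
def idealTerm (m : Ideal k[X]) (χ : (FinAdele k)ˣ →* ℂˣ) (pr : (Adele k)ˣ →* G) (x : ℂ)
    (a : Ideal k[X]) : MonoidAlgebra ℂ G :=
  MonoidAlgebra.single (idealClass pr a)⁻¹ (chiIdeal m χ a * x ^ idealDeg a)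

lemma idealTerm_eq_zero (hm : m ≠ ⊥) {x : ℂ} (a : NzIdeal k) (h : ¬ IsCoprime a.1 m) :
    idealTerm m χ pr x a.1 = 0 := by
  rw [idealTerm, chiIdeal_eq_zero hm a h, zero_mul, MonoidAlgebra.single_zero]

variable [Finite k]

lemma finite_idealDeg_le (M : ℤ) : {a : NzIdeal k | (idealDeg a.1 : ℤ) ≤ M}.Finite := by
  let f : {a : NzIdeal k | (idealDeg a.1 : ℤ) ≤ M} → degreeLT k (M.toNat + 1) := fun a =>
    ⟨Submodule.IsPrincipal.generator a.1.1, mem_degreeLT.mpr (degree_le_natDegree.trans_lt (by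
      have h : (idealDeg a.1.1 : ℤ) ≤ M := a.2
      change ((idealDeg a.1.1 : ℕ) : WithBot ℕ) < _
      exact_mod_cast (by omega : idealDeg a.1.1 < M.toNat + 1)))⟩
  have hf : Function.Injective f := fun a b h =>
    Subtype.ext (generator_injective (congrArg (fun p => p.1) h))
  have := Finite.of_injective f hf
  exact Set.toFinite _

/-- The nonzero ideals of degree at most `M`. -/
def idealsLE (k : Type*) [Field k] [Finite k] (M : ℤ) : Finset (NzIdeal k) :=
  (finite_idealDeg_le M).toFinset

@[simp] lemma mem_idealsLE {M : ℤ} {a : NzIdeal k} : a ∈ idealsLE k M ↔ (idealDeg a.1 : ℤ) ≤ M := by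
  rw [idealsLE, Set.Finite.mem_toFinset, Set.mem_ofPred_eq]

lemma idealsLE_eq_empty {M : ℤ} (hM : M < 0) : idealsLE k M = ∅ := by
  ext a
  rw [mem_idealsLE]
  simp
  omega

-- Reindexing by 𝔯 = 𝔞𝔢, a bijection from the nonzero ideals onto the nonzero multiples of 𝔞.
open scoped Classical in
lemma hasSum_multiples (ψ : Ideal k[X] → ℂ) (a : NzIdeal k) (M : ℤ) :
    HasSum (fun e : NzIdeal k => if (idealDeg a.1 : ℤ) + idealDeg e.1 ≤ M then ψ (a.1 * e.1) else 0)
      (∑ r ∈ idealsLE k M, if a.1 ∣ r.1 then ψ r.1 else 0) := by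
  let F : NzIdeal k → ℂ := fun r => if r ∈ idealsLE k M then (if a.1 ∣ r.1 then ψ r.1 else 0) else 0
  have h1 : HasSum F (∑ r ∈ idealsLE k M, F r) :=
    hasSum_sum_of_ne_finset_zero fun r hr => if_neg hr
  have h2 : ∑ r ∈ idealsLE k M, F r = ∑ r ∈ idealsLE k M, if a.1 ∣ r.1 then ψ r.1 else 0 :=
    Finset.sum_congr rfl fun r hr => if_pos hr
  rw [h2] at h1
  let g : NzIdeal k → NzIdeal k := fun e => ⟨a.1 * e.1, mul_ne_zero a.2 e.2⟩
  have hg : Function.Injective g := fun e e' h =>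
    Subtype.ext (mul_left_cancel₀ a.2 (congrArg Subtype.val h))
  rw [← hg.hasSum_iff] at h1
  · refine h1.congr_fun fun e => ?_
    change _ = F (g e)
    simp only [F, mem_idealsLE, g, dvd_mul_right, if_true, idealDeg_mul a.2 e.2, Nat.cast_add]
  · intro r hr
    have : ¬ a.1 ∣ r.1 := by
      rintro ⟨e, he⟩
      have h0 : e ≠ ⊥ := by
        rintro rfl
        exact r.2 (he.trans (mul_zero _))
      exact hr ⟨⟨e, h0⟩, Subtype.ext he.symm⟩
    simp only [F, if_neg this, ite_self]

-- An exchange of two finite sums: an ideal of degree above M divides no nonzero ideal of degree at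
-- most M, so only finitely many 𝔞 contribute.
open scoped Classical in
lemma hasSum_divisorSums (ψ : Ideal k[X] → ℂ) (c : NzIdeal k → ℂ) (M : ℤ) :
    HasSum (fun a : NzIdeal k => c a * ∑ r ∈ idealsLE k M, if a.1 ∣ r.1 then ψ r.1 else 0)
      (∑ r ∈ idealsLE k M, ψ r.1 * ∑ a ∈ idealsLE k M, if a.1 ∣ r.1 then c a else 0) := by
  have h1 : ∀ a ∉ idealsLE k M,
      c a * ∑ r ∈ idealsLE k M, (if a.1 ∣ r.1 then ψ r.1 else 0) = 0 := by
    intro a ha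
    rw [Finset.sum_eq_zero, mul_zero]
    intro r hr
    rw [if_neg]
    intro h
    rw [mem_idealsLE] at ha hr
    exact ha ((Nat.cast_le.mpr (idealDeg_le_of_dvd r.2 h)).trans hr)
  have h2 : HasSum (fun a : NzIdeal k => c a *
      ∑ r ∈ idealsLE k M, if a.1 ∣ r.1 then ψ r.1 else 0)
      (∑ a ∈ idealsLE k M, c a * ∑ r ∈ idealsLE k M, if a.1 ∣ r.1 then ψ r.1 else 0) :=
    hasSum_sum_of_ne_finset_zero h1
  refine (congrArg (HasSum _) ?_).mp h2
  simp only [Finset.mul_sum]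
  rw [Finset.sum_comm]
  refine Finset.sum_congr rfl fun a _ => Finset.sum_congr rfl fun r _ => ?_
  split_ifs
  · rw [mul_comm]
  · rw [mul_zero, mul_zero]

lemma coeff_finsum_ite {ι G : Type*} {P : ι → Prop} {F : ι → MonoidAlgebra ℂ G} (s : Finset ι)
    (hs : ∀ i, P i → i ∈ s) [DecidablePred P] (h : G) :
    (∑ᶠ (i : ι) (_ : P i), F i).coeff h = ∑ i ∈ s, if P i then (F i).coeff h else 0 := by
  have h1 : ∀ i, (∑ᶠ (_ : P i), F i) = if P i then F i else 0 := fun i => finsum_eq_if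
  simp only [h1]
  rw [finsum_eq_sum_of_support_subset (s := s), MonoidAlgebra.coeff_sum, Finsupp.finsetSum_apply]
  · refine Finset.sum_congr rfl fun i _ => ?_
    split_ifs
    · rfl
    · rfl
  · intro i hi
    rw [Function.mem_support, ne_eq, ite_eq_right_iff, Classical.not_imp] at hi
    exact hs i hi.1

open scoped Classical in
lemma coeff_sigmaG (hm : m ≠ ⊥) {x : ℂ} {M : ℤ} (r : NzIdeal k) (hr : (idealDeg r.1 : ℤ) ≤ M)
    (h : G) : (sigmaG m χ pr r.1 x).coeff h =
      ∑ a ∈ idealsLE k M, if a.1 ∣ r.1 then (idealTerm m χ pr x a.1).coeff h else 0 := by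
  rw [sigmaG, coeff_finsum_ite ((idealsLE k M).map ⟨Subtype.val, Subtype.val_injective⟩),
    Finset.sum_map]
  · refine Finset.sum_congr rfl fun a _ => ?_
    rw [Function.Embedding.coeFn_mk]
    by_cases h1 : a.1 ∣ r.1
    · by_cases h2 : IsCoprime a.1 m
      · rw [if_pos ⟨h1, h2⟩, if_pos h1]; rfl
      · rw [if_neg fun h => h2 h.2, if_pos h1, idealTerm_eq_zero hm a h2]; rfl
    · rw [if_neg fun h => h1 h.1, if_neg h1]
  · rintro e ⟨he, -⟩
    have h0 : e ≠ ⊥ := by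
      rintro rfl
      exact r.2 (zero_dvd_iff.mp he)
    rw [Finset.mem_map]
    refine ⟨⟨e, h0⟩, ?_, rfl⟩
    rw [mem_idealsLE]
    exact (Nat.cast_le.mpr (idealDeg_le_of_dvd r.2 he)).trans hr

/-- The base is a positive real, so its logarithm is real and no branch of the complex power
interferes. -/
lemma zpow_cpow {Q : ℕ} (hQ : Q ≠ 0) (n : ℤ) (z : ℂ) :
    ((((Q : ℝ) ^ n : ℝ)) : ℂ) ^ z = ((Q : ℂ) ^ z) ^ n := by
  have h0 : (0 : ℝ) < Q := by positivity
  have hQ' : (Q : ℂ) ≠ 0 := Nat.cast_ne_zero.mpr hQ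
  rw [Complex.cpow_def_of_ne_zero (Complex.ofReal_ne_zero.mpr (zpow_pos h0 n).ne'),
    Complex.cpow_def_of_ne_zero hQ', ← Complex.ofReal_log (zpow_pos h0 n).le, Real.log_zpow,
    ← Complex.exp_int_mul, Complex.ofReal_mul, Complex.ofReal_intCast, Complex.ofReal_log h0.le,
    Complex.ofReal_natCast, mul_assoc]

/-- The sum of `ψ_E^*(𝔯) σ^G_𝔪(χ, 𝔯, x)` over the nonzero ideals `𝔯` of degree at most `M`,
computed on coefficients. -/
def sumLE (E : WeierstrassCurve (RatFunc k)) (m : Ideal k[X]) (χ : (FinAdele k)ˣ →* ℂˣ)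
    (pr : (Adele k)ˣ →* G) (x : ℂ) (h : G) (M : ℤ) : ℂ :=
  ∑ r ∈ idealsLE k M, (psiIdeal E r.1 : ℂ) * (sigmaG m χ pr r.1 x).coeff h

lemma sumLE_of_neg (E : WeierstrassCurve (RatFunc k)) {x : ℂ} {h : G} {M : ℤ} (hM : M < 0) :
    sumLE E m χ pr x h M = 0 := by
  rw [sumLE, idealsLE_eq_empty hM, Finset.sum_empty]

/-- On ideals of degree d the power of |𝔯| is constant, equal to X^d with X = q^{s-t-1}, and the
ideals of degree exactly d are the difference of two truncations. -/
lemma coeff_dirichletTerm (E : WeierstrassCurve (RatFunc k)) (s t : ℂ) (h : G) (d : ℕ) :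
    (dirichletTerm E m χ pr s t d).coeff h = ((Nat.card k : ℂ) ^ (s - t - 1)) ^ d *
      (sumLE E m χ pr ((Nat.card k : ℂ) ^ (1 - 2 * s)) h d -
        sumLE E m χ pr ((Nat.card k : ℂ) ^ (1 - 2 * s)) h (d - 1)) := by
  classical
  set x := (Nat.card k : ℂ) ^ (1 - 2 * s)
  have h1 : idealsLE k d = idealsLE k (d - 1) ∪ (idealsLE k d).filter fun r => idealDeg r.1 = d := by
    ext r
    simp only [Finset.mem_union, Finset.mem_filter, mem_idealsLE]
    omega
  have h2 : Disjoint (idealsLE k ((d : ℤ) - 1))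
      ((idealsLE k d).filter fun r => idealDeg r.1 = d) := by
    rw [Finset.disjoint_left]
    intro r
    simp only [Finset.mem_filter, mem_idealsLE]
    omega
  have h3 : sumLE E m χ pr x h d - sumLE E m χ pr x h (d - 1) =
      ∑ r ∈ (idealsLE k d).filter fun r => idealDeg r.1 = d,
        (psiIdeal E r.1 : ℂ) * (sigmaG m χ pr r.1 x).coeff h := by
    have h4 := Finset.sum_union h2
      (f := fun r => (psiIdeal E r.1 : ℂ) * (sigmaG m χ pr r.1 x).coeff h)
    rw [← h1] at h4
    rw [sumLE, h4, sumLE, add_sub_cancel_left]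
  have hQ : (Nat.card k : ℂ) ≠ 0 := Nat.cast_ne_zero.mpr Nat.card_pos.ne'
  rw [h3, Finset.mul_sum, dirichletTerm,
    coeff_finsum_ite ((idealsLE k d).map ⟨Subtype.val, Subtype.val_injective⟩), Finset.sum_map,
    Finset.sum_filter]
  · refine Finset.sum_congr rfl fun r _ => ?_
    rw [Function.Embedding.coeFn_mk]
    by_cases hr : idealDeg r.1 = d
    · rw [if_pos ⟨r.2, hr⟩, if_pos hr, MonoidAlgebra.coeff_smul_apply, smul_eq_mul, idealAbs,
        zpow_cpow Nat.card_pos.ne', hr, show 1 + t - s = -(s - t - 1) by ring, Complex.cpow_neg,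
        inv_zpow', neg_neg, zpow_natCast, mul_assoc]
    · rw [if_neg fun h => hr h.2, if_neg hr]
  · rintro r ⟨h0, hr⟩
    rw [Finset.mem_map]
    exact ⟨⟨r, h0⟩, mem_idealsLE.mpr (by exact_mod_cast hr.le), rfl⟩

/-- Summation by parts: subtract X times the series, shifted by one. The differences vanish at
negative M, and the one at 0 is A(0) since A(-1) = 0. -/
lemma hasSum_telescope {A : ℤ → ℂ} {X W : ℂ} (hX : X ≠ 0) (h : HasSum (fun M => X ^ M * A M) W)
    (hA : ∀ M < 0, A M = 0) :
    HasSum (fun d : ℕ => X ^ d * (A d - A (d - 1))) ((1 - X) * W) := by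
  have h1 : HasSum (fun M : ℤ => X * (X ^ (M - 1) * A (M - 1))) (X * W) :=
    ((Equiv.subRight (1 : ℤ)).hasSum_iff.mpr h).mul_left X
  have h2 : HasSum (fun M : ℤ => X ^ M * (A M - A (M - 1))) ((1 - X) * W) := by
    rw [sub_mul, one_mul]
    refine (h.sub h1).congr_fun fun M => ?_
    rw [← mul_assoc, ← zpow_one_add₀ hX, add_sub_cancel, mul_sub]
  have h3 := (Nat.cast_injective (R := ℤ)).hasSum_iff (f := fun M : ℤ => X ^ M * (A M - A (M - 1)))
    (a := (1 - X) * W) fun M hM => by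
      have h4 : M < 0 := by
        by_contra h5
        exact hM ⟨M.toNat, Int.toNat_of_nonneg (not_lt.mp h5)⟩
      rw [hA M h4, hA (M - 1) (by omega), sub_zero, mul_zero]
  refine (h3.mpr h2).congr_fun fun d => ?_
  rw [Function.comp_apply, zpow_natCast]

end DivisorSums

/-! ### The L-series as a sum over all nonzero ideals -/

section LSeries

variable {k : Type*} [Field k] [Finite k] {G : Type*} [CommGroup G] {m : Ideal k[X]}
  {χ : (FinAdele k)ˣ →* ℂˣ} {pr : (Adele k)ˣ →* G}

lemma gSummable_idealTerm (hm : m ≠ ⊥) (hχ : IsDirichletCharacter m χ) {z : ℂ}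
    (hz : Nat.card k * ‖z‖ < 1) : GSummable fun a : NzIdeal k => idealTerm m χ pr z a.1 := by
  refine gSummable_single ?_
  refine Summable.of_norm_bounded (g := fun a : NzIdeal k => ‖z‖ ^ idealDeg a.1)
    ((summable_pow_natDegree (norm_nonneg z) hz).comp_injective generator_injective) fun a => ?_
  rw [norm_mul, norm_pow]
  exact mul_le_of_le_one_left (by positivity) (norm_chi0_le_one hm hχ _)

lemma gSummable_lTerm (hm : m ≠ ⊥) (hχ : IsDirichletCharacter m χ) {z : ℂ}
    (hz : Nat.card k * ‖z‖ < 1) : GSummable (lTerm m χ pr z) := fun h =>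
  (gSummable_idealTerm (pr := pr) hm hχ hz h).comp_injective
    (i := fun r : {r : Ideal k[X] // r ≠ ⊥ ∧ IsCoprime r m} => (⟨r.1, r.2.1⟩ : NzIdeal k))
    fun _ _ hr => Subtype.ext (congrArg (fun a : NzIdeal k => a.1) hr)

lemma gHasSum_idealTerm [Finite G] (hm : m ≠ ⊥) (hχ : IsDirichletCharacter m χ) {z : ℂ}
    (hz : Nat.card k * ‖z‖ < 1) :
    GHasSum (fun a : NzIdeal k => idealTerm m χ pr z a.1) (lSeries m χ pr z) := by
  intro h
  have h1 := (gSummable_lTerm (pr := pr) hm hχ hz).gHasSum h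
  have hinj : Function.Injective
      fun r : {r : Ideal k[X] // r ≠ ⊥ ∧ IsCoprime r m} => (⟨r.1, r.2.1⟩ : NzIdeal k) :=
    fun _ _ hr => Subtype.ext (congrArg (fun a : NzIdeal k => a.1) hr)
  refine (hinj.hasSum_iff (f := fun a : NzIdeal k => (idealTerm m χ pr z a.1).coeff h)
    fun a ha => ?_).mp h1
  rw [idealTerm_eq_zero hm a fun hc => ha ⟨⟨a.1, a.2, hc⟩, rfl⟩]
  rfl

end LSeries

section CellSeries

/-! ### The series over the cells -/

lemma hasSum_sigma_mul {P : Type*} {B : P → Type*} [∀ p, Finite (B p)] {K : P → ℂ}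
    {f : (Σ p, B p) → ℂ} {a : ℂ} (h : HasSum (fun i : Σ p, B p => K i.1 * f i) a) :
    HasSum (fun p => K p * ∑' b, f ⟨p, b⟩) a :=
  HasSum.sigma (f := fun i : Σ p, B p => K i.1 * f i) h fun p =>
    HasSum.mul_left (K p) (Summable.of_finite (f := fun b => f ⟨p, b⟩)).hasSum

/-- The substitution N = M + D - d, with d = deg 𝔞 and D = deg 𝔡, separates the variables. At x =
q^{-s}, y = q^{-t} the three factors are |𝔡|^{t-s}, the M-th power of q^{s-t-1}, and the d-th power
of q^{1-2s}. -/
lemma zpow_exponents {x y q : ℂ} (hx : x ≠ 0) (hy : y ≠ 0) (hq : q ≠ 0) (d D M : ℤ) :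
    x ^ (d - (M + (D - d))) * y ^ (d + (M + (D - d))) * q ^ (D - (M + (D - d))) =
      (y / x) ^ D * (y / (x * q)) ^ M * (q * x ^ 2) ^ d := by
  rw [show d - (M + (D - d)) = d + d - (M + D) by ring, show d + (M + (D - d)) = M + D by ring,
    show D - (M + (D - d)) = d - M by ring, zpow_sub₀ hx, zpow_add₀ hx, zpow_add₀ hx, zpow_add₀ hy,
    zpow_sub₀ hq, div_zpow, div_zpow, mul_zpow, mul_zpow, sq, mul_zpow]
  field_simp

variable {k : Type*} [Field k]

/-- The sum of the values of a form over the cells with parameters `a` and `N`. -/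
def cellSum (φ : GL2A k → ℚ) (p : NzIdeal k × ℤ) : ℂ :=
  ∑' β : {β : k[X] // β.degree < (Submodule.IsPrincipal.generator p.1.1).degree},
    ((φ (affineGL (cellIdele p.1 p.2) ((polyFin k β.1, 0) : Adele k)) : ℚ) : ℂ)

/-- The contribution of the cells with parameters `a` and `N`, up to a class in `G`. -/
def cellVal (m : Ideal k[X]) (χ : (FinAdele k)ˣ →* ℂˣ) (φ : GL2A k → ℚ) (x y : ℂ)
    (p : NzIdeal k × ℤ) : ℂ :=
  chiIdeal m χ p.1.1 * (x ^ ((idealDeg p.1.1 : ℤ) - p.2) * y ^ ((idealDeg p.1.1 : ℤ) + p.2)) *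
    cellSum φ p

variable {m n : Ideal k[X]} {χ : (FinAdele k)ˣ →* ℂˣ} {φ : GL2A k → ℚ} {x y : ℂ}

lemma form_cellRep (hφ : IsAutomorphicForm n φ) (i : CellIndex k) : φ (cellRep i) =
    φ (affineGL (cellIdele i.1.1 i.1.2.2) ((polyFin k i.2.1, 0) : Adele k)) :=
  hφ.left_invariant _ _

/-- Convergence over all cells is restricted to the slice where 𝔴 is the unit ideal; the factor from
𝔴 is nonzero there and can be divided out. -/
lemma summable_cellVal [Finite k] (hχ : IsDirichletCharacter m χ) (hφ : IsAutomorphicForm n φ) (hx : x ≠ 0)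
    (hy : y ≠ 0) (hs : Summable fun i => (φ (cellRep i) : ℂ) * secVal m χ x y (cellRep i)) :
    Summable (cellVal m χ φ x y) := by
  have h1 := hs.hasSum
  have h2 := hasSum_sigma_mul (P := NzIdeal k × NzIdeal k × ℤ)
    (B := fun p => {β : k[X] // β.degree < (Submodule.IsPrincipal.generator p.1.1).degree})
    (K := fun p => chiIdeal m χ p.2.1.1 * (y ^ 2) ^ idealDeg p.2.1.1 *
      (chiIdeal m χ p.1.1 * (x ^ ((idealDeg p.1.1 : ℤ) - p.2.2) *
        y ^ ((idealDeg p.1.1 : ℤ) + p.2.2))))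
    (f := fun i => ((φ (affineGL (cellIdele i.1.1 i.1.2.2)
      ((polyFin k i.2.1, 0) : Adele k)) : ℚ) : ℂ))
    (a := ∑' i, (φ (cellRep i) : ℂ) * secVal m χ x y (cellRep i))
    (h1.congr_fun fun i => by rw [form_cellRep hφ, secVal_cellRep hχ hx, mul_comm])
  let ι : NzIdeal k × ℤ → NzIdeal k × NzIdeal k × ℤ := fun p => (p.1, ⟨⊤, top_ne_bot⟩, p.2)
  have hι : Function.Injective ι := fun p p' h => by
    simp only [ι, Prod.mk.injEq] at h
    exact Prod.ext h.1 h.2.2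
  have h3 := h2.summable.comp_injective hι
  have hne : chiIdeal m χ ⊤ * (y ^ 2) ^ idealDeg (⊤ : Ideal k[X]) ≠ 0 :=
    mul_ne_zero (chiIdeal_top_ne_zero hχ) (pow_ne_zero _ (pow_ne_zero _ hy))
  rw [← summable_mul_left_iff hne]
  refine h3.congr fun p => ?_
  rw [cellVal, ← mul_assoc]
  rfl

variable {G : Type*} [CommGroup G] {pr : (Adele k)ˣ →* G}

/-- The contribution of the cells with parameters `a` and `N`. -/
def cellTerm (m : Ideal k[X]) (χ : (FinAdele k)ˣ →* ℂˣ) (pr : (Adele k)ˣ →* G) (φ : GL2A k → ℚ)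
    (x y : ℂ) (p : NzIdeal k × ℤ) : MonoidAlgebra ℂ G :=
  MonoidAlgebra.single (idealClass pr p.1.1)⁻¹ (cellVal m χ φ x y p)

lemma coeff_idealTerm_mul_cellTerm (w : NzIdeal k) (p : NzIdeal k × ℤ) (h : G)
    [Decidable ((idealClass pr w.1)⁻¹ * (idealClass pr p.1.1)⁻¹ = h)] :
    (idealTerm m χ pr (y ^ 2) w.1 * cellTerm m χ pr φ x y p).coeff h =
      (if (idealClass pr w.1)⁻¹ * (idealClass pr p.1.1)⁻¹ = h then
        chiIdeal m χ w.1 * (y ^ 2) ^ idealDeg w.1 * (chiIdeal m χ p.1.1 *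
          (x ^ ((idealDeg p.1.1 : ℤ) - p.2) * y ^ ((idealDeg p.1.1 : ℤ) + p.2))) else 0) *
        cellSum φ p := by
  rw [idealTerm, cellTerm, MonoidAlgebra.single_mul_single, MonoidAlgebra.coeff_single,
    Finsupp.single_apply, cellVal]
  split_ifs
  · ring
  · rw [zero_mul]

/-- Neither φ nor the residues β involve 𝔴, so the absolutely convergent sum over the cells is a
product in ℂ[G] of a series over 𝔴 and one over (𝔞, N). -/
lemma eq_smul_of_hasSum_cells [Finite k] [Finite G] (hm : m ≠ ⊥) (hχ : IsDirichletCharacter m χ)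
    (hφ : IsAutomorphicForm n φ) (hx : x ≠ 0) (hy2 : Nat.card k * ‖y ^ 2‖ < 1)
    (hv : Summable (cellVal m χ φ x y)) {c : ℂ} {I : MonoidAlgebra ℂ G}
    (hI : ∀ h, HasSum (fun i => c * ((φ (cellRep i) : ℂ) * secCoeff m χ pr x y h (cellRep i)))
      (I.coeff h)) :
    I = c • (lSeries m χ pr (y ^ 2) * gsum (cellTerm m χ pr φ x y)) := by
  classical
  refine monoidAlgebra_ext fun h => ?_
  have h2 := hasSum_sigma_mul (P := NzIdeal k × NzIdeal k × ℤ)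
    (B := fun p => {β : k[X] // β.degree < (Submodule.IsPrincipal.generator p.1.1).degree})
    (K := fun p => c * (if (idealClass pr p.2.1.1)⁻¹ * (idealClass pr p.1.1)⁻¹ = h then
      chiIdeal m χ p.2.1.1 * (y ^ 2) ^ idealDeg p.2.1.1 *
      (chiIdeal m χ p.1.1 * (x ^ ((idealDeg p.1.1 : ℤ) - p.2.2) *
        y ^ ((idealDeg p.1.1 : ℤ) + p.2.2))) else 0))
    (f := fun i => ((φ (affineGL (cellIdele i.1.1 i.1.2.2)
      ((polyFin k i.2.1, 0) : Adele k)) : ℚ) : ℂ)) (a := I.coeff h)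
    ((hI h).congr_fun fun i => by
      rw [form_cellRep hφ, secCoeff, secVal_cellRep hχ hx, secClass_cellRep, mul_comm
        ((φ (affineGL (cellIdele i.1.1 i.1.2.2) ((polyFin k i.2.1, 0) : Adele k)) : ℚ) : ℂ),
        ← mul_assoc c])
  have h3 : GHasSum (cellTerm m χ pr φ x y) (gsum (cellTerm m χ pr φ x y)) :=
    (gSummable_single hv).gHasSum
  have h4 := ((gHasSum_idealTerm (pr := pr) hm hχ hy2).mul h3 h).mul_left c
  -- A cell lists 𝔞 before 𝔴, while the product of series lists 𝔴 first.
  let e : NzIdeal k × NzIdeal k × ℤ ≃ NzIdeal k × NzIdeal k × ℤ :=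
    ⟨fun p => (p.2.1, p.1, p.2.2), fun p => (p.2.1, p.1, p.2.2), fun _ => rfl, fun _ => rfl⟩
  rw [← e.hasSum_iff] at h4
  rw [MonoidAlgebra.coeff_smul_apply, smul_eq_mul]
  refine h2.unique (h4.congr_fun fun p => ?_)
  rw [Function.comp_apply]
  change _ = c * (idealTerm m χ pr (y ^ 2) p.2.1.1 * cellTerm m χ pr φ x y (p.1, p.2.2)).coeff h
  rw [coeff_idealTerm_mul_cellTerm, mul_assoc]
  rfl

variable [Finite k] {E : WeierstrassCurve (RatFunc k)} {τ : AddChar (Adele k) ℂ} {δ : (Adele k)ˣ}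

open scoped Classical in
lemma cellSum_eq (hE : IsSplitAtInf E) (hτ : IsAdditiveCharacter τ δ)
    (hφ : IsFourierCoefficient τ δ φ fun D => ((Divisor.abs D : ℝ) : ℂ) * (psi E D : ℂ))
    (a : NzIdeal k) (N : ℤ) : cellSum φ (a, N) =
      (Nat.card kˣ : ℂ) * ((Nat.card k : ℂ) ^ (ideleDeg δ - N) *
        ∑ r ∈ idealsLE k (N - ideleDeg δ + idealDeg a.1),
          if a.1 ∣ r.1 then (psiIdeal E r.1 : ℂ) else 0) := by
  have h1 := hasSum_cell hE hτ hφ a N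
  have h2 := ((hasSum_multiples (fun r => (psiIdeal E r : ℂ)) a
    (N - ideleDeg δ + idealDeg a.1)).mul_left ((Nat.card k : ℂ) ^ (ideleDeg δ - N))).mul_left
      (Nat.card kˣ : ℂ)
  refine h1.unique (h2.congr_fun fun e => ?_)
  rw [cellCoeff]
  congr 2
  refine if_congr ?_ rfl rfl
  omega

open scoped Classical in
lemma coeff_cellTerm (hx : x ≠ 0) (hy : y ≠ 0) (hE : IsSplitAtInf E)
    (hτ : IsAdditiveCharacter τ δ)
    (hφ : IsFourierCoefficient τ δ φ fun D => ((Divisor.abs D : ℝ) : ℂ) * (psi E D : ℂ))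
    (h : G) (a : NzIdeal k) (M : ℤ) :
    (cellTerm m χ pr φ x y (a, M + (ideleDeg δ - idealDeg a.1))).coeff h =
      (Nat.card kˣ : ℂ) * (y / x) ^ ideleDeg δ * ((y / (x * Nat.card k)) ^ M *
        ((idealTerm m χ pr (Nat.card k * x ^ 2) a.1).coeff h *
          ∑ r ∈ idealsLE k M, if a.1 ∣ r.1 then (psiIdeal E r.1 : ℂ) else 0)) := by
  have hq : (Nat.card k : ℂ) ≠ 0 := Nat.cast_ne_zero.mpr Nat.card_pos.ne'
  have h1 := zpow_exponents hx hy hq (idealDeg a.1) (ideleDeg δ) M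
  have h2 : M + (ideleDeg δ - idealDeg a.1) - ideleDeg δ + idealDeg a.1 = M := by ring
  rw [cellTerm, idealTerm, MonoidAlgebra.coeff_single, MonoidAlgebra.coeff_single,
    Finsupp.single_apply, Finsupp.single_apply, cellVal, cellSum_eq hE hτ hφ]
  simp only [h2]
  split_ifs
  · rw [zpow_natCast] at h1
    linear_combination (chiIdeal m χ a.1 * (Nat.card kˣ : ℂ) *
      ∑ r ∈ idealsLE k M, if a.1 ∣ r.1 then (psiIdeal E r.1 : ℂ) else 0) * h1
  · rw [zero_mul, mul_zero, mul_zero]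

/-- For fixed M the sum over 𝔞 assembles the divisor sums σ(𝔯) for all 𝔯 of degree at most M,
because the powers of x, y and q depending on 𝔞 combine to (qx²)^{deg 𝔞}. -/
lemma hasSum_sumLE [Finite G] (hm : m ≠ ⊥) (hx : x ≠ 0) (hy : y ≠ 0) (hE : IsSplitAtInf E)
    (hτ : IsAdditiveCharacter τ δ)
    (hφ : IsFourierCoefficient τ δ φ fun D => ((Divisor.abs D : ℝ) : ℂ) * (psi E D : ℂ))
    (hv : Summable (cellVal m χ φ x y)) (h : G) :
    HasSum (fun M : ℤ => (Nat.card kˣ : ℂ) * (y / x) ^ ideleDeg δ *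
      ((y / (x * Nat.card k)) ^ M * sumLE E m χ pr (Nat.card k * x ^ 2) h M))
      ((gsum (cellTerm m χ pr φ x y)).coeff h) := by
  classical
  have h1 : HasSum (fun p => (cellTerm m χ pr φ x y p).coeff h)
      ((gsum (cellTerm m χ pr φ x y)).coeff h) := (gSummable_single hv).gHasSum h
  -- The shear N = M + deg 𝔡 - deg 𝔞 makes the degree bound on 𝔯 independent of 𝔞.
  let e : ℤ × NzIdeal k ≃ NzIdeal k × ℤ := (Equiv.prodComm _ _).trans
    (Equiv.prodShear (Equiv.refl _) fun a => Equiv.addRight (ideleDeg δ - idealDeg a.1))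
  rw [← e.hasSum_iff] at h1
  refine HasSum.prod_fiberwise h1 fun M => ?_
  have h2 := ((hasSum_divisorSums (fun r => (psiIdeal E r : ℂ))
    (fun a => (idealTerm m χ pr (Nat.card k * x ^ 2) a.1).coeff h) M).mul_left
      ((y / (x * Nat.card k)) ^ M)).mul_left ((Nat.card kˣ : ℂ) * (y / x) ^ ideleDeg δ)
  have h3 : sumLE E m χ pr (Nat.card k * x ^ 2) h M = ∑ r ∈ idealsLE k M, (psiIdeal E r.1 : ℂ) *
      ∑ a ∈ idealsLE k M,
        if a.1 ∣ r.1 then (idealTerm m χ pr (Nat.card k * x ^ 2) a.1).coeff h else 0 :=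
    Finset.sum_congr rfl fun r hr => by rw [coeff_sigmaG hm r (mem_idealsLE.mp hr)]
  rw [h3]
  exact h2.congr_fun fun a => coeff_cellTerm hx hy hE hτ hφ h a M

end CellSeries

/-! ### Size of the parameters `q^{-s}` and `q^{-t}` -/

section Powers

lemma card_mul_norm_cpow_lt_one {q : ℕ} (hq : 1 < q) {s : ℂ} (hs : 1 < s.re) :
    q * ‖(q : ℂ) ^ (-s)‖ < 1 := by
  have h0 : (0 : ℝ) < q := by positivity
  rw [Complex.norm_natCast_cpow_of_pos (by omega), Complex.neg_re]
  calc (q : ℝ) * (q : ℝ) ^ (-s.re) = (q : ℝ) ^ (1 + -s.re) := by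
        rw [Real.rpow_add h0, Real.rpow_one]
    _ < 1 := Real.rpow_lt_one_of_one_lt_of_neg (by exact_mod_cast hq) (by linarith)

lemma card_mul_norm_sq_lt_one {q : ℕ} (hq : 1 < q) {y : ℂ} (hy : q * ‖y‖ < 1) :
    q * ‖y ^ 2‖ < 1 := by
  have h1 : (1 : ℝ) ≤ q := by exact_mod_cast hq.le
  have h2 : ‖y‖ ≤ 1 := (le_mul_of_one_le_left (norm_nonneg y) h1).trans hy.le
  refine lt_of_le_of_lt ?_ hy
  rw [norm_pow]
  exact mul_le_mul_of_nonneg_left (pow_le_of_le_one (norm_nonneg y) h2 two_ne_zero) (by linarith)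

end Powers

/-! ### Assembling the formula -/

section Formula

variable {k : Type*} [Field k] [Finite k] {G : Type*} [CommGroup G] [Finite G] {m n : Ideal k[X]}
  {χ : (FinAdele k)ˣ →* ℂˣ} {pr : (Adele k)ˣ →* G} {E : WeierstrassCurve (RatFunc k)}
  {τ : AddChar (Adele k) ℂ} {δ : (Adele k)ˣ} {φ : GL2A k → ℚ} {s t : ℂ}

/-- The Dirichlet series inherits its convergence from the sum over the cells by telescoping,
whether or not q^{s-t-1} is 1; only solving for the cell sum requires 1 - q^{s-t-1} to be nonzero.
-/
lemma hasSum_dirichletTerm (hm : m ≠ ⊥) (hE : IsSplitAtInf E) (hτ : IsAdditiveCharacter τ δ)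
    (hφ : IsFourierCoefficient τ δ φ fun D => ((Divisor.abs D : ℝ) : ℂ) * (psi E D : ℂ))
    (hv : Summable (cellVal m χ φ ((Nat.card k : ℂ) ^ (-s)) ((Nat.card k : ℂ) ^ (-t)))) (h : G) :
    HasSum (fun d => (dirichletTerm E m χ pr s t d).coeff h)
      ((1 - (Nat.card k : ℂ) ^ (s - t - 1)) *
        (((Nat.card kˣ : ℂ) * ((ideleAbs δ : ℝ) : ℂ) ^ (t - s))⁻¹ *
          (gsum (cellTerm m χ pr φ ((Nat.card k : ℂ) ^ (-s)) ((Nat.card k : ℂ) ^ (-t)))).coeff h)) := by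
  have hq : (Nat.card k : ℂ) ≠ 0 := Nat.cast_ne_zero.mpr Nat.card_pos.ne'
  have hu : (Nat.card kˣ : ℂ) ≠ 0 := Nat.cast_ne_zero.mpr Nat.card_pos.ne'
  have hne : ∀ z : ℂ, (Nat.card k : ℂ) ^ z ≠ 0 := fun z => by
    rw [Ne, Complex.cpow_eq_zero_iff]
    exact fun h => hq h.1
  have h1 := hasSum_sumLE (pr := pr) hm (hne (-s)) (hne (-t)) hE hτ hφ hv h
  have e1 : (Nat.card k : ℂ) ^ (-t) / (Nat.card k : ℂ) ^ (-s) = (Nat.card k : ℂ) ^ (s - t) := by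
    rw [← Complex.cpow_sub _ _ hq]
    congr 1
    ring
  have e2 : (Nat.card k : ℂ) ^ (-t) / ((Nat.card k : ℂ) ^ (-s) * Nat.card k) =
      (Nat.card k : ℂ) ^ (s - t - 1) := by
    rw [← div_div, e1, Complex.cpow_sub _ 1 hq, Complex.cpow_one]
  have e3 : (Nat.card k : ℂ) * ((Nat.card k : ℂ) ^ (-s)) ^ 2 = (Nat.card k : ℂ) ^ (1 - 2 * s) := by
    rw [← Complex.cpow_nat_mul, sub_eq_add_neg, Complex.cpow_add _ _ hq, Complex.cpow_one]
    congr 2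
    push_cast
    ring
  have e4 : ((ideleAbs δ : ℝ) : ℂ) ^ (t - s) = ((Nat.card k : ℂ) ^ (s - t)) ^ ideleDeg δ := by
    rw [ideleAbs, Divisor.abs, zpow_cpow Nat.card_pos.ne', ← neg_sub s t, Complex.cpow_neg,
      inv_zpow', neg_neg]
    rfl
  rw [e1, e2, e3, ← e4] at h1
  have hc : (Nat.card kˣ : ℂ) * ((ideleAbs δ : ℝ) : ℂ) ^ (t - s) ≠ 0 := by
    rw [e4]
    exact mul_ne_zero hu (zpow_ne_zero _ (hne _))
  have h2 := h1.mul_left ((Nat.card kˣ : ℂ) * ((ideleAbs δ : ℝ) : ℂ) ^ (t - s))⁻¹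
  simp only [inv_mul_cancel_left₀ hc] at h2
  refine (hasSum_telescope (hne _) h2 fun M hM => sumLE_of_neg E hM).congr_fun fun d => ?_
  exact coeff_dirichletTerm E s t h d

lemma gsum_cellTerm_eq (hm : m ≠ ⊥) (hE : IsSplitAtInf E) (hτ : IsAdditiveCharacter τ δ)
    (hφ : IsFourierCoefficient τ δ φ fun D => ((Divisor.abs D : ℝ) : ℂ) * (psi E D : ℂ))
    (hv : Summable (cellVal m χ φ ((Nat.card k : ℂ) ^ (-s)) ((Nat.card k : ℂ) ^ (-t))))
    (hX : (Nat.card k : ℂ) ^ (s - t - 1) ≠ 1) :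
    gsum (cellTerm m χ pr φ ((Nat.card k : ℂ) ^ (-s)) ((Nat.card k : ℂ) ^ (-t))) =
      ((Nat.card kˣ : ℂ) * (((ideleAbs δ : ℝ) : ℂ) ^ (t - s) /
        (1 - (Nat.card k : ℂ) ^ (s - t - 1)))) • gsum (dirichletTerm E m χ pr s t) := by
  have hq : (Nat.card k : ℝ) ≠ 0 := Nat.cast_ne_zero.mpr Nat.card_pos.ne'
  have hu : (Nat.card kˣ : ℂ) ≠ 0 := Nat.cast_ne_zero.mpr Nat.card_pos.ne'
  have hδ : ((ideleAbs δ : ℝ) : ℂ) ^ (t - s) ≠ 0 := by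
    rw [Ne, Complex.cpow_eq_zero_iff]
    exact fun h => zpow_ne_zero _ hq (Complex.ofReal_eq_zero.mp h.1)
  refine monoidAlgebra_ext fun h => ?_
  have h1 := hasSum_dirichletTerm (pr := pr) hm hE hτ hφ hv h
  have h2 : (gsum (dirichletTerm E m χ pr s t)).coeff h = _ := h1.tsum_eq
  rw [MonoidAlgebra.coeff_smul_apply, h2, smul_eq_mul]
  have h3 := sub_ne_zero.mpr hX.symm
  field_simp

theorem integral_eisenstein_mul_form (hm : m ≠ ⊥) (hnm : n ∣ m) (hχ : IsDirichletCharacter m χ)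
    (hpr : IsFiniteQuotient pr) (hE : IsSplitAtInf E) (hτ : IsAdditiveCharacter τ δ)
    (hφ : IsNormalizedHeckeEigenform E n τ δ φ) (μG : Measure (PGL2A k)) [μG.IsHaarMeasure]
    (hμ1 : μG ((QuotientGroup.mk : GL2A k → PGL2A k) '' GL2O k) = 1)
    {𝓕 : Set (PGL2A k)} (h𝓕 : IsFundamentalDomain (rationalSubgroup k) 𝓕 μG)
    (hs : 1 < s.re) (ht : 1 < t.re) :
    GIntegrable (integrand m χ pr φ ((Nat.card k : ℂ) ^ (-s)) ((Nat.card k : ℂ) ^ (-t)))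
        (μG.restrict 𝓕) ∧
      GSummable (dirichletTerm E m χ pr s t) ∧
      ((Nat.card k : ℂ) ^ (s - t - 1) ≠ 1 →
        gintegral (integrand m χ pr φ ((Nat.card k : ℂ) ^ (-s)) ((Nat.card k : ℂ) ^ (-t)))
            (μG.restrict 𝓕) =
          (((Nat.card k : ℂ) - 1) * (muConst μG m : ℂ) * (((ideleAbs δ : ℝ) : ℂ) ^ (t - s) /
              (1 - (Nat.card k : ℂ) ^ (s - t - 1)))) •
            (lSeries m χ pr ((Nat.card k : ℂ) ^ (-2 * t)) * gsum (dirichletTerm E m χ pr s t))) := by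
  have hq : 1 < Nat.card k := Finite.one_lt_card
  have hq0 : (Nat.card k : ℂ) ≠ 0 := Nat.cast_ne_zero.mpr Nat.card_pos.ne'
  have hne : ∀ z : ℂ, (Nat.card k : ℂ) ^ z ≠ 0 := fun z => by
    rw [Ne, Complex.cpow_eq_zero_iff]
    exact fun h => hq0 h.1
  have hqx := card_mul_norm_cpow_lt_one hq hs
  have hqy := card_mul_norm_cpow_lt_one hq ht
  have key := fun h => hasSum_integrand hm hnm hχ hpr hφ.automorphic hφ.cuspidal μG hμ1 h𝓕
    (hne (-s)) (hne (-t)) hqx hqy h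
  -- Summability over the cells does not involve the class in G, so it is read off at the class 1.
  have hv := summable_cellVal hχ hφ.automorphic (hne (-s)) (hne (-t)) (key 1).1
  refine ⟨fun h => (key h).2.1,
    fun h => (hasSum_dirichletTerm (pr := pr) hm hE hτ hφ.fourier hv h).summable, fun hX => ?_⟩
  have h1 := eq_smul_of_hasSum_cells hm hχ hφ.automorphic (hne (-s))
    (card_mul_norm_sq_lt_one hq hqy) hv (c := (μG.real (k0Bar m) : ℂ) * (Nat.card kˣ : ℂ))
    (I := gintegral (integrand m χ pr φ ((Nat.card k : ℂ) ^ (-s)) ((Nat.card k : ℂ) ^ (-t)))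
      (μG.restrict 𝓕)) fun h => (key h).2.2.congr_fun fun i => by rw [mul_assoc]
  have e1 : ((Nat.card k : ℂ) ^ (-t)) ^ 2 = (Nat.card k : ℂ) ^ (-2 * t) := by
    rw [← Complex.cpow_nat_mul]
    congr 1
    push_cast
    ring
  have e2 : (Nat.card kˣ : ℂ) = Nat.card k - 1 := by
    rw [Nat.card_units, Nat.cast_sub hq.le, Nat.cast_one]
  have e3 : (muConst μG m : ℂ) = ((Nat.card k : ℂ) - 1) * (μG.real (k0Bar m) : ℂ) := by
    rw [muConst, coe_k0Bar]
    push_cast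
    rfl
  -- Two factors q - 1 occur, one from the fibres over PGL₂(F) and one from the constants in the
  -- Fourier expansion; the first is absorbed in μ(𝔪).
  rw [h1, gsum_cellTerm_eq hm hE hτ hφ.fourier hv hX, e1, e2, e3, mul_smul_comm, smul_smul]
  congr 1
  ring

end Formula

end RankinSelberg

end

theorem theorem6p14 {k : Type*} [Field k] [Finite k]
    (m n : Ideal k[X]) (hm : m ≠ ⊥) (hnm : n ∣ m)
    (χ : (RankinSelberg.FinAdele k)ˣ →* ℂˣ) (hχ : RankinSelberg.IsDirichletCharacter m χ)
    (hχ1 : χ ≠ 1)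
    {G : Type*} [CommGroup G] [Finite G] (pr : (RankinSelberg.Adele k)ˣ →* G)
    (hpr : RankinSelberg.IsFiniteQuotient pr)
    (E : WeierstrassCurve (RatFunc k)) [E.IsElliptic] (hE : RankinSelberg.IsSplitAtInf E)
    (τ : AddChar (RankinSelberg.Adele k) ℂ) (δ : (RankinSelberg.Adele k)ˣ)
    (hτ : RankinSelberg.IsAdditiveCharacter τ δ)
    (φ : RankinSelberg.GL2A k → ℚ) (hφ : RankinSelberg.IsNormalizedHeckeEigenform E n τ δ φ)
    (μG : Measure (RankinSelberg.PGL2A k)) (hμ : μG.IsHaarMeasure)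
    (hμ1 : μG ((QuotientGroup.mk : RankinSelberg.GL2A k → RankinSelberg.PGL2A k) ''
      RankinSelberg.GL2O k) = 1)
    (𝓕 : Set (RankinSelberg.PGL2A k))
    (h𝓕 : IsFundamentalDomain (RankinSelberg.rationalSubgroup k) 𝓕 μG)
    (s t : ℂ) (hs : 1 < s.re) (ht : 1 < t.re) :
    let q : ℂ := (Nat.card k : ℂ)
    (∀ g : RankinSelberg.GL2A k,
      RankinSelberg.GSummable (RankinSelberg.eisTerm m χ pr g (q ^ (-s)) (q ^ (-t)))) ∧
    (∀ (γ : GL (Fin 2) (RatFunc k)) (g : RankinSelberg.GL2A k),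
      ∀ z ∈ Subgroup.center (RankinSelberg.GL2A k),
        RankinSelberg.eisenstein m χ pr (RankinSelberg.diagGL k γ * g * z) (q ^ (-s)) (q ^ (-t)) =
          RankinSelberg.eisenstein m χ pr g (q ^ (-s)) (q ^ (-t))) ∧
    RankinSelberg.GIntegrable
      (RankinSelberg.integrand m χ pr φ (q ^ (-s)) (q ^ (-t))) (μG.restrict 𝓕) ∧
    RankinSelberg.GSummable (RankinSelberg.lTerm m χ pr (q ^ (-2 * t))) ∧
    RankinSelberg.GSummable (RankinSelberg.dirichletTerm E m χ pr s t) ∧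
    (q ^ (s - t - 1) ≠ 1 →
      RankinSelberg.gintegral
          (RankinSelberg.integrand m χ pr φ (q ^ (-s)) (q ^ (-t))) (μG.restrict 𝓕) =
        ((q - 1) * (RankinSelberg.muConst μG m : ℂ) *
            (((RankinSelberg.ideleAbs δ : ℝ) : ℂ) ^ (t - s) / (1 - q ^ (s - t - 1)))) •
          (RankinSelberg.lSeries m χ pr (q ^ (-2 * t)) *
            RankinSelberg.gsum (RankinSelberg.dirichletTerm E m χ pr s t))) := by
  have hq : 1 < Nat.card k := Finite.one_lt_card
  have hne : ∀ z : ℂ, (Nat.card k : ℂ) ^ z ≠ 0 := fun z => by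
    rw [Ne, Complex.cpow_eq_zero_iff]
    exact fun h => Nat.card_pos.ne' (Nat.cast_eq_zero.mp h.1)
  have hqx := RankinSelberg.card_mul_norm_cpow_lt_one hq hs
  have hqy := RankinSelberg.card_mul_norm_cpow_lt_one hq ht
  have hqz : Nat.card k * ‖(Nat.card k : ℂ) ^ (-2 * t)‖ < 1 := by
    rw [neg_mul]
    refine RankinSelberg.card_mul_norm_cpow_lt_one hq ?_
    rw [Complex.mul_re, Complex.re_ofNat, Complex.im_ofNat, zero_mul, sub_zero]
    linarith
  obtain ⟨h1, h2, h3⟩ := RankinSelberg.integral_eisenstein_mul_form (pr := pr) hm hnm hχ hpr hE hτ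
    hφ μG hμ1 h𝓕 hs ht
  refine ⟨fun g => ?_, fun γ g z hz => ?_, h1, RankinSelberg.gSummable_lTerm hm hχ hqz, h2, h3⟩
  · exact RankinSelberg.gsummable_eisTerm hχ hpr (hne _) (hne _) g
      (RankinSelberg.summable_secVal hm hχ (hne _) (hne _) hqx hqy g)
  · rw [RankinSelberg.eisenstein_mul_center hm hχ hpr (hne _) (hne _) _ hz,
      RankinSelberg.eisenstein_diagGL_mul hχ hpr]
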